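/- **Setting.** Let $T_0>0$, $d\in\mathbb N$, $0<\sigma<d$, $0<n_0<d-1$. *Clock.* On $\mathbb C^d$ with orthonormal basis $|E_0\rangle,\dots,|E_{d-1}\rangle$ let $\hat H_c=\sum_{n}\frac{2\pi n}{T_0}|E_n\rangle\langle E_n|$ and $|\theta_k\rangle=d^{-1/2}\sum_n e^{-2\pi i nk/d}|E_n\rangle$ $(k\in\mathbb Z)$. Let $\mathcal S_d(k_0)$ be the set of the $d$ integers $k$ with $-d/2\le k_0-k<d/2$, $S(k_0)=\sum_{k\in\mathcal S_d(k_0)}e^{-\frac{2\pi}{\sigma^2}(k-k_0)^2}$, $A(\sigma;k_0)=S(k_0)^{-1/2}$, $A=A(\sigma;0)$, $\psi_{\rm nor}(k_0;x)=A(\sigma;k_0)\,e^{-\frac{\pi}{\sigma^2}(x-k_0)^2}e^{2\pi i n_0(x-k_0)/d}$ and $|\Psi_{\rm nor}(k_0)\rangle=\sum_{k\in\mathcal S_d(k_0)}\psi_{\rm nor}(k_0;k)|\theta_k\rangle$. *Potential.* $V_0:\mathbb R\to\mathbb R$ is smooth, $2\pi$-periodic, nonnegative, $\int_0^{2\pi}V_0=1$,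 with a unique global maximum on $[0,2\pi]$, at $x_0$. Put $V_d(x)=\frac{2\pi}{d}V_0(2\pi x/d)$ and $\hat V_d=\frac d{T_0}\sum_{k=0}^{d-1}V_d(k)|\theta_k\rangle\langle\theta_k|$. Let $0<x_{vr}\le\pi$ and $0<\gamma\le1$ satisfy $x_{vr}+\pi\gamma\le x_0\le 2\pi-x_{vr}-\pi\gamma$, and let $$\tilde\epsilon_V=1-\int_{-x_{vr}}^{x_{vr}}V_0(x+x_0)\,dx,\qquad t_1=\tfrac{T_0}{2\pi}(x_0-x_{vr}-\pi\gamma),\qquad t_2=\tfrac{T_0}{2\pi}(x_0+x_{vr}+\pi\gamma).$$ *System.* $H_s,H_{int}$ are commuting Hermitian $d_s\times d_s$ matrices, the eigenvalues of $H_{int}$ lie in $[-\pi,\pi)$, and $\rho$ is a density matrix. For an integrable pulse $g\ge0$ vanishing outside $[t_1,t_2]$ with $\int_{t_1}^{t_2} g=1$ let $\rho_s(t)=U\rho U^\dagger$ with $U=e^{-itH_s}e^{-iH_{int}\int_{t_1}^tg}$ (the pulse-driven state). The autonomously evolved state is $\rho_s'(t)=\mathrm{tr}_c\big[e^{-itH}(\rho\otimes|\Psi_{\rm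 nor}(0)\rangle\langle\Psi_{\rm nor}(0)|)e^{itH}\big]$ with $H=H_s\otimes1+1\otimes\hat H_c+H_{int}\otimes\hat V_d$. The trace norm $\|\cdot\|_1$ is the sum of the singular values. *Clock error.* Let $b\in\mathbb R$ satisfy $b\ge\sup_{k\ge1}\big(2\max_{[0,2\pi]}|(\pi V_0)^{(k-1)}|\big)^{1/k}$, $\kappa=0.792$, $\alpha_0=\frac2{d-1}\min\{n_0,d-1-n_0\}$, $\bar\upsilon=\frac{\pi\alpha_0\kappa}{\ln(\pi\alpha_0^2\sigma^2)}b$ and $\mathcal N=\Big\lfloor\frac{\pi\alpha_0^2}{2(\bar\upsilon+d/\sigma^2)^2}\big(\tfrac d\sigma\big)^2\Big\rfloor$. Let $$\bar\epsilon_2=\begin{cases}(2\pi)^{5/4}\sigma^{3/2}A\big(1+\tfrac{\pi^2}8\big)\sqrt{\tfrac e2\tfrac{\alpha_0}{\bar\upsilon\sigma^2/d+1}}\;\exp\!\Big(-\tfrac\pi4\tfrac{\alpha_0^2}{(d/\sigma^2+\bar\upsilon)^2}\big(\tfrac d\sigma\big)^2\Big)&\text{if }\mathcal N\ge8,\ \pi\alpha_0^2\sigma^2>1,\\[4pt]\frac{3^{7/4}}{\sqrt{2\pi}\,e}\frac{A(8+\pi^2)}{\alpha_0^3}\Big(\frac{\kappa\sqrt{6\pi}}{\ln3}b+\frac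 d\sigma\Big)^3\frac\sigma{d^3}&\text{otherwise,}\end{cases}$$ $$\epsilon_T=\bar\epsilon_2+2A\Big(\tfrac{2\pi}{1-e^{-\pi d/\sigma^2}}+\tfrac{b+2\pi/d}{1-e^{-\pi d^2/\sigma^2}}+\tfrac{2\pi d}{\sigma^2}+\tfrac{\pi d^2}{\sigma^2}+\tfrac1d\Big)e^{-\frac\pi4\frac{d^2}{\sigma^2}},$$ $$\bar\epsilon_{step}=2Ae^{-\frac{\pi d^2}{4\sigma^2}},\qquad \epsilon_{\rm nor}(t)=\Big|\sqrt{S(dt/T_0)/S(0)}-1\Big|,\qquad \varepsilon_v(t,d)=|t|\tfrac d{T_0}\epsilon_T+\big(|t|\tfrac d{T_0}+1\big)\bar\epsilon_{step}+\epsilon_{\rm nor}(t).$$ *System error.* Let $\epsilon_k=2\pi\big|\int_0^{2\pi t/T_0}(V_0(x)-V_0(x+2\pi k/d))\,dx\big|$, $$\epsilon_V(t,d)=\sup_{s\in[0,1]}\ \sum_{j=0}^{d}(\epsilon_{k_j}^2+\epsilon_{k_j})\,|\psi_{\rm nor}(0;k_j)|^2,\qquad k_j=-\tfrac d2+s+j,$$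 $$B=4\pi\Big((1+2\pi)A^2\frac{e^{-2\pi\tilde\kappa d^2/\sigma^2}}{1-e^{-4\pi\sqrt{\tilde\kappa}\,d/\sigma^2}}+2\tilde\epsilon_V(1+8\pi\tilde\epsilon_V)\Big),\qquad\tilde\kappa=\begin{cases}0&d\gamma/2\le1,\\(\gamma/2-1/d)^2&\text{otherwise,}\end{cases}$$ where $B=+\infty$ if $\tilde\kappa=0$, and $\varepsilon_s=B+2\pi T_0\tilde\epsilon_V(2\pi T_0\tilde\epsilon_V+1)$. **Theorem.** (I) If $0\le 2\pi t/T_0\le x_0-x_{vr}-\pi\gamma$ or $x_0+x_{vr}+\pi\gamma\le 2\pi t/T_0\le2\pi+x_0-x_{vr}-\pi\gamma$, then $\epsilon_V(t,d)\le B$. (II) For every system, every pulse $g$ as above and all $t\in[0,t_1]\cup[t_2,T_0]$, $$\|\rho_s(t)-\rho_s'(t)\|_1\le\sqrt{d_s\,\mathrm{tr}[\rho^2]}\,\big(2\varepsilon_v(t,d)+\varepsilon_v(t,d)^2+\varepsilon_s\big),$$ and the same bound holds with $\varepsilon_s$ replaced by $\epsilon_V(t,d)+2\pi\tilde\epsilon_V(2\pi\tilde\epsilon_V+1)$.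 (III) Let $V_0(x)=A_c\cos^{2n}\!\big(\tfrac{x-x_0}2\big)$, $A_c=\frac{2^{2n}}{2\pi\binom{2n}n}$. For every $n\ge1$ it satisfies the conditions on $V_0$, and $b=\frac{2e^2}{(2\pi)^{3/2}}\frac{\pi}{\sqrt2}\,n\sqrt n$ is admissible. Fix $T_0,x_0,x_{vr},\gamma$ as above and let $\sigma=\sqrt d$, $0<n_0(d)<d-1$ with $\alpha_0\ge\alpha>0$ for all $d\ge2$, and let $n=n(d)\in\mathbb N$ satisfy $c_1d^{1/4}\sqrt{\ln d}\le n(d)\le c_2d^{1/4}\sqrt{\ln d}$ for all large $d$, with constants $c_1>0$ and $c_2$. Then, with this value of $b$, there are $c>0$, $C$ and $p\in\mathbb N$ such that for all large $d$ one has $\tilde\kappa>0$ and $$2\varepsilon_v(t,d)+\varepsilon_v(t,d)^2+\varepsilon_s\le C\,d^{\,p}\,e^{-c\,d^{1/4}\sqrt{\ln d}}\qquad\text{for all }t\in[0,T_0].$$ Consequently, for all $m,\delta>0$ and all sufficiently large $d$, $$\|\rho_s(t)-\rho_s'(t)\|_1\,d^m\le\delta\,\sqrt{d_s\,\mathrm{tr}[\rho^2]}$$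 for all systems, all pulses and all $t\in[0,t_1]\cup[t_2,T_0]$ simultaneously. -/

import Mathlib

open scoped Kronecker ComplexOrder

noncomputable section

namespace QuantumClock

/-! ### Matrices -/

/-- The unitary `exp (-i t H)`. -/
def evolution {ι : Type*} [Fintype ι] [DecidableEq ι] (t : ℝ) (H : Matrix ι ι ℂ) :
    Matrix ι ι ℂ :=
  NormedSpace.exp ((-(Complex.I * (t : ℂ))) • H)

/-- The trace norm `‖M‖₁`, the sum of the singular values of `M`. -/
def traceNorm {ι : Type*} [Fintype ι] [DecidableEq ι] (M : Matrix ι ι ℂ) : ℝ :=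
  ∑ i, Real.sqrt ((Matrix.isHermitian_conjTranspose_mul_self M).eigenvalues i)

/-- Density matrices. -/
def IsDensity {ι : Type*} [Fintype ι] (ρ : Matrix ι ι ℂ) : Prop :=
  ρ.PosSemidef ∧ ρ.trace = 1

/-- Partial trace over the second tensor factor. -/
def partialTrace {ι κ : Type*} [Fintype κ] (M : Matrix (ι × κ) (ι × κ) ℂ) : Matrix ι ι ℂ :=
  Matrix.of fun i j => ∑ k, M (i, k) (j, k)

/-- The projector `|v⟩⟨v|`. -/
def ketbra {κ : Type*} (v : κ → ℂ) : Matrix κ κ ℂ :=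
  Matrix.vecMulVec v (star v)

/-! ### The finite clock, written in its energy basis -/

/-- The clock Hamiltonian `∑ n ω |E_n⟩⟨E_n|` with `ω = 2π / T₀`. -/
def clockHamiltonian (T₀ : ℝ) (d : ℕ) : Matrix (Fin d) (Fin d) ℂ :=
  Matrix.diagonal fun n => (((n : ℕ) : ℝ) * (2 * Real.pi / T₀) : ℝ)

/-- The time states `|θ_k⟩ = d^(-1/2) ∑ e^(-2π i n k / d) |E_n⟩`, for all integers `k`. -/
def timeState (d : ℕ) (k : ℤ) : Fin d → ℂ := fun n =>
  ((1 / Real.sqrt d : ℝ) : ℂ) *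
    Complex.exp (-(Complex.I * ((2 * Real.pi * ((n : ℕ) : ℝ) * (k : ℝ) / (d : ℝ) : ℝ) : ℂ)))

/-- `V_d (x) = (2π/d) V₀ (2π x / d)`. -/
def stretchedPotential (V₀ : ℝ → ℝ) (d : ℕ) (x : ℝ) : ℝ :=
  2 * Real.pi / d * V₀ (2 * Real.pi * x / d)

/-- The interaction potential `(d/T₀) ∑ V_d (k) |θ_k⟩⟨θ_k|`. -/
def clockPotential (T₀ : ℝ) (V₀ : ℝ → ℝ) (d : ℕ) : Matrix (Fin d) (Fin d) ℂ :=
  (((d : ℝ) / T₀ : ℝ) : ℂ) •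
    ∑ k ∈ Finset.range d,
      ((stretchedPotential V₀ d (k : ℝ) : ℝ) : ℂ) • ketbra (timeState d (k : ℤ))

/-- The set of the `d` integers `k` with `-d/2 ≤ k₀ - k < d/2`. -/
def centredIntegers (d : ℕ) (k₀ : ℝ) : Finset ℤ :=
  Finset.Ioc ⌊k₀ - (d : ℝ) / 2⌋ ⌊k₀ + (d : ℝ) / 2⌋

theorem mem_centredIntegers (d : ℕ) (k₀ : ℝ) (k : ℤ) :
    k ∈ centredIntegers d k₀ ↔ -(d : ℝ) / 2 ≤ k₀ - k ∧ k₀ - k < (d : ℝ) / 2 := by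
  unfold centredIntegers
  rw [Finset.mem_Ioc, Int.floor_lt, Int.le_floor]
  constructor
  · rintro ⟨h₁, h₂⟩
    constructor <;> linarith
  · rintro ⟨h₁, h₂⟩
    constructor <;> linarith

/-- `∑ e^(-2π (k - k₀)² / σ²)` over the `d` integers centred at `k₀`. -/
def gaussSum (d : ℕ) (σ k₀ : ℝ) : ℝ :=
  ∑ k ∈ centredIntegers d k₀, Real.exp (-(2 * Real.pi / σ ^ 2) * ((k : ℝ) - k₀) ^ 2)

/-- The normalisation constant `A (σ; k₀)` of the Gaussian clock state. -/
def normConst (d : ℕ) (σ k₀ : ℝ) : ℝ :=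
  1 / Real.sqrt (gaussSum d σ k₀)

/-- The wave function `ψ_nor (k₀; x)`. -/
def psiNor (d : ℕ) (σ n₀ k₀ x : ℝ) : ℂ :=
  ((normConst d σ k₀ * Real.exp (-(Real.pi / σ ^ 2) * (x - k₀) ^ 2) : ℝ) : ℂ) *
    Complex.exp (Complex.I * ((2 * Real.pi * n₀ * (x - k₀) / d : ℝ) : ℂ))

/-- The normalised Gaussian clock state `|Ψ_nor (k₀)⟩ = ∑ ψ_nor (k₀; k) |θ_k⟩`. -/
def clockState (d : ℕ) (σ n₀ k₀ : ℝ) : Fin d → ℂ :=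
  ∑ k ∈ centredIntegers d k₀, psiNor d σ n₀ k₀ (k : ℝ) • timeState d k

/-! ### System states -/

/-- The total Hamiltonian `H_s ⊗ 1 + 1 ⊗ H_c + H_int ⊗ V_d` on system and clock. -/
def totalHamiltonian {dS : ℕ} (T₀ : ℝ) (V₀ : ℝ → ℝ) (d : ℕ)
    (Hs Hint : Matrix (Fin dS) (Fin dS) ℂ) :
    Matrix (Fin dS × Fin d) (Fin dS × Fin d) ℂ :=
  Hs ⊗ₖ (1 : Matrix (Fin d) (Fin d) ℂ) +
    (1 : Matrix (Fin dS) (Fin dS) ℂ) ⊗ₖ clockHamiltonian T₀ d +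
    Hint ⊗ₖ clockPotential T₀ V₀ d

/-- The system state `ρ'_s (t) = tr_c (e^(-itH) (ρ ⊗ |Ψ_nor (0)⟩⟨Ψ_nor (0)|) e^(itH))`
of the autonomous evolution. -/
def autonomousState {dS : ℕ} (T₀ : ℝ) (V₀ : ℝ → ℝ) (d : ℕ) (σ n₀ : ℝ)
    (Hs Hint ρ : Matrix (Fin dS) (Fin dS) ℂ) (t : ℝ) : Matrix (Fin dS) (Fin dS) ℂ :=
  partialTrace
    (evolution t (totalHamiltonian T₀ V₀ d Hs Hint) * (ρ ⊗ₖ ketbra (clockState d σ n₀ 0)) *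
      evolution (-t) (totalHamiltonian T₀ V₀ d Hs Hint))

/-- The system state `ρ_s (t)` at time `t` under the time dependent Hamiltonian
`H_s + g (t) H_int` for commuting `H_s`, `H_int`, where the pulse `g` starts at time `tᵢ`. -/
def pulseState {dS : ℕ} (g : ℝ → ℝ) (tᵢ : ℝ) (Hs Hint ρ : Matrix (Fin dS) (Fin dS) ℂ)
    (t : ℝ) : Matrix (Fin dS) (Fin dS) ℂ :=
  (evolution t Hs * evolution (∫ x in tᵢ..t, g x) Hint) * ρ *
    (evolution (-(∫ x in tᵢ..t, g x)) Hint * evolution (-t) Hs)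

/-- `g` is an integrable nonnegative pulse supported in `[tᵢ, t_f]` and of integral one. -/
def IsPulse (g : ℝ → ℝ) (tᵢ t_f : ℝ) : Prop :=
  MeasureTheory.Integrable g ∧ (∀ x, 0 ≤ g x) ∧ (∀ x, x ∉ Set.Icc tᵢ t_f → g x = 0) ∧
    ∫ x in tᵢ..t_f, g x = 1

/-- Admissible system data: Hermitian commuting `H_s`, `H_int`, the eigenvalues of `H_int` lie
in `[-π, π)`, and `ρ` is a density matrix. -/
def IsSystem {dS : ℕ} (Hs Hint ρ : Matrix (Fin dS) (Fin dS) ℂ) : Prop :=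
  Hs.IsHermitian ∧ (∃ h : Hint.IsHermitian, ∀ i, h.eigenvalues i ∈ Set.Ico (-Real.pi) Real.pi) ∧
    Commute Hs Hint ∧ IsDensity ρ

/-- `sqrt (d_s tr ρ²)`. -/
def systemFactor {dS : ℕ} (ρ : Matrix (Fin dS) (Fin dS) ℂ) : ℝ :=
  Real.sqrt (dS * (ρ * ρ).trace.re)

/-! ### The potential -/

/-- A smooth nonnegative `2π`-periodic potential of integral one over a period, with a
unique global maximum on `[0, 2π]`, attained at `x₀`. -/
def IsPeakedPotential (V₀ : ℝ → ℝ) (x₀ : ℝ) : Prop :=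
  ContDiff ℝ (⊤ : ℕ∞) V₀ ∧ Function.Periodic V₀ (2 * Real.pi) ∧
    (∫ x in (0 : ℝ)..(2 * Real.pi), V₀ x = 1) ∧ (∀ x, 0 ≤ V₀ x) ∧
    x₀ ∈ Set.Icc 0 (2 * Real.pi) ∧
    ∀ x ∈ Set.Icc (0 : ℝ) (2 * Real.pi), x ≠ x₀ → V₀ x < V₀ x₀

/-- `b` is at least `sup_{k ≥ 1} (2 max_{[0,2π]} |V^(k-1)|)^(1/k)`. -/
def IsDerivBound (V : ℝ → ℝ) (b : ℝ) : Prop :=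
  ∀ k : ℕ, 1 ≤ k → ∀ x ∈ Set.Icc (0 : ℝ) (2 * Real.pi),
    (2 * |iteratedDeriv (k - 1) V x|) ^ ((1 : ℝ) / k) ≤ b

/-- The potential `A_c cos^(2n) ((x - x₀)/2)` with `A_c = 2^(2n) / (2π (2n choose n))`. -/
def cosPotential (n : ℕ) (x₀ x : ℝ) : ℝ :=
  2 ^ (2 * n) / (2 * Real.pi * (Nat.choose (2 * n) n : ℝ)) * Real.cos ((x - x₀) / 2) ^ (2 * n)

/-- The value of `b` used for `π V₀`, where `V₀` is the cosine potential of index `n`. -/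
def cosDerivBound (n : ℕ) : ℝ :=
  2 * Real.exp 2 / (2 * Real.pi) ^ ((3 : ℝ) / 2) * (Real.pi / Real.sqrt 2) * (n * Real.sqrt n)

/-! ### The clock error `ε_v (t, d)`, for the initial clock state centred at zero -/

/-- `α₀ = (2/(d-1)) min (n₀, d-1-n₀)`. -/
def alphaZero (d : ℕ) (n₀ : ℝ) : ℝ :=
  2 / ((d : ℝ) - 1) * min n₀ ((d : ℝ) - 1 - n₀)

/-- The constant `κ = 0.792`. -/
def kap : ℝ := 792 / 1000

/-- The exponential decay rate parameter. -/
def rateParam (σ α₀ b : ℝ) : ℝ :=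
  Real.pi * α₀ * kap / Real.log (Real.pi * α₀ ^ 2 * σ ^ 2) * b

/-- The natural number deciding which of the two bounds in `epsTwo` is used. -/
def calN (d : ℕ) (σ α₀ b : ℝ) : ℕ :=
  ⌊Real.pi * α₀ ^ 2 / (2 * (rateParam σ α₀ b + d / σ ^ 2) ^ 2) * (d / σ) ^ 2⌋₊

open Classical in
/-- The contribution of the tails of the Fourier transform of the clock state. The condition
`1 < π α₀² σ²` says that the rate parameter is well defined and nonnegative. -/
def epsTwo (d : ℕ) (σ α₀ b : ℝ) : ℝ :=
  if 8 ≤ calN d σ α₀ b ∧ 1 < Real.pi * α₀ ^ 2 * σ ^ 2 then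
    (2 * Real.pi) ^ ((5 : ℝ) / 4) * σ ^ ((3 : ℝ) / 2) * normConst d σ 0 * (1 + Real.pi ^ 2 / 8) *
      Real.sqrt (Real.exp 1 / 2 * (α₀ / (rateParam σ α₀ b * σ ^ 2 / d + 1))) *
      Real.exp (-(Real.pi / 4) * (α₀ ^ 2 / (d / σ ^ 2 + rateParam σ α₀ b) ^ 2) * (d / σ) ^ 2)
  else
    3 ^ ((7 : ℝ) / 4) / (Real.sqrt (2 * Real.pi) * Real.exp 1) *
      (normConst d σ 0 * (8 + Real.pi ^ 2) / α₀ ^ 3) *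
      (kap * Real.sqrt (6 * Real.pi) / Real.log 3 * b + d / σ) ^ 3 * (σ / d ^ 3)

/-- The error per unit step. -/
def epsT (d : ℕ) (σ α₀ b : ℝ) : ℝ :=
  epsTwo d σ α₀ b + 2 * normConst d σ 0 *
    (2 * Real.pi / (1 - Real.exp (-(Real.pi * d / σ ^ 2))) +
      (b + 2 * Real.pi / d) / (1 - Real.exp (-(Real.pi * d ^ 2 / σ ^ 2))) +
      (2 * Real.pi * d / σ ^ 2 + Real.pi * d ^ 2 / σ ^ 2 + 1 / d)) *
    Real.exp (-(Real.pi / 4) * (d ^ 2 / σ ^ 2))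

/-- The error of shifting the summation range by one. -/
def epsStep (d : ℕ) (σ : ℝ) : ℝ :=
  2 * normConst d σ 0 * Real.exp (-(Real.pi * d ^ 2 / (4 * σ ^ 2)))

/-- The error of renormalising the clock state after the time `t`. -/
def epsNor (T₀ : ℝ) (d : ℕ) (σ t : ℝ) : ℝ :=
  |Real.sqrt (gaussSum d σ (d / T₀ * t) / gaussSum d σ 0) - 1|

/-- The clock error `ε_v (t, d)`. -/
def epsClock (T₀ : ℝ) (d : ℕ) (σ α₀ b t : ℝ) : ℝ :=
  |t| * (d / T₀) * epsT d σ α₀ b + (|t| * (d / T₀) + 1) * epsStep d σ + epsNor T₀ d σ t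

/-! ### The system error -/

/-- `ε_k = 2π |∫_0^{2π t/T₀} (V₀ (x) - V₀ (x + 2π k/d)) dx|`. -/
def epsK (T₀ : ℝ) (V₀ : ℝ → ℝ) (d : ℕ) (t k : ℝ) : ℝ :=
  2 * Real.pi *
    |∫ x in (0 : ℝ)..(t * (2 * Real.pi) / T₀), (V₀ x - V₀ (x + 2 * Real.pi * k / d))|

/-- `ε_V (t, d)`: the maximum over `s ∈ [0,1]` of the sum of
`(ε_k² + ε_k) |ψ_nor (k₀; k)|²` over `k = k₀ - d/2 + s, k₀ - d/2 + s + 1, …, k₀ + d/2 + s`. -/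
def epsV (T₀ : ℝ) (V₀ : ℝ → ℝ) (d : ℕ) (σ n₀ k₀ t : ℝ) : ℝ :=
  sSup ((fun s : ℝ => ∑ j ∈ Finset.range (d + 1),
    (epsK T₀ V₀ d t (k₀ - d / 2 + s + j) ^ 2 + epsK T₀ V₀ d t (k₀ - d / 2 + s + j)) *
      ‖psiNor d σ n₀ k₀ (k₀ - d / 2 + s + j)‖ ^ 2) '' Set.Icc (0 : ℝ) 1)

open Classical in
/-- `κ̃ = 0` if `d γ / 2 ≤ 1` and `κ̃ = (γ/2 - 1/d)²` otherwise. -/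
def kappaTilde (d : ℕ) (γ : ℝ) : ℝ :=
  if (d : ℝ) * γ / 2 ≤ 1 then 0 else (γ / 2 - 1 / d) ^ 2

/-- The explicit bound on `ε_V`, as a real number. It is meaningful for `0 < kappaTilde d γ`;
for `kappaTilde d γ = 0` the quotient has the form `A²/0` and the bound is infinite. -/
def epsVBound (d : ℕ) (σ γ ε : ℝ) : ℝ :=
  4 * Real.pi *
    ((1 + 2 * Real.pi) * normConst d σ 0 ^ 2 *
        (Real.exp (-(2 * Real.pi * kappaTilde d γ * (d ^ 2 / σ ^ 2))) /
          (1 - Real.exp (-(4 * Real.pi * Real.sqrt (kappaTilde d γ) * d / σ ^ 2)))) +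
      2 * ε * (1 + 8 * Real.pi * ε))

/-- The system error `ε_s`, built from the explicit bound on `ε_V`. -/
def epsS (T₀ : ℝ) (d : ℕ) (σ γ ε : ℝ) : ℝ :=
  epsVBound d σ γ ε + 2 * Real.pi * T₀ * ε * (2 * Real.pi * T₀ * ε + 1)

/-- The mass of `V₀` over a period outside `[x₀ - x_vr, x₀ + x_vr]`, i.e. `ε̃_V` with
`1 - ε̃_V = ∫_{-x_vr}^{x_vr} V₀ (x + x₀) dx`. -/
def outsideMass (V₀ : ℝ → ℝ) (x₀ xvr : ℝ) : ℝ :=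
  1 - ∫ x in (-xvr)..xvr, V₀ (x + x₀)

/-- The constraints on `x₀`, `x_vr` and `γ`. -/
def IsWindow (x₀ xvr γ : ℝ) : Prop :=
  0 < xvr ∧ xvr ≤ Real.pi ∧ 0 < γ ∧ γ ≤ 1 ∧
    xvr + Real.pi * γ ≤ x₀ ∧ x₀ ≤ 2 * Real.pi - xvr - Real.pi * γ

/-- The beginning `t₁` of the peak window. -/
def startTime (T₀ x₀ xvr γ : ℝ) : ℝ := T₀ * (x₀ - xvr - Real.pi * γ) / (2 * Real.pi)

/-- The end `t₂` of the peak window. -/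
def stopTime (T₀ x₀ xvr γ : ℝ) : ℝ := T₀ * (x₀ + xvr + Real.pi * γ) / (2 * Real.pi)

end QuantumClock

end

namespace QuantumClock

/-! ### Entire extensions of smooth functions with geometrically bounded derivatives -/

theorem iteratedDeriv_eq_of_eq_on_reals (k : ℕ) : ∀ {G : ℂ → ℂ} {g : ℝ → ℝ},
    Differentiable ℂ G → ContDiff ℝ (⊤ : ℕ∞) g → (∀ x : ℝ, G x = g x) →
    ∀ x : ℝ, iteratedDeriv k G x = (iteratedDeriv k g x : ℝ) := by
  induction k with
  | zero => intro G g _ _ h x; simpa using h x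
  | succ k ih =>
    intro G g hG hg h x
    rw [iteratedDeriv_succ', iteratedDeriv_succ']
    have hg' := contDiff_infty_iff_deriv.1 hg
    refine ih ?_ hg'.2 ?_ x
    · exact (hG.contDiff (n := 2)).differentiable_deriv_two
    · intro y
      have h1 : HasDerivAt (fun z : ℝ => G z) (deriv G y) y :=
        (hG (y : ℂ)).hasDerivAt.comp_ofReal
      have h2 : HasDerivAt (fun z : ℝ => (g z : ℂ)) (deriv g y : ℝ) y :=
        (hg'.1 y).hasDerivAt.ofReal_comp
      have h3 : (fun z : ℝ => G z) = fun z : ℝ => (g z : ℂ) := funext h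
      rw [h3] at h1
      exact h1.unique h2

theorem hasSum_taylor_of_iteratedDeriv_le {W : ℝ → ℝ} {b : ℝ} (hW : ContDiff ℝ (⊤ : ℕ∞) W)
    (hb : ∀ k : ℕ, 1 ≤ k → ∀ x, |iteratedDeriv k W x| ≤ b ^ k / 2) (x : ℝ) :
    HasSum (fun k : ℕ => iteratedDeriv k W 0 * x ^ k / k.factorial) (W x) := by
  rcases eq_or_ne x 0 with rfl | hx
  · convert hasSum_single (f := fun k : ℕ => iteratedDeriv k W 0 * (0 : ℝ) ^ k / k.factorial) 0 ?_
    · simp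
    · intro k hk; simp [hk]
  have hsum : Summable (fun k : ℕ => iteratedDeriv k W 0 * x ^ k / k.factorial) := by
    rw [← summable_nat_add_iff 1]
    refine Summable.of_norm_bounded (g := fun k : ℕ =>
      (|b| * |x|) ^ (k + 1) / (k + 1).factorial)
      ((summable_nat_add_iff 1).2 (Real.summable_pow_div_factorial (|b| * |x|))) ?_
    intro k
    rw [Real.norm_eq_abs, abs_div, abs_mul, abs_pow, Nat.abs_cast, mul_pow]
    gcongr
    refine (hb (k + 1) (by omega) 0).trans ?_
    have : b ^ (k + 1) ≤ |b| ^ (k + 1) := by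
      rw [← abs_pow]; exact le_abs_self _
    have h0 : 0 ≤ |b| ^ (k + 1) := by positivity
    linarith
  refine (hsum.hasSum_iff_tendsto_nat).2 ?_
  rw [← Filter.tendsto_add_atTop_iff_nat 1]
  have hzero : Filter.Tendsto (fun n : ℕ => (|b| * |x|) ^ (n + 1) / (n + 1).factorial)
      Filter.atTop (nhds 0) :=
    (Filter.tendsto_add_atTop_iff_nat 1).2
      (FloorSemiring.tendsto_pow_div_factorial_atTop (|b| * |x|))
  rw [tendsto_iff_norm_sub_tendsto_zero]
  refine squeeze_zero (fun n => norm_nonneg _) (fun n => ?_) hzero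
  obtain ⟨x', -, hx'⟩ := taylor_mean_remainder_lagrange_iteratedDeriv (f := W) (x := x)
    (x₀ := 0) (n := n) hx.symm (hW.of_le (by exact_mod_cast le_top)).contDiffOn
  have htay : taylorWithinEval W n (Set.uIcc 0 x) 0 x =
      ∑ k ∈ Finset.range (n + 1), iteratedDeriv k W 0 * x ^ k / k.factorial := by
    rw [taylor_within_apply]
    refine Finset.sum_congr rfl fun k _ => ?_
    rw [iteratedDerivWithin_eq_iteratedDeriv (uniqueDiffOn_uIcc hx.symm)
      (hW.of_le (by exact_mod_cast le_top)).contDiffAt Set.left_mem_uIcc]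
    simp only [sub_zero, smul_eq_mul]
    ring
  rw [← htay, norm_sub_rev, hx', Real.norm_eq_abs, abs_div, abs_mul, abs_pow, Nat.abs_cast,
    mul_pow, sub_zero]
  gcongr
  refine (hb (n + 1) (by omega) x').trans ?_
  have : b ^ (n + 1) ≤ |b| ^ (n + 1) := by
    rw [← abs_pow]; exact le_abs_self _
  have h0 : 0 ≤ |b| ^ (n + 1) := by positivity
  linarith

/-- A smooth function on the line whose `k`-th derivative is bounded by `b ^ k / 2` extends to an
entire function with imaginary part at most `sinh (b |y|) / 2` at height `y`. -/
theorem exists_entire_extension {W : ℝ → ℝ} {b : ℝ} (hb0 : 0 ≤ b) (hW : ContDiff ℝ (⊤ : ℕ∞) W)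
    (hb : ∀ k : ℕ, 1 ≤ k → ∀ x, |iteratedDeriv k W x| ≤ b ^ k / 2) :
    ∃ F : ℂ → ℂ, Differentiable ℂ F ∧ (∀ x : ℝ, F x = W x) ∧
      ∀ x y : ℝ, |(F (x + y * Complex.I)).im| ≤ Real.sinh (b * |y|) / 2 := by
  set F : ℂ → ℂ := fun z => ∑' k : ℕ, ((iteratedDeriv k W 0 : ℝ) : ℂ) * z ^ k / k.factorial with hF
  have hFW : ∀ x : ℝ, F x = W x := by
    intro x
    have h := (Complex.hasSum_ofReal.2 (hasSum_taylor_of_iteratedDeriv_le hW hb x)).tsum_eq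
    rw [← h, hF]
    push_cast
    rfl
  have hFd : Differentiable ℂ F := by
    intro z
    have hU : DifferentiableOn ℂ F (Metric.ball 0 (‖z‖ + 1)) := by
      refine Complex.differentiableOn_tsum_of_summable_norm
        (u := fun k : ℕ => (1 + |W 0|) * ((b * (‖z‖ + 1)) ^ k / k.factorial))
        ((Real.summable_pow_div_factorial _).mul_left _)
        (fun k => by fun_prop) Metric.isOpen_ball ?_
      intro k w hw
      have hw' : ‖w‖ ≤ ‖z‖ + 1 := by
        have := mem_ball_zero_iff.1 hw; linarith
      rw [norm_div, norm_mul, norm_pow, Complex.norm_natCast, Complex.norm_real,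
        Real.norm_eq_abs, mul_pow, ← mul_div_assoc, ← mul_assoc]
      have hk : |iteratedDeriv k W 0| ≤ (1 + |W 0|) * b ^ k := by
        rcases Nat.eq_zero_or_pos k with rfl | hk
        · simp
        · refine (hb k hk 0).trans ?_
          have : 0 ≤ b ^ k := by positivity
          have : 0 ≤ |W 0| * b ^ k := by positivity
          nlinarith
      gcongr
    exact (hU z (by simp)).differentiableAt (Metric.isOpen_ball.mem_nhds (by simp))
  refine ⟨F, hFd, hFW, fun x y => ?_⟩
  have hs := Complex.hasSum_taylorSeries_of_entire hFd (x : ℂ) (x + y * Complex.I)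
  have hs' := (Complex.hasSum_im hs)
  have hsinh : HasSum (fun n : ℕ => ((b * |y|) ^ n / n.factorial -
      (-(b * |y|)) ^ n / n.factorial) / 4) (Real.sinh (b * |y|) / 2) := by
    have h1 := ((NormedSpace.expSeries_div_hasSum_exp (b * |y|)).sub
      (NormedSpace.expSeries_div_hasSum_exp (-(b * |y|)))).div_const 4
    rw [← Real.exp_eq_exp_ℝ] at h1
    rw [show Real.sinh (b * |y|) / 2 =
      (Real.exp (b * |y|) - Real.exp (-(b * |y|))) / 4 by rw [Real.sinh_eq]; ring]
    exact h1
  refine hs'.norm_le_of_bounded hsinh fun n => ?_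
  rw [iteratedDeriv_eq_of_eq_on_reals n hFd hW hFW]
  have hterm : ((n.factorial : ℂ)⁻¹ • ((x : ℂ) + y * Complex.I - x) ^ n •
      ((iteratedDeriv n W x : ℝ) : ℂ)) =
      (((n.factorial : ℝ)⁻¹ * y ^ n * iteratedDeriv n W x : ℝ) : ℂ) * Complex.I ^ n := by
    simp only [smul_eq_mul, add_sub_cancel_left, mul_pow]
    push_cast
    ring
  rw [hterm, Complex.im_ofReal_mul]
  have hpos : 0 ≤ b * |y| := by positivity
  rcases Nat.even_or_odd n with he | ho
  · have : (Complex.I ^ n).im = 0 := by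
      obtain ⟨m, rfl⟩ := he
      rw [← two_mul, pow_mul, Complex.I_sq]
      rcases neg_one_pow_eq_or ℂ m with h | h <;> simp [h]
    rw [this, he.neg_pow]
    simp
  · have hI : |(Complex.I ^ n).im| ≤ 1 := by
      refine (Complex.abs_im_le_norm _).trans ?_
      simp
    have hn1 : 1 ≤ n := by
      rcases ho with ⟨m, rfl⟩; omega
    rw [ho.neg_pow, Real.norm_eq_abs, abs_mul, abs_mul, abs_mul, abs_pow,
      abs_of_nonneg (by positivity : (0:ℝ) ≤ (n.factorial : ℝ)⁻¹)]
    calc (n.factorial : ℝ)⁻¹ * |y| ^ n * |iteratedDeriv n W x| * |(Complex.I ^ n).im|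
        ≤ (n.factorial : ℝ)⁻¹ * |y| ^ n * (b ^ n / 2) * 1 := by
          gcongr
          exact hb n hn1 x
      _ = _ := by rw [mul_pow]; ring

end QuantumClock

namespace QuantumClock

/-! ### Contour shifts and Fourier tails of Gaussian wave packets -/

theorem integrable_exp_neg_mul_sub_sq {a : ℝ} (ha : 0 < a) (κ : ℝ) :
    MeasureTheory.Integrable fun x : ℝ => Real.exp (-a * (x - κ) ^ 2) :=
  (integrable_exp_neg_mul_sq ha).comp_sub_right κ

theorem integral_exp_neg_mul_sub_sq (a κ : ℝ) :
    ∫ x : ℝ, Real.exp (-a * (x - κ) ^ 2) = Real.sqrt (Real.pi / a) := by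
  rw [MeasureTheory.integral_sub_right_eq_self (fun x : ℝ => Real.exp (-a * x ^ 2)) κ]
  exact integral_gaussian a

theorem tendsto_exp_neg_mul_sub_sq {a : ℝ} (ha : 0 < a) (κ : ℝ) {l : Filter ℝ} {f : ℝ → ℝ}
    (hf : Filter.Tendsto (fun T => |f T|) l Filter.atTop) :
    Filter.Tendsto (fun T => Real.exp (-a * (f T - κ) ^ 2)) l (nhds 0) := by
  refine Real.tendsto_exp_atBot.comp ?_
  have h1 : Filter.Tendsto (fun T => |f T| - |κ|) l Filter.atTop :=
    Filter.tendsto_atTop_add_const_right _ _ hf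
  have h2 : Filter.Tendsto (fun T => (|f T| - |κ|) ^ 2) l Filter.atTop :=
    (Filter.tendsto_pow_atTop two_ne_zero).comp h1
  have h3 : Filter.Tendsto (fun T => (f T - κ) ^ 2) l Filter.atTop := by
    refine Filter.tendsto_atTop_mono (fun T => ?_) h2
    rw [← sq_abs (f T - κ)]
    exact sq_le_sq' (by linarith [abs_sub_abs_le_abs_sub κ (f T), abs_sub_comm κ (f T)])
      (abs_sub_abs_le_abs_sub _ _)
  exact h3.const_mul_atTop_of_neg (by linarith)

theorem integral_eq_integral_add_mul_I {g : ℂ → ℂ} (hg : Differentiable ℂ g) {Y C a κ : ℝ}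
    (ha : 0 < a)
    (hbd : ∀ x y : ℝ, |y| ≤ |Y| → ‖g (x + y * Complex.I)‖ ≤ C * Real.exp (-a * (x - κ) ^ 2)) :
    ∫ x : ℝ, g x = ∫ x : ℝ, g (x + Y * Complex.I) := by
  have hint : ∀ y : ℝ, |y| ≤ |Y| →
      MeasureTheory.Integrable fun x : ℝ => g (x + y * Complex.I) := by
    intro y hy
    refine ((integrable_exp_neg_mul_sub_sq ha κ).const_mul C).mono' ?_ ?_
    · have := hg.continuous
      exact (Continuous.aestronglyMeasurable (by fun_prop))
    · exact Filter.Eventually.of_forall fun x => hbd x y hy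
  have h0 : MeasureTheory.Integrable fun x : ℝ => g x := by
    simpa using hint 0 (by simp)
  have hY := hint Y le_rfl
  have hvert : ∀ f : ℝ → ℝ, Filter.Tendsto (fun T => |f T|) Filter.atTop Filter.atTop →
      Filter.Tendsto (fun T : ℝ => ∫ y in (0 : ℝ)..Y, g (f T + y * Complex.I)) Filter.atTop
        (nhds 0) := by
    intro f hf
    have hz := ((tendsto_exp_neg_mul_sub_sq ha κ hf).const_mul C).mul_const |Y - 0|
    rw [mul_zero, zero_mul] at hz
    refine squeeze_zero_norm (fun T => ?_) hz
    refine intervalIntegral.norm_integral_le_of_norm_le_const fun y hy => ?_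
    refine hbd _ _ ?_
    have hy' := Set.uIoc_subset_uIcc hy
    have := Set.abs_sub_left_of_mem_uIcc hy'
    simpa using this
  have hlim : Filter.Tendsto (fun T : ℝ =>
      (((∫ x in (-T)..T, g x) - ∫ x in (-T)..T, g (x + Y * Complex.I)) +
        Complex.I • ∫ y in (0 : ℝ)..Y, g ((T : ℝ) + y * Complex.I)) -
        Complex.I • ∫ y in (0 : ℝ)..Y, g ((-T : ℝ) + y * Complex.I)) Filter.atTop
      (nhds ((((∫ x : ℝ, g x) - ∫ x : ℝ, g (x + Y * Complex.I)) + Complex.I • 0) -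
        Complex.I • 0)) := by
    refine Filter.Tendsto.sub (Filter.Tendsto.add (Filter.Tendsto.sub ?_ ?_) ?_) ?_
    · exact MeasureTheory.intervalIntegral_tendsto_integral h0 Filter.tendsto_neg_atTop_atBot
        Filter.tendsto_id
    · exact MeasureTheory.intervalIntegral_tendsto_integral hY Filter.tendsto_neg_atTop_atBot
        Filter.tendsto_id
    · exact (hvert (fun T => T) Filter.tendsto_abs_atTop_atTop).const_smul _
    · refine (hvert (fun T => -T) ?_).const_smul _
      simpa using Filter.tendsto_abs_atTop_atTop
  have hconst : (fun T : ℝ =>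
      (((∫ x in (-T)..T, g x) - ∫ x in (-T)..T, g (x + Y * Complex.I)) +
        Complex.I • ∫ y in (0 : ℝ)..Y, g ((T : ℝ) + y * Complex.I)) -
        Complex.I • ∫ y in (0 : ℝ)..Y, g ((-T : ℝ) + y * Complex.I)) = fun _ => 0 := by
    funext T
    have := Complex.integral_boundary_rect_eq_zero_of_differentiableOn g (-(T : ℂ))
      (T + Y * Complex.I) hg.differentiableOn
    simpa using this
  rw [hconst] at hlim
  have := tendsto_nhds_unique hlim tendsto_const_nhds
  simp only [smul_zero, add_zero, sub_zero] at this
  exact sub_eq_zero.1 this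

/-- A Gaussian wave packet of width `σ`, centre `κ` and frequency `-m`, with the phase `P`. -/
noncomputable def gaussPacket (σ κ m : ℝ) (P : ℂ → ℂ) (z : ℂ) : ℂ :=
  Complex.exp (-(Real.pi / σ ^ 2 : ℝ) * (z - κ) ^ 2 - Complex.I * P z -
    2 * Real.pi * Complex.I * m * z)

theorem differentiable_gaussPacket (σ κ m : ℝ) {P : ℂ → ℂ} (hP : Differentiable ℂ P) :
    Differentiable ℂ (gaussPacket σ κ m P) := by
  unfold gaussPacket
  fun_prop

theorem norm_gaussPacket (σ κ m : ℝ) (P : ℂ → ℂ) (x y : ℝ) :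
    ‖gaussPacket σ κ m P (x + y * Complex.I)‖ =
      Real.exp (Real.pi / σ ^ 2 * y ^ 2 + (P (x + y * Complex.I)).im + 2 * Real.pi * m * y) *
        Real.exp (-(Real.pi / σ ^ 2) * (x - κ) ^ 2) := by
  rw [gaussPacket, Complex.norm_exp, ← Real.exp_add]
  congr 1
  simp only [Complex.sub_re, Complex.mul_re, Complex.neg_re, Complex.neg_im, Complex.ofReal_re,
    Complex.ofReal_im, Complex.I_re, Complex.I_im, pow_two, Complex.add_re, Complex.add_im,
    Complex.sub_im, Complex.mul_im, Complex.re_ofNat, Complex.im_ofNat]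
  ring

theorem norm_integral_gaussPacket_le {σ κ m β v : ℝ} {P : ℂ → ℂ} (hσ : 0 < σ) (hv : 0 ≤ v)
    (hβ : 0 ≤ β) (hP : Differentiable ℂ P)
    (hPim : ∀ x y : ℝ, |(P (x + y * Complex.I)).im| ≤ Real.sinh (β * |y|)) :
    ‖∫ x : ℝ, gaussPacket σ κ m P x‖ ≤
      σ * Real.exp (Real.pi / σ ^ 2 * v ^ 2 + Real.sinh (β * v) - 2 * Real.pi * |m| * v) := by
  have ha : 0 < Real.pi / σ ^ 2 := by positivity
  obtain ⟨Y, hYv, hYm⟩ : ∃ Y : ℝ, |Y| = v ∧ m * Y = -(|m| * v) := by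
    rcases le_total 0 m with h | h
    · exact ⟨-v, by rw [abs_neg, abs_of_nonneg hv], by rw [abs_of_nonneg h]; ring⟩
    · exact ⟨v, abs_of_nonneg hv, by rw [abs_of_nonpos h]; ring⟩
  have hbd : ∀ x y : ℝ, |y| ≤ |Y| → ‖gaussPacket σ κ m P (x + y * Complex.I)‖ ≤
      Real.exp (Real.pi / σ ^ 2 * v ^ 2 + Real.sinh (β * v) + 2 * Real.pi * |m| * v) *
        Real.exp (-(Real.pi / σ ^ 2) * (x - κ) ^ 2) := by
    intro x y hy
    rw [hYv] at hy
    rw [norm_gaussPacket]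
    have h1 : y ^ 2 ≤ v ^ 2 :=
      sq_le_sq' (by linarith [neg_abs_le y]) (by linarith [le_abs_self y])
    have h2 : (P (x + y * Complex.I)).im ≤ Real.sinh (β * v) :=
      (le_abs_self _).trans ((hPim x y).trans (Real.sinh_le_sinh.2 (by gcongr)))
    have h3 : m * y ≤ |m| * v := by
      refine (le_abs_self _).trans ?_
      rw [abs_mul]
      gcongr
    refine mul_le_mul_of_nonneg_right (Real.exp_le_exp.2 ?_) (Real.exp_pos _).le
    refine add_le_add (add_le_add (by gcongr) h2) ?_
    nlinarith [Real.pi_pos]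
  rw [integral_eq_integral_add_mul_I (differentiable_gaussPacket σ κ m hP) ha hbd]
  have hle : ∀ x : ℝ, ‖gaussPacket σ κ m P (x + Y * Complex.I)‖ ≤
      Real.exp (Real.pi / σ ^ 2 * v ^ 2 + Real.sinh (β * v) - 2 * Real.pi * |m| * v) *
        Real.exp (-(Real.pi / σ ^ 2) * (x - κ) ^ 2) := by
    intro x
    rw [norm_gaussPacket]
    have h1 : Y ^ 2 = v ^ 2 := by rw [← hYv, sq_abs]
    have h2 := (le_abs_self _).trans (hPim x Y)
    rw [hYv] at h2
    gcongr
    rw [h1]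
    nlinarith [Real.pi_pos]
  calc ‖∫ x : ℝ, gaussPacket σ κ m P (x + Y * Complex.I)‖
      ≤ ∫ x : ℝ, Real.exp (Real.pi / σ ^ 2 * v ^ 2 + Real.sinh (β * v) -
          2 * Real.pi * |m| * v) * Real.exp (-(Real.pi / σ ^ 2) * (x - κ) ^ 2) :=
        MeasureTheory.norm_integral_le_of_norm_le
          ((integrable_exp_neg_mul_sub_sq ha κ).const_mul _) (Filter.Eventually.of_forall hle)
    _ = _ := by
        rw [MeasureTheory.integral_const_mul, integral_exp_neg_mul_sub_sq,
          show Real.pi / (Real.pi / σ ^ 2) = σ ^ 2 by field_simp, Real.sqrt_sq hσ.le]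
        ring

end QuantumClock

namespace QuantumClock

/-! ### Poisson summation for the derivative of a wave packet -/

/-- The logarithmic derivative of a Gaussian wave packet. -/
noncomputable def packetLogDeriv (σ κ m : ℝ) (P : ℂ → ℂ) (x : ℝ) : ℂ :=
  -((2 * Real.pi / σ ^ 2 * (x - κ) : ℝ) : ℂ) - Complex.I * deriv P x -
    2 * Real.pi * Complex.I * m

theorem hasDerivAt_gaussPacket (σ κ m : ℝ) {P : ℂ → ℂ} (hP : Differentiable ℂ P) (x : ℝ) :
    HasDerivAt (fun x : ℝ => gaussPacket σ κ m P x)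
      (gaussPacket σ κ m P x * packetLogDeriv σ κ m P x) x := by
  have h1 : HasDerivAt (fun z : ℂ => -(Real.pi / σ ^ 2 : ℝ) * (z - κ) ^ 2 - Complex.I * P z -
      2 * Real.pi * Complex.I * m * z) (packetLogDeriv σ κ m P x) (x : ℂ) := by
    have := ((((hasDerivAt_id (x : ℂ)).sub_const (κ : ℂ)).pow 2).const_mul
      (-(Real.pi / σ ^ 2 : ℝ) : ℂ)).sub (((hP x).hasDerivAt).const_mul Complex.I) |>.sub
      ((hasDerivAt_id (x : ℂ)).const_mul (2 * Real.pi * Complex.I * m))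
    convert! this using 1
    rw [packetLogDeriv]
    push_cast
    simp only [id]
    ring
  exact h1.cexp.comp_ofReal

theorem norm_gaussPacket_ofReal (σ κ m : ℝ) {P : ℂ → ℂ} (hPr : ∀ x : ℝ, (P x).im = 0) (x : ℝ) :
    ‖gaussPacket σ κ m P x‖ = Real.exp (-(Real.pi / σ ^ 2) * (x - κ) ^ 2) := by
  have := norm_gaussPacket σ κ m P x 0
  simpa [hPr] using this

theorem norm_packetLogDeriv_le {σ κ m M : ℝ} {P : ℂ → ℂ}
    (hM : ∀ x : ℝ, ‖deriv P x‖ ≤ M) (x : ℝ) :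
    ‖packetLogDeriv σ κ m P x‖ ≤
      2 * Real.pi / σ ^ 2 * |x - κ| + (M + 2 * Real.pi * |m|) := by
  rw [packetLogDeriv]
  refine (norm_sub_le _ _).trans ?_
  have h1 := norm_sub_le (-((2 * Real.pi / σ ^ 2 * (x - κ) : ℝ) : ℂ)) (Complex.I * deriv P x)
  have h2 : ‖-((2 * Real.pi / σ ^ 2 * (x - κ) : ℝ) : ℂ)‖ = 2 * Real.pi / σ ^ 2 * |x - κ| := by
    rw [norm_neg, Complex.norm_real, Real.norm_eq_abs, abs_mul, abs_of_nonneg (by positivity)]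
  have h3 : ‖Complex.I * deriv P x‖ ≤ M := by simpa using hM x
  have h4 : ‖(2 * Real.pi * Complex.I * m : ℂ)‖ = 2 * Real.pi * |m| := by
    simp [abs_of_pos Real.pi_pos]
  linarith

theorem linear_mul_exp_le {a c e κ : ℝ} (ha : 0 < a) (hc : 0 ≤ c) (he : 0 ≤ e) (x : ℝ) :
    (c * |x - κ| + e) * Real.exp (-a * (x - κ) ^ 2) ≤
      ((c * (1 + 2 / a) + e) * Real.exp (a / 2 * κ ^ 2)) * Real.exp (-(a / 4) * x ^ 2) := by
  have h1 : |x - κ| ≤ (1 + 2 / a) * Real.exp (a / 2 * (x - κ) ^ 2) := by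
    have h := Real.add_one_le_exp (a / 2 * (x - κ) ^ 2)
    have h2 : |x - κ| ≤ 1 + (x - κ) ^ 2 := by
      rw [← sq_abs (x - κ)]; nlinarith [sq_nonneg (|x - κ| - 1)]
    have h3 : (1 + 2 / a) * (a / 2 * (x - κ) ^ 2 + 1) =
      1 + (x - κ) ^ 2 + (2 / a + a / 2 * (x - κ) ^ 2) := by field_simp; ring
    have h4 : 0 ≤ 2 / a + a / 2 * (x - κ) ^ 2 := by positivity
    have h5 : (1 + 2 / a) * (a / 2 * (x - κ) ^ 2 + 1) ≤
      (1 + 2 / a) * Real.exp (a / 2 * (x - κ) ^ 2) := by gcongr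
    linarith
  have h2 : e ≤ e * Real.exp (a / 2 * (x - κ) ^ 2) :=
    le_mul_of_one_le_right he (Real.one_le_exp (by positivity))
  calc (c * |x - κ| + e) * Real.exp (-a * (x - κ) ^ 2)
      ≤ (c * ((1 + 2 / a) * Real.exp (a / 2 * (x - κ) ^ 2)) +
          e * Real.exp (a / 2 * (x - κ) ^ 2)) * Real.exp (-a * (x - κ) ^ 2) := by gcongr
    _ = (c * (1 + 2 / a) + e) * Real.exp (-(a / 2) * (x - κ) ^ 2) := by
        rw [show -(a / 2) * (x - κ) ^ 2 = a / 2 * (x - κ) ^ 2 + -a * (x - κ) ^ 2 by ring,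
          Real.exp_add]
        ring
    _ ≤ (c * (1 + 2 / a) + e) * Real.exp (a / 2 * κ ^ 2 + -(a / 4) * x ^ 2) := by
        gcongr
        nlinarith [sq_nonneg (x - 2 * κ)]
    _ = _ := by rw [Real.exp_add]; ring

theorem abs_intCast_mul_geometric_sum {r : ℝ} (h0 : 0 ≤ r) (h1 : r < 1) :
    HasSum (fun s : ℤ => |(s : ℝ)| * r ^ s.natAbs) (2 * (r / (1 - r) ^ 2)) := by
  have hn : HasSum (fun n : ℕ => (n : ℝ) * r ^ n) (r / (1 - r) ^ 2) :=
    hasSum_coe_mul_geometric_of_norm_lt_one (by rwa [Real.norm_eq_abs, abs_of_nonneg h0])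
  have hn' : HasSum (fun n : ℕ => ((n + 1 : ℕ) : ℝ) * r ^ (n + 1)) (r / (1 - r) ^ 2) := by
    rw [hasSum_nat_add_iff (f := fun n : ℕ => (n : ℝ) * r ^ n) 1]
    simpa using hn
  have := HasSum.of_nat_of_neg_add_one (f := fun s : ℤ => |(s : ℝ)| * r ^ s.natAbs)
    (m := r / (1 - r) ^ 2) (m' := r / (1 - r) ^ 2) (by simpa using hn) (by
      convert hn' using 2 with n
      congr 1
      push_cast
      rw [abs_neg, abs_of_nonneg (by positivity)])
  rwa [two_mul]

theorem summable_exp_neg_mul_int_sq {a : ℝ} (ha : 0 < a) :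
    Summable fun k : ℤ => Real.exp (-a * (k : ℝ) ^ 2) := by
  have hr0 : 0 ≤ Real.exp (-a) := (Real.exp_pos _).le
  have hr1 : Real.exp (-a) < 1 := by rw [Real.exp_lt_one_iff]; linarith
  have hg := summable_geometric_of_lt_one hr0 hr1
  have hs : Summable fun k : ℤ => Real.exp (-a) ^ k.natAbs :=
    Summable.of_nat_of_neg (by simpa using hg) (by simpa using hg)
  refine Summable.of_nonneg_of_le (fun k => (Real.exp_pos _).le) (fun k => ?_) hs
  rw [← Real.exp_nat_mul]
  refine Real.exp_le_exp.2 ?_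
  have h1 : (k.natAbs : ℝ) ≤ (k : ℝ) ^ 2 := by
    rw [Nat.cast_natAbs]
    have h2 : |k| ≤ k ^ 2 := by simpa using Int.natAbs_le_self_sq k
    exact_mod_cast h2
  nlinarith

theorem norm_tsum_deriv_gaussPacket_le {σ κ m β v a M : ℝ} {P : ℂ → ℂ} (hσ : 0 < σ)
    (hv : 0 < v) (hβ : 0 ≤ β) (hP : Differentiable ℂ P)
    (hPim : ∀ x y : ℝ, |(P (x + y * Complex.I)).im| ≤ Real.sinh (β * |y|))
    (hM : ∀ x : ℝ, ‖deriv P x‖ ≤ M) (hma : ∀ s : ℤ, s ≠ 0 → |(s : ℝ)| - 1 + a ≤ |m + s|) :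
    (Summable fun k : ℤ => gaussPacket σ κ m P (k : ℝ) * packetLogDeriv σ κ m P k) ∧
    ‖∑' k : ℤ, gaussPacket σ κ m P (k : ℝ) * packetLogDeriv σ κ m P k‖ ≤
      4 * Real.pi * σ * Real.exp (Real.pi / σ ^ 2 * v ^ 2 + Real.sinh (β * v) -
        2 * Real.pi * a * v) / (1 - Real.exp (-(2 * Real.pi * v))) ^ 2 := by
  set h : ℝ → ℂ := fun x => gaussPacket σ κ m P x with hh
  have hPr : ∀ x : ℝ, (P x).im = 0 := by
    intro x
    simpa using hPim x 0
  have hder := hasDerivAt_gaussPacket σ κ m hP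
  have hderiv : deriv h = fun x : ℝ => gaussPacket σ κ m P x * packetLogDeriv σ κ m P x :=
    funext fun x => (hder x).deriv
  have hdP : Continuous (deriv P) := (hP.contDiff (n := 2)).differentiable_deriv_two.continuous
  have hcont : Continuous (deriv h) := by
    rw [hderiv]
    have h1 := (differentiable_gaussPacket σ κ m hP).continuous
    unfold packetLogDeriv
    fun_prop
  have ha : 0 < Real.pi / σ ^ 2 := by positivity
  have hM0 : 0 ≤ M := (norm_nonneg _).trans (hM 0)
  set K : ℝ := (2 * Real.pi / σ ^ 2 * (1 + 2 / (Real.pi / σ ^ 2)) + (M + 2 * Real.pi * |m|)) *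
    Real.exp (Real.pi / σ ^ 2 / 2 * κ ^ 2) with hK
  have hbd : ∀ x : ℝ, ‖deriv h x‖ ≤ K * Real.exp (-(Real.pi / σ ^ 2 / 4) * x ^ 2) := by
    intro x
    rw [hderiv]
    simp only [norm_mul]
    rw [norm_gaussPacket_ofReal σ κ m hPr, mul_comm]
    refine le_trans (mul_le_mul_of_nonneg_right (norm_packetLogDeriv_le hM x)
      (Real.exp_pos _).le) ?_
    exact linear_mul_exp_le ha (by positivity) (by positivity) x
  have hint : MeasureTheory.Integrable h := by
    refine (integrable_exp_neg_mul_sub_sq ha κ).mono' ?_ ?_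
    · exact (((differentiable_gaussPacket σ κ m hP).continuous.comp
        Complex.continuous_ofReal)).aestronglyMeasurable
    · exact Filter.Eventually.of_forall fun x => (norm_gaussPacket_ofReal σ κ m hPr x).le
  have hint' : MeasureTheory.Integrable (deriv h) :=
    ((integrable_exp_neg_mul_sq (by positivity : 0 < Real.pi / σ ^ 2 / 4)).const_mul K).mono'
      hcont.aestronglyMeasurable (Filter.Eventually.of_forall hbd)
  have hO : deriv h =O[Filter.cocompact ℝ] fun x => |x| ^ (-(2 : ℝ)) := by
    have h1 := (isLittleO_exp_neg_mul_sq_cocompact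
      (a := ((Real.pi / σ ^ 2 / 4 : ℝ) : ℂ)) (by rw [Complex.ofReal_re]; positivity) (-2)).isBigO
    refine Asymptotics.IsBigO.trans (Asymptotics.IsBigO.of_bound K
      (Filter.Eventually.of_forall fun x => ?_)) h1
    refine (hbd x).trans (le_of_eq ?_)
    rw [Complex.norm_exp]
    congr 2
    rw [← Complex.ofReal_pow, ← Complex.ofReal_neg, ← Complex.ofReal_mul, Complex.ofReal_re]
  have hF : ∀ s : ℤ, FourierTransform.fourier (deriv h) (s : ℝ) =
      (2 * Real.pi * Complex.I * (s : ℝ)) * ∫ x : ℝ, gaussPacket σ κ (m + s) P x := by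
    intro s
    rw [Real.fourier_deriv hint (fun x => (hder x).differentiableAt) hint']
    simp only [smul_eq_mul]
    congr 1
    rw [Real.fourier_real_eq_integral_exp_smul]
    refine MeasureTheory.integral_congr_ae (Filter.Eventually.of_forall fun x => ?_)
    simp only [hh, gaussPacket, smul_eq_mul]
    rw [← Complex.exp_add]
    congr 1
    push_cast
    ring
  set r := Real.exp (-(2 * Real.pi * v)) with hr
  set E := Real.exp (Real.pi / σ ^ 2 * v ^ 2 + Real.sinh (β * v) - 2 * Real.pi * a * v) with hE
  have hr1 : r < 1 := Real.exp_lt_one_iff.2 (by have := Real.pi_pos; simp; positivity)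
  have hr0 : 0 < r := Real.exp_pos _
  have hFle : ∀ s : ℤ, ‖FourierTransform.fourier (deriv h) (s : ℝ)‖ ≤
      (2 * Real.pi * σ * E / r) * (|(s : ℝ)| * r ^ s.natAbs) := by
    intro s
    rcases eq_or_ne s 0 with rfl | hs
    · rw [hF]; simp
    rw [hF, norm_mul]
    have h1 : ‖(2 * Real.pi * Complex.I * (s : ℝ) : ℂ)‖ = 2 * Real.pi * |(s : ℝ)| := by
      simp [abs_of_pos Real.pi_pos]
    rw [h1]
    have h2 := norm_integral_gaussPacket_le (κ := κ) (m := m + s) hσ hv.le hβ hP hPim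
    have h3 : Real.exp (Real.pi / σ ^ 2 * v ^ 2 + Real.sinh (β * v) -
        2 * Real.pi * |m + s| * v) ≤ E / r * r ^ s.natAbs := by
      rw [hr, ← Real.exp_nat_mul, hE, ← Real.exp_sub, ← Real.exp_add]
      refine Real.exp_le_exp.2 ?_
      have h4 := hma s hs
      rw [Nat.cast_natAbs, Int.cast_abs]
      have h5 : 2 * Real.pi * v * (|(s : ℝ)| - 1 + a) ≤ 2 * Real.pi * v * |m + s| := by gcongr
      linarith
    calc 2 * Real.pi * |(s : ℝ)| * ‖∫ x : ℝ, gaussPacket σ κ (m + s) P x‖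
        ≤ 2 * Real.pi * |(s : ℝ)| * (σ * (E / r * r ^ s.natAbs)) := by
          gcongr
          exact h2.trans (by gcongr)
      _ = _ := by ring
  have hgeo := (abs_intCast_mul_geometric_sum hr0.le hr1).mul_left (2 * Real.pi * σ * E / r)
  have hsumF : Summable fun s : ℤ => FourierTransform.fourier (deriv h) (s : ℝ) :=
    Summable.of_norm_bounded hgeo.summable hFle
  have hpois := Real.tsum_eq_tsum_fourier_of_rpow_decay_of_summable hcont
    (by norm_num : (1 : ℝ) < 2) hO hsumF 0
  constructor
  · have hs : Summable fun k : ℤ => K * Real.exp (-(Real.pi / σ ^ 2 / 4) * (k : ℝ) ^ 2) := by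
      refine Summable.mul_left _ (summable_exp_neg_mul_int_sq (by positivity))
    refine Summable.of_norm_bounded hs fun k => ?_
    have := hbd k
    rwa [hderiv] at this
  · have e1 : ∑' k : ℤ, gaussPacket σ κ m P (k : ℝ) * packetLogDeriv σ κ m P k =
        ∑' n : ℤ, deriv h (0 + n) := by
      rw [hderiv]; simp
    rw [e1, hpois]
    refine (tsum_of_norm_bounded hgeo fun s => ?_).trans (le_of_eq ?_)
    · rw [norm_mul]
      simpa using hFle s
    · field_simp
      ring

end QuantumClock

namespace QuantumClock

/-! ### Gaussian tail sums over unit-spaced points -/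

theorem exp_neg_mul_sq_tail_le {a D x₀ : ℝ} (ha : 0 < a) (hD : 0 ≤ D) (hx : D / 2 ≤ x₀) (j : ℕ) :
    Real.exp (-a * (x₀ + j) ^ 2) ≤ Real.exp (-(a * D ^ 2 / 4)) * Real.exp (-(a * D)) ^ j := by
  rw [← Real.exp_nat_mul, ← Real.exp_add]
  refine Real.exp_le_exp.2 ?_
  have hj : (0 : ℝ) ≤ j := j.cast_nonneg
  have h1 : D ^ 2 / 4 + D * j ≤ (x₀ + j) ^ 2 := by nlinarith
  nlinarith

theorem tsum_exp_neg_mul_sq_tail_le {a D x₀ : ℝ} (ha : 0 < a) (hD : 0 < D) (hx : D / 2 ≤ x₀) :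
    (Summable fun j : ℕ => Real.exp (-a * (x₀ + j) ^ 2)) ∧
    ∑' j : ℕ, Real.exp (-a * (x₀ + j) ^ 2) ≤
      Real.exp (-(a * D ^ 2 / 4)) / (1 - Real.exp (-(a * D))) := by
  have hr1 : Real.exp (-(a * D)) < 1 := by rw [Real.exp_lt_one_iff]; nlinarith
  have hg := (hasSum_geometric_of_lt_one (Real.exp_pos (-(a * D))).le hr1).mul_left
    (Real.exp (-(a * D ^ 2 / 4)))
  have hs : Summable fun j : ℕ => Real.exp (-a * (x₀ + j) ^ 2) :=
    Summable.of_nonneg_of_le (fun j => (Real.exp_pos _).le)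
      (fun j => exp_neg_mul_sq_tail_le ha hD.le hx j) hg.summable
  refine ⟨hs, ?_⟩
  rw [div_eq_mul_inv]
  exact hasSum_le (fun j => exp_neg_mul_sq_tail_le ha hD.le hx j) hs.hasSum hg

theorem exp_neg_div_one_sub_exp_neg_le {y : ℝ} (hy : 0 < y) :
    Real.exp (-y) / (1 - Real.exp (-y)) ≤ 1 / y := by
  have h1 : Real.exp (-y) < 1 := by rw [Real.exp_lt_one_iff]; linarith
  rw [div_le_div_iff₀ (by linarith) hy]
  have h2 := Real.add_one_le_exp y
  have h3 : Real.exp (-y) * Real.exp y = 1 := by rw [← Real.exp_add]; simp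
  nlinarith [Real.exp_pos (-y)]

theorem tsum_mul_exp_neg_mul_sq_tail_le {a D x₀ : ℝ} (ha : 0 < a) (hD : 2 ≤ D) (hx : D / 2 ≤ x₀)
    (hx' : x₀ ≤ D / 2 + 1) :
    (Summable fun j : ℕ => 2 * a * (x₀ + j) * Real.exp (-a * (x₀ + j) ^ 2)) ∧
    ∑' j : ℕ, 2 * a * (x₀ + j) * Real.exp (-a * (x₀ + j) ^ 2) ≤
      Real.exp (-(a * D ^ 2 / 4)) * (2 * (a * D) + 1 + 1 / D) := by
  have hD0 : 0 < D := by linarith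
  set G : ℕ → ℝ := fun j => Real.exp (-a * (x₀ + j) ^ 2) with hG
  have hs := (tsum_exp_neg_mul_sq_tail_le ha hD0 hx).1
  have hs1 : Summable fun j : ℕ => G (j + 1) := (summable_nat_add_iff 1).2 hs
  have hB : HasSum (fun j : ℕ => (G j - G (j + 1)) + a * G (j + 1))
      (G 0 + a * ∑' j : ℕ, G (j + 1)) := by
    have h := (hs.hasSum.sub hs1.hasSum).add (hs1.hasSum.mul_left a)
    rwa [hs.tsum_eq_zero_add, add_sub_cancel_right] at h
  have hterm : ∀ j : ℕ, 2 * a * (x₀ + (j + 1 : ℕ)) * G (j + 1) ≤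
      (G j - G (j + 1)) + a * G (j + 1) := by
    intro j
    have h1 : G j = G (j + 1) * Real.exp (a * (2 * (x₀ + j) + 1)) := by
      simp only [hG]
      rw [← Real.exp_add]
      congr 1
      push_cast
      ring
    have h2 := Real.add_one_le_exp (a * (2 * (x₀ + j) + 1))
    have h3 : 0 < G (j + 1) := Real.exp_pos _
    rw [h1]
    push_cast
    nlinarith
  have hT1 : Summable fun j : ℕ => 2 * a * (x₀ + (j + 1 : ℕ)) * G (j + 1) :=
    Summable.of_nonneg_of_le (fun j => by
      have : 0 ≤ x₀ := by linarith
      have : 0 < G (j + 1) := Real.exp_pos _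
      positivity) hterm hB.summable
  have hT : Summable fun j : ℕ => 2 * a * (x₀ + j) * G j :=
    (summable_nat_add_iff (f := fun j : ℕ => 2 * a * (x₀ + j) * G j) 1).1 hT1
  refine ⟨hT, ?_⟩
  rw [hT.tsum_eq_zero_add]
  have h1 := hasSum_le hterm hT1.hasSum hB
  have hr1 : Real.exp (-(a * D)) < 1 := by rw [Real.exp_lt_one_iff]; nlinarith
  have hg := ((hasSum_geometric_of_lt_one (Real.exp_pos (-(a * D))).le hr1).mul_left
    (Real.exp (-(a * D)))).mul_left (Real.exp (-(a * D ^ 2 / 4)))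
  have h2 : ∑' j : ℕ, G (j + 1) ≤ Real.exp (-(a * D ^ 2 / 4)) * (1 / (a * D)) := by
    refine (hasSum_le (fun j => ?_) hs1.hasSum hg).trans ?_
    · refine (exp_neg_mul_sq_tail_le ha hD0.le hx (j + 1)).trans (le_of_eq ?_)
      rw [pow_succ' (Real.exp (-(a * D)))]
    · rw [← div_eq_mul_inv]
      exact mul_le_mul_of_nonneg_left (exp_neg_div_one_sub_exp_neg_le (by positivity))
        (Real.exp_pos _).le
  have h3 : G 0 ≤ Real.exp (-(a * D ^ 2 / 4)) := by
    simpa only [pow_zero, mul_one] using exp_neg_mul_sq_tail_le ha hD0.le hx 0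
  have h4 : 2 * a * (x₀ + (0 : ℕ)) * G 0 ≤ 2 * (a * D) * Real.exp (-(a * D ^ 2 / 4)) := by
    have : 0 ≤ x₀ := by linarith
    have h5 : 2 * a * (x₀ + (0 : ℕ)) ≤ 2 * (a * D) := by push_cast; nlinarith
    exact mul_le_mul h5 h3 (Real.exp_pos _).le (by positivity)
  have h5 : a * ∑' j : ℕ, G (j + 1) ≤ Real.exp (-(a * D ^ 2 / 4)) * (1 / D) := by
    calc a * ∑' j : ℕ, G (j + 1) ≤ a * (Real.exp (-(a * D ^ 2 / 4)) * (1 / (a * D))) := by gcongr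
      _ = _ := by field_simp
  linarith

theorem sum_Ioc_eq_tsum_sub {E : Type*} [NormedAddCommGroup E] [CompleteSpace E] {c : ℤ → E}
    (hc : Summable c) (m : ℤ) (d : ℕ) :
    ∑ k ∈ Finset.Ioc (m - d) m, c k =
      ∑' k, c k - ∑' j : ℕ, c (m + 1 + j) - ∑' j : ℕ, c (m - d - j) := by
  have hr : Function.Injective fun j : ℕ => m + 1 + (j : ℤ) := fun i j h => by simpa using h
  have hl : Function.Injective fun j : ℕ => m - d - (j : ℤ) := fun i j h => by simpa using h
  have h1 := hc.sum_add_tsum_compl (s := Finset.Ioc (m - (d : ℤ)) m)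
  have hcompl : ((Finset.Ioc (m - (d : ℤ)) m : Finset ℤ) : Set ℤ)ᶜ =
      Set.range (fun j : ℕ => m + 1 + (j : ℤ)) ∪ Set.range (fun j : ℕ => m - d - (j : ℤ)) := by
    ext k
    simp only [Finset.coe_Ioc, Set.mem_compl_iff, Set.mem_Ioc, Set.mem_union, Set.mem_range]
    constructor
    · intro h
      rcases lt_or_ge m k with hk | hk
      · exact Or.inl ⟨(k - m - 1).toNat, by omega⟩
      · exact Or.inr ⟨(m - d - k).toNat, by omega⟩
    · rintro (⟨j, rfl⟩ | ⟨j, rfl⟩) <;> omega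
  have hdisj : Disjoint (Set.range (fun j : ℕ => m + 1 + (j : ℤ)))
      (Set.range (fun j : ℕ => m - d - (j : ℤ))) := by
    rw [Set.disjoint_left]
    rintro k ⟨i, rfl⟩ ⟨j, hj⟩
    simp only at hj
    omega
  rw [hcompl, (hc.subtype _).tsum_union_disjoint hdisj (hc.subtype _), tsum_range _ hr,
    tsum_range _ hl] at h1
  rw [← h1]
  abel

/-- The error of one step: the sum of the derivatives of a wave packet over the `d` integers
around its centre. -/
theorem norm_sum_deriv_gaussPacket_le {σ κ μ β v a M : ℝ} {P : ℂ → ℂ} {d : ℕ} {m : ℤ}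
    (hσ : 0 < σ) (hd : 2 ≤ d) (hv : 0 < v) (hβ : 0 ≤ β) (hP : Differentiable ℂ P)
    (hPim : ∀ x y : ℝ, |(P (x + y * Complex.I)).im| ≤ Real.sinh (β * |y|))
    (hM : ∀ x : ℝ, ‖deriv P x‖ ≤ M) (hma : ∀ s : ℤ, s ≠ 0 → |(s : ℝ)| - 1 + a ≤ |μ + s|)
    (hκ₁ : m - (d : ℝ) / 2 ≤ κ) (hκ₂ : κ ≤ m + 1 - (d : ℝ) / 2) :
    ‖∑ k ∈ Finset.Ioc (m - d) m, gaussPacket σ κ μ P (k : ℝ) * packetLogDeriv σ κ μ P k‖ ≤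
      4 * Real.pi * σ * Real.exp (Real.pi / σ ^ 2 * v ^ 2 + Real.sinh (β * v) -
        2 * Real.pi * a * v) / (1 - Real.exp (-(2 * Real.pi * v))) ^ 2 +
      2 * (Real.exp (-(Real.pi / σ ^ 2 * d ^ 2 / 4)) *
        ((M + 2 * Real.pi * |μ|) / (1 - Real.exp (-(Real.pi / σ ^ 2 * d))) +
          (2 * (Real.pi / σ ^ 2 * d) + 1 + 1 / d))) := by
  obtain ⟨hs, hle⟩ := norm_tsum_deriv_gaussPacket_le (κ := κ) hσ hv hβ hP hPim hM hma
  set c : ℤ → ℂ := fun k => gaussPacket σ κ μ P (k : ℝ) * packetLogDeriv σ κ μ P k with hc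
  have hPr : ∀ x : ℝ, (P x).im = 0 := fun x => by simpa using hPim x 0
  have ha : 0 < Real.pi / σ ^ 2 := by positivity
  have hM0 : 0 ≤ M := (norm_nonneg _).trans (hM 0)
  have hd' : (2 : ℝ) ≤ d := by exact_mod_cast hd
  have hcn : ∀ k : ℤ, ‖c k‖ ≤ 2 * (Real.pi / σ ^ 2) * |(k : ℝ) - κ| *
      Real.exp (-(Real.pi / σ ^ 2) * |(k : ℝ) - κ| ^ 2) +
      (M + 2 * Real.pi * |μ|) * Real.exp (-(Real.pi / σ ^ 2) * |(k : ℝ) - κ| ^ 2) := by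
    intro k
    rw [hc, norm_mul, norm_gaussPacket_ofReal σ κ μ hPr, sq_abs, ← add_mul, mul_comm]
    refine mul_le_mul_of_nonneg_right ((norm_packetLogDeriv_le hM k).trans (le_of_eq ?_))
      (Real.exp_pos _).le
    ring
  have htail : ∀ (f : ℕ → ℤ) (x₀ : ℝ), (d : ℝ) / 2 ≤ x₀ → x₀ ≤ (d : ℝ) / 2 + 1 →
      (∀ j : ℕ, |(f j : ℝ) - κ| = x₀ + j) →
      ‖∑' j : ℕ, c (f j)‖ ≤ Real.exp (-(Real.pi / σ ^ 2 * d ^ 2 / 4)) *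
        ((M + 2 * Real.pi * |μ|) / (1 - Real.exp (-(Real.pi / σ ^ 2 * d))) +
          (2 * (Real.pi / σ ^ 2 * d) + 1 + 1 / d)) := by
    intro f x₀ h1 h2 hf
    obtain ⟨s1, l1⟩ := tsum_exp_neg_mul_sq_tail_le ha (by linarith : (0 : ℝ) < d) h1
    obtain ⟨s2, l2⟩ := tsum_mul_exp_neg_mul_sq_tail_le ha hd' h1 h2
    have := tsum_of_norm_bounded (s2.hasSum.add (s1.hasSum.mul_left (M + 2 * Real.pi * |μ|)))
      (f := fun j => c (f j)) (fun j => by simpa only [hf] using hcn (f j))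
    refine this.trans ?_
    have hpos : 0 ≤ M + 2 * Real.pi * |μ| := by positivity
    have := mul_le_mul_of_nonneg_left l1 hpos
    refine (add_le_add l2 this).trans (le_of_eq ?_)
    ring
  have hR := htail (fun j => m + 1 + j) (m + 1 - κ) (by linarith) (by linarith) (fun j => by
    push_cast
    rw [abs_of_nonneg (by have : (0:ℝ) ≤ j := j.cast_nonneg
                          linarith)]
    ring)
  have hL := htail (fun j => m - d - j) (κ - (m - d)) (by linarith) (by linarith) (fun j => by
    push_cast
    rw [abs_of_nonpos (by have : (0:ℝ) ≤ j := j.cast_nonneg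
                          linarith)]
    ring)
  rw [sum_Ioc_eq_tsum_sub hs m d]
  refine (norm_sub_le _ _).trans ?_
  have := norm_sub_le (∑' k, c k) (∑' j : ℕ, c (m + 1 + j))
  linarith

end QuantumClock

namespace QuantumClock

/-! ### Numerical inequalities for the error of one step -/

theorem sinh_mul_le {s x : ℝ} (hs0 : 0 ≤ s) (hs1 : s ≤ 1) (hx : 0 ≤ x) :
    Real.sinh (s * x) ≤ s * Real.sinh x := by
  refine hasSum_le (fun n => ?_) (Real.hasSum_sinh (s * x)) ((Real.hasSum_sinh x).mul_left s)
  rw [mul_pow, mul_div_assoc]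
  have h : s ^ (2 * n + 1) ≤ s := by
    simpa using pow_le_pow_of_le_one hs0 hs1 (show 1 ≤ 2 * n + 1 by omega)
  gcongr

theorem sinh_le_of_exp_le {x K : ℝ} (h : Real.exp x ≤ K) :
    Real.sinh x ≤ (K - 1 / K) / 2 := by
  rw [Real.sinh_eq, Real.exp_neg]
  have h1 : 1 / K ≤ (Real.exp x)⁻¹ := by
    rw [← one_div]; exact one_div_le_one_div_of_le (Real.exp_pos x) h
  linarith

theorem exp_three_halves_le : Real.exp (3 / 2) ≤ 4.5 := by
  have h1 : Real.exp (3 / 2) = Real.exp 1 * Real.exp (1 / 2) := by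
    rw [← Real.exp_add]; norm_num
  have h2 : Real.exp (1 / 2) ≤ 1.65 := by
    have := Real.exp_bound' (x := 1 / 2) (by norm_num) (by norm_num) (n := 5) (by norm_num)
    refine this.trans ?_
    norm_num [Finset.sum_range_succ, Nat.factorial]
  rw [h1]
  have h3 := Real.exp_one_lt_d9
  nlinarith [Real.exp_pos 1, Real.exp_pos (1 / 2)]

theorem sinh_le_three_halves_mul {y : ℝ} (h0 : 0 ≤ y) (h1 : y ≤ 3 / 2) :
    Real.sinh y ≤ 3 / 2 * y := by
  have h := sinh_mul_le (s := y / (3 / 2)) (x := 3 / 2) (by positivity)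
    ((div_le_one (by norm_num)).2 h1) (by norm_num)
  rw [div_mul_cancel₀ _ (by norm_num)] at h
  have h2 := sinh_le_of_exp_le exp_three_halves_le
  have h3 : y / (3 / 2) * Real.sinh (3 / 2) ≤ y / (3 / 2) * ((4.5 - 1 / 4.5) / 2) := by gcongr
  norm_num at h3
  linarith

theorem log_le_div_exp_one {t : ℝ} (ht : 0 < t) : Real.log t ≤ t / Real.exp 1 := by
  have h := Real.add_one_le_exp (Real.log t - 1)
  rw [Real.exp_sub, Real.exp_log ht] at h
  linarith

theorem sinh_log_le {q w : ℝ} (hq0 : 0 < q) (hq1 : q ≤ 1) (hw : 4 ≤ w) :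
    Real.sinh (q * (1 - q) * (2 * Real.log (w / q)) / kap) ≤ w ^ 2 / 4 * (1 - q ^ 2) := by
  set v := w / 4 with hv
  have hv1 : 1 ≤ v := by rw [hv]; linarith
  set a := 2 * q * (1 - q) / kap with ha
  have hk : kap = 792 / 1000 := rfl
  have ha0 : 0 ≤ a := by
    rw [ha, hk]
    have : 0 ≤ 1 - q := by linarith
    positivity
  have ha' : a = 250 / 99 * (q * (1 - q)) := by rw [ha, hk]; ring
  have ha1 : a ≤ 1 := by rw [ha']; nlinarith [sq_nonneg (q - 1 / 2)]
  have hlog : Real.log (w / q) = Real.log (4 / q) + Real.log v := by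
    rw [← Real.log_mul (by positivity) (by positivity)]
    congr 1
    rw [hv]; field_simp
  have hlv : 0 ≤ Real.log v := Real.log_nonneg hv1
  have hl4 : 0 ≤ Real.log (4 / q) := Real.log_nonneg (by rw [le_div_iff₀ hq0]; linarith)
  set y := a * Real.log (4 / q) with hy
  set s := a * Real.log v with hs
  have harg : q * (1 - q) * (2 * Real.log (w / q)) / kap = y + s := by
    rw [hlog, hy, hs, ha]; ring
  have hsplit : Real.sinh (y + s) = Real.exp s * Real.sinh y + Real.exp (-y) * Real.sinh s := by
    rw [Real.sinh_eq, Real.sinh_eq, Real.sinh_eq, neg_add, Real.exp_add, Real.exp_add]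
    ring
  have hy0 : 0 ≤ y := by positivity
  have hs0 : 0 ≤ s := by positivity
  have hqlog : q * Real.log (4 / q) ≤ 1.3863 * q + 0.3679 := by
    rw [Real.log_div (by norm_num) hq0.ne', show (4 : ℝ) = 2 ^ 2 by norm_num, Real.log_pow]
    have h1 := log_le_div_exp_one (inv_pos.2 hq0)
    rw [Real.log_inv] at h1
    have h2 := Real.log_two_lt_d9
    have h3 : q * (-Real.log q) ≤ 1 / Real.exp 1 := by
      calc q * (-Real.log q) ≤ q * (q⁻¹ / Real.exp 1) := by gcongr
        _ = _ := by field_simp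
    have h4 : 1 / Real.exp 1 ≤ 0.3679 := by
      rw [div_le_iff₀ (Real.exp_pos 1)]
      have := Real.exp_one_gt_d9
      nlinarith
    push_cast
    nlinarith
  have hyle : y ≤ (1 - q) * (3.5009 * q + 0.9291) := by
    have h1 : y = (1 - q) * (250 / 99 * (q * Real.log (4 / q))) := by rw [hy, ha']; ring
    rw [h1]
    refine mul_le_mul_of_nonneg_left ?_ (by linarith)
    linarith
  have hy32 : y ≤ 3 / 2 := hyle.trans (by nlinarith [sq_nonneg (q - 0.367)])
  have hsinhy := sinh_le_three_halves_mul hy0 hy32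
  have hexps : Real.exp s ≤ v ^ 2 := by
    have h1 : s ≤ Real.log (v ^ 2) := by
      rw [Real.log_pow, hs]; push_cast; nlinarith
    calc Real.exp s ≤ Real.exp (Real.log (v ^ 2)) := Real.exp_le_exp.2 h1
      _ = v ^ 2 := Real.exp_log (by positivity)
  have hsinhs : Real.sinh s ≤ a * (v ^ 2 / 2) := by
    refine (sinh_mul_le ha0 ha1 hlv).trans ?_
    gcongr
    rw [Real.sinh_log (by positivity)]
    have : 0 ≤ v⁻¹ := by positivity
    nlinarith
  have hexpy : Real.exp (-y) ≤ 1 := by rw [Real.exp_le_one_iff]; linarith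
  have hsy : 0 ≤ Real.sinh y := Real.sinh_nonneg_iff.2 hy0
  have hss : 0 ≤ Real.sinh s := Real.sinh_nonneg_iff.2 hs0
  have hw2 : w ^ 2 / 4 = 4 * v ^ 2 := by rw [hv]; ring
  rw [harg, hsplit, hw2]
  have h1 : Real.exp s * Real.sinh y ≤ v ^ 2 * (3 / 2 * y) := by gcongr
  have h2 : Real.exp (-y) * Real.sinh s ≤ 1 * (a * (v ^ 2 / 2)) := by gcongr
  have h3 : 3 / 2 * y + a / 2 ≤ 4 * (1 - q ^ 2) := by
    rw [ha']
    nlinarith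
  nlinarith [mul_le_mul_of_nonneg_left h3 (sq_nonneg v)]

theorem sq_rpow_five_quarters_ge : 2 * Real.pi ≤ (2 * Real.pi) ^ ((5 : ℝ) / 4) := by
  have h : (1 : ℝ) ≤ 2 * Real.pi := by linarith [Real.pi_gt_three]
  calc 2 * Real.pi = (2 * Real.pi) ^ (1 : ℝ) := (Real.rpow_one _).symm
    _ ≤ _ := Real.rpow_le_rpow_of_exponent_le h (by norm_num)

theorem rpow_three_halves {x : ℝ} (hx : 0 < x) : x ^ ((3 : ℝ) / 2) = x * Real.sqrt x := by
  rw [show (3 : ℝ) / 2 = 1 + 1 / 2 by norm_num, Real.rpow_add hx, Real.rpow_one,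
    Real.sqrt_eq_rpow]

theorem two_mul_div_exp_one_le {s : ℝ} (hs : 0 ≤ s) : 2 * (s / Real.exp 1) ≤ 0.75 * s := by
  rw [← mul_div_assoc, div_le_iff₀ (Real.exp_pos 1)]
  have := Real.exp_one_gt_d9
  nlinarith

theorem le_of_sixteen_le_mul_sq {t : ℝ} (ht : 0 < t) (h : 16 ≤ 3.15 * t ^ 2) : 2.25 ≤ t := by
  nlinarith

theorem le_sqrt_exp_one_mul {t : ℝ} (ht : 2.25 ≤ t) :
    1.7 ≤ Real.sqrt (Real.exp 1 / 2 * t) := by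
  refine Real.le_sqrt_of_sq_le ?_
  have := Real.exp_one_gt_d9
  nlinarith

theorem two_mul_sq_le_one_add_pi_sq : 2 * (17 / 16 : ℝ) ^ 2 ≤ (1 + Real.pi ^ 2 / 8) * 1.7 := by
  nlinarith [Real.pi_gt_three]

set_option maxHeartbeats 800000 in
/-- The error bound in the first case of `epsTwo`. -/
theorem exists_rate_of_eight_le_calN {d σ α b υ : ℝ} (hd : 0 < d) (hσ : 0 < σ)
    (hα0 : 0 < α) (hα1 : α ≤ 1) (hb : 0 ≤ b) (hX : 1 < Real.pi * α ^ 2 * σ ^ 2)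
    (hυ : υ = Real.pi * α * kap / Real.log (Real.pi * α ^ 2 * σ ^ 2) * b)
    (hN : 8 ≤ Real.pi * α ^ 2 / (2 * (υ + d / σ ^ 2) ^ 2) * (d / σ) ^ 2) :
    Real.pi * b / d ≤ 1 ∧ ∃ v : ℝ, 0 < v ∧
      4 * Real.pi * σ * Real.exp (Real.pi / σ ^ 2 * v ^ 2 + Real.sinh (2 * Real.pi * b / d * v) -
        2 * Real.pi * (α / 2) * v) / (1 - Real.exp (-(2 * Real.pi * v))) ^ 2 ≤
      (2 * Real.pi) ^ ((5 : ℝ) / 4) * σ ^ ((3 : ℝ) / 2) * (1 + Real.pi ^ 2 / 8) *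
        Real.sqrt (Real.exp 1 / 2 * (α / (υ * σ ^ 2 / d + 1))) *
        Real.exp (-(Real.pi / 4) * (α ^ 2 / (d / σ ^ 2 + υ) ^ 2) * (d / σ) ^ 2) := by
  have hπ := Real.pi_pos
  have hk : kap = 792 / 1000 := rfl
  set X := Real.pi * α ^ 2 * σ ^ 2 with hXd
  set L := Real.log X with hL
  have hL0 : 0 < L := Real.log_pos hX
  have hυ0 : 0 ≤ υ := by rw [hυ, hk]; positivity
  have hpos : 0 < υ + d / σ ^ 2 := by positivity
  set q := (d / σ ^ 2) / (υ + d / σ ^ 2) with hq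
  have hq0 : 0 < q := by positivity
  have hq1 : q ≤ 1 := by rw [hq, div_le_one hpos]; linarith
  set w := Real.sqrt X * q with hw
  have hsX : Real.sqrt X ^ 2 = X := Real.sq_sqrt (by linarith)
  have hw2 : w ^ 2 = X * q ^ 2 := by rw [hw, mul_pow, hsX]
  have hN' : Real.pi * α ^ 2 / (2 * (υ + d / σ ^ 2) ^ 2) * (d / σ) ^ 2 = w ^ 2 / 2 := by
    rw [hw2, hXd, hq]; field_simp
  have hw16 : 16 ≤ w ^ 2 := by linarith
  have hw0 : 0 < w := mul_pos (Real.sqrt_pos.2 (by linarith)) hq0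
  have hw4 : 4 ≤ w := by
    refine (pow_le_pow_iff_left₀ (by norm_num) hw0.le two_ne_zero).1 ?_
    linarith
  have hLlog : L = 2 * Real.log (w / q) := by
    rw [hw, mul_div_assoc, div_self hq0.ne', mul_one, Real.log_sqrt (by linarith)]; ring
  have hυq : υ * (σ ^ 2 / d) * q = 1 - q := by
    rw [hq]; field_simp; ring
  have hbL : Real.pi * α * b = υ * L / kap := by
    rw [hυ, hk]; field_simp
  have hb1 : Real.pi * b / d ≤ 1 := by
    have h1 : L ≤ 2 * (Real.sqrt X / Real.exp 1) := by
      rw [hL, ← hsX, Real.log_pow, Real.sqrt_sq (Real.sqrt_nonneg _)]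
      have := log_le_div_exp_one (Real.sqrt_pos.2 (show 0 < X by linarith))
      push_cast
      linarith
    have h2 : Real.pi * b / d = L * (υ * (σ ^ 2 / d) * q) / (kap * α * σ ^ 2 * q) := by
      have : Real.pi * b = υ * L / kap / α := by rw [← hbL]; field_simp
      rw [this, hk]; field_simp
    rw [h2, hυq, div_le_one (by rw [hk]; positivity)]
    have h5 : L * (1 - q) ≤ 2 * (Real.sqrt X / Real.exp 1) * 1 := by
      refine mul_le_mul h1 (by linarith) (by linarith) (by positivity)
    have h6 := two_mul_div_exp_one_le (Real.sqrt_nonneg X)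
    have h7 : Real.sqrt X * 4 ≤ X * q := by
      rw [← hsX, sq, mul_assoc, Real.sqrt_mul_self (Real.sqrt_nonneg X)]
      exact mul_le_mul_of_nonneg_left hw4 (Real.sqrt_nonneg X)
    have h8 : X * q ≤ 3.15 * (α * σ ^ 2 * q) := by
      have e1 : X * q = Real.pi * α * (α * σ ^ 2 * q) := by rw [hXd]; ring
      rw [e1]
      refine mul_le_mul_of_nonneg_right ?_ (by positivity)
      calc Real.pi * α ≤ Real.pi * 1 := by gcongr
        _ ≤ 3.15 := by linarith [Real.pi_lt_d2]
    rw [hk]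
    linarith
  refine ⟨hb1, σ ^ 2 * α * q ^ 2 / 2, by positivity, ?_⟩
  -- the exponent
  have hsinh : Real.sinh (2 * Real.pi * b / d * (σ ^ 2 * α * q ^ 2 / 2)) ≤
      w ^ 2 / 4 * (1 - q ^ 2) := by
    have h1 : 2 * Real.pi * b / d * (σ ^ 2 * α * q ^ 2 / 2) =
        q * (1 - q) * (2 * Real.log (w / q)) / kap := by
      rw [← hLlog, ← hυq]
      have : 2 * Real.pi * b / d * (σ ^ 2 * α * q ^ 2 / 2) =
        (Real.pi * α * b) * (σ ^ 2 / d) * q ^ 2 := by ring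
      rw [this, hbL]; ring
    rw [h1]
    exact sinh_log_le hq0 hq1 hw4
  have hE : Real.pi / σ ^ 2 * (σ ^ 2 * α * q ^ 2 / 2) ^ 2 +
      Real.sinh (2 * Real.pi * b / d * (σ ^ 2 * α * q ^ 2 / 2)) -
        2 * Real.pi * (α / 2) * (σ ^ 2 * α * q ^ 2 / 2) ≤
      -(Real.pi / 4) * (α ^ 2 / (d / σ ^ 2 + υ) ^ 2) * (d / σ) ^ 2 := by
    have h1 : -(Real.pi / 4) * (α ^ 2 / (d / σ ^ 2 + υ) ^ 2) * (d / σ) ^ 2 = -(w ^ 2 / 4) := by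
      rw [hw2, hXd, hq, add_comm υ]; field_simp
    have h2 : Real.pi / σ ^ 2 * (σ ^ 2 * α * q ^ 2 / 2) ^ 2 = w ^ 2 / 4 * q ^ 2 := by
      rw [hw2, hXd]; field_simp; ring
    have h3 : 2 * Real.pi * (α / 2) * (σ ^ 2 * α * q ^ 2 / 2) = w ^ 2 / 2 := by
      rw [hw2, hXd]; ring
    rw [h1, h2, h3]
    linarith
  have hden : (16 / 17 : ℝ) ^ 2 ≤
      (1 - Real.exp (-(2 * Real.pi * (σ ^ 2 * α * q ^ 2 / 2)))) ^ 2 := by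
    have h1 : 16 ≤ 2 * Real.pi * (σ ^ 2 * α * q ^ 2 / 2) := by
      have : w ^ 2 ≤ 2 * Real.pi * (σ ^ 2 * α * q ^ 2 / 2) := by
        rw [hw2, hXd]
        have : α * (Real.pi * σ ^ 2 * α * q ^ 2) ≤ 1 * (Real.pi * σ ^ 2 * α * q ^ 2) := by
          gcongr
        linarith
      linarith
    have h2 : Real.exp (-(2 * Real.pi * (σ ^ 2 * α * q ^ 2 / 2))) ≤ 1 / 17 := by
      rw [Real.exp_neg, ← one_div]
      refine one_div_le_one_div_of_le (by norm_num) ?_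
      linarith [Real.add_one_le_exp (2 * Real.pi * (σ ^ 2 * α * q ^ 2 / 2))]
    exact pow_le_pow_left₀ (by norm_num) (by linarith) 2
  -- the prefactor
  have hpre : 1.7 * σ ≤ σ ^ ((3 : ℝ) / 2) *
      Real.sqrt (Real.exp 1 / 2 * (α / (υ * σ ^ 2 / d + 1))) := by
    have h1 : α / (υ * σ ^ 2 / d + 1) = α * q := by rw [hq]; field_simp
    have h2 : 2.25 ≤ σ * (α * q) := by
      have h3 : (16 : ℝ) ≤ 3.15 * (σ * (α * q)) ^ 2 := by
        have : w ^ 2 = Real.pi * (σ * (α * q)) ^ 2 := by rw [hw2, hXd]; ring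
        rw [this] at hw16
        refine hw16.trans ?_
        gcongr
        exact Real.pi_lt_d2.le
      exact le_of_sixteen_le_mul_sq (by positivity) h3
    rw [rpow_three_halves hσ, h1, mul_assoc, ← Real.sqrt_mul hσ.le, mul_comm,
      show σ * (Real.exp 1 / 2 * (α * q)) = Real.exp 1 / 2 * (σ * (α * q)) by ring]
    exact mul_le_mul_of_nonneg_left (le_sqrt_exp_one_mul h2) hσ.le
  calc 4 * Real.pi * σ * Real.exp (Real.pi / σ ^ 2 * (σ ^ 2 * α * q ^ 2 / 2) ^ 2 +
        Real.sinh (2 * Real.pi * b / d * (σ ^ 2 * α * q ^ 2 / 2)) -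
        2 * Real.pi * (α / 2) * (σ ^ 2 * α * q ^ 2 / 2)) /
        (1 - Real.exp (-(2 * Real.pi * (σ ^ 2 * α * q ^ 2 / 2)))) ^ 2
      ≤ 4 * Real.pi * σ *
          Real.exp (-(Real.pi / 4) * (α ^ 2 / (d / σ ^ 2 + υ) ^ 2) * (d / σ) ^ 2) /
          (16 / 17) ^ 2 := by gcongr
    _ = (2 * Real.pi) * (2 * (17 / 16) ^ 2 * σ) *
          Real.exp (-(Real.pi / 4) * (α ^ 2 / (d / σ ^ 2 + υ) ^ 2) * (d / σ) ^ 2) := by ring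
    _ ≤ ((2 * Real.pi) ^ ((5 : ℝ) / 4)) * ((1 + Real.pi ^ 2 / 8) * (σ ^ ((3 : ℝ) / 2) *
          Real.sqrt (Real.exp 1 / 2 * (α / (υ * σ ^ 2 / d + 1))))) *
          Real.exp (-(Real.pi / 4) * (α ^ 2 / (d / σ ^ 2 + υ) ^ 2) * (d / σ) ^ 2) := by
        have h1 : 2 * (17 / 16) ^ 2 * σ ≤ (1 + Real.pi ^ 2 / 8) * (1.7 * σ) := by
          rw [← mul_assoc]
          exact mul_le_mul_of_nonneg_right two_mul_sq_le_one_add_pi_sq hσ.le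
        have h2 := sq_rpow_five_quarters_ge
        refine mul_le_mul_of_nonneg_right (mul_le_mul h2 (h1.trans ?_) (by positivity)
          (by positivity)) (Real.exp_pos _).le
        exact mul_le_mul_of_nonneg_left hpre (by positivity)
    _ = _ := by ring

end QuantumClock

namespace QuantumClock

theorem exp_neg_half_mul_cube_le {Z : ℝ} (hZ : 0 < Z) :
    Real.exp (-(Z / 2)) / (1 - Real.exp (-Z)) ^ 2 ≤ 14.4 / Z ^ 3 := by
  have hE : Real.exp (-Z) ≤ 1 / (1 + Z) := by
    rw [Real.exp_neg, ← one_div]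
    exact one_div_le_one_div_of_le (by linarith) (by linarith [Real.add_one_le_exp Z])
  have hlt : Real.exp (-Z) < 1 := by rw [Real.exp_lt_one_iff]; linarith
  rw [div_le_div_iff₀ (by have : 0 < 1 - Real.exp (-Z) := by linarith
                          positivity) (by positivity)]
  rcases le_total Z 2 with h | h
  · have h1 : Z / (1 + Z) ≤ 1 - Real.exp (-Z) := by
      have : Z / (1 + Z) = 1 - 1 / (1 + Z) := by field_simp; ring
      linarith
    have h2 : (Z / (1 + Z)) ^ 2 ≤ (1 - Real.exp (-Z)) ^ 2 := by gcongr
    have h3 : Real.exp (-(Z / 2)) ≤ 1 / (1 + Z / 2) := by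
      rw [Real.exp_neg, ← one_div]
      exact one_div_le_one_div_of_le (by linarith) (by linarith [Real.add_one_le_exp (Z / 2)])
    calc Real.exp (-(Z / 2)) * Z ^ 3 ≤ 1 / (1 + Z / 2) * Z ^ 3 := by gcongr
      _ ≤ 14.4 * (Z / (1 + Z)) ^ 2 := by
        rw [div_pow, ← mul_div_assoc, one_div_mul_eq_div, div_le_div_iff₀ (by positivity)
          (by positivity)]
        have h4 : Z * (1 + Z) ^ 2 ≤ 14.4 * (1 + Z / 2) := by nlinarith
        calc Z ^ 3 * (1 + Z) ^ 2 = Z ^ 2 * (Z * (1 + Z) ^ 2) := by ring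
          _ ≤ Z ^ 2 * (14.4 * (1 + Z / 2)) := by gcongr
          _ = _ := by ring
      _ ≤ _ := by gcongr
  · have h1 : Real.exp (-Z) ≤ 0.1354 := by
      have h2 : Real.exp (-Z) ≤ Real.exp (-1) ^ 2 := by
        rw [← Real.exp_nat_mul]
        exact Real.exp_le_exp.2 (by push_cast; linarith)
      have h3 : Real.exp (-1) ≤ 0.36788 := Real.exp_neg_one_lt_d9.le.trans (by norm_num)
      have h4 := Real.exp_pos (-1)
      nlinarith
    have h2 : Z * Real.exp (-(Z / 6)) ≤ 6 * Real.exp (-1) := by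
      have h3 := Real.add_one_le_exp (Z / 6 - 1)
      have h4 : Z ≤ 6 * Real.exp (Z / 6 - 1) := by linarith
      calc Z * Real.exp (-(Z / 6)) ≤ 6 * Real.exp (Z / 6 - 1) * Real.exp (-(Z / 6)) := by gcongr
        _ = 6 * Real.exp (-1) := by
          rw [mul_assoc, ← Real.exp_add]; congr 2; ring
    have h3 : Real.exp (-(Z / 2)) * Z ^ 3 = (Z * Real.exp (-(Z / 6))) ^ 3 := by
      rw [mul_pow, ← Real.exp_nat_mul, mul_comm]
      congr 2; push_cast; ring
    have h5 : (Z * Real.exp (-(Z / 6))) ^ 3 ≤ (6 * 0.36788) ^ 3 := by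
      have : Real.exp (-1) ≤ 0.36788 := Real.exp_neg_one_lt_d9.le.trans (by norm_num)
      exact pow_le_pow_left₀ (by positivity) (h2.trans (by linarith)) 3
    have h6 : (1 - 0.1354 : ℝ) ^ 2 ≤ (1 - Real.exp (-Z)) ^ 2 := by
      refine pow_le_pow_left₀ (by norm_num) (by linarith) 2
    rw [h3]
    refine h5.trans ?_
    refine le_trans ?_ (mul_le_mul_of_nonneg_left h6 (by norm_num))
    norm_num

theorem exp_one_point_two_nine_le : Real.exp 1.2904 ≤ 3.64 := by
  have h1 : Real.exp 1.2904 = Real.exp 1 * Real.exp 0.2904 := by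
    rw [← Real.exp_add]; norm_num
  have h2 : Real.exp 0.2904 ≤ 1.338 := by
    have := Real.exp_bound' (x := 0.2904) (by norm_num) (by norm_num) (n := 4) (by norm_num)
    refine this.trans ?_
    norm_num [Finset.sum_range_succ, Nat.factorial]
  rw [h1]
  have h3 := Real.exp_one_lt_d9
  nlinarith [Real.exp_pos 1]

theorem exp_one_point_six_nine_le : Real.exp 1.69 ≤ 5.43 := by
  have h1 : Real.exp 1.69 = Real.exp 1 * Real.exp 0.69 := by
    rw [← Real.exp_add]; norm_num
  have h2 : Real.exp 0.69 ≤ 1.995 := by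
    have := Real.exp_bound' (x := 0.69) (by norm_num) (by norm_num) (n := 5) (by norm_num)
    refine this.trans ?_
    norm_num [Finset.sum_range_succ, Nat.factorial]
  rw [h1]
  have h3 := Real.exp_one_lt_d9
  nlinarith [Real.exp_pos 1]

theorem kap_mul_sqrt_div_log_ge : 3.1 ≤ kap * Real.sqrt (6 * Real.pi) / Real.log 3 := by
  have hk : kap = 792 / 1000 := rfl
  have h3 : (0 : ℝ) < Real.log 3 := Real.log_pos (by norm_num)
  have h1 : Real.log 3 ≤ 1.1 := by
    rw [Real.log_le_iff_le_exp (by norm_num)]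
    have h1 : Real.exp 1.1 = Real.exp 1 * Real.exp 0.1 := by
      rw [← Real.exp_add]; norm_num
    have h2 : 1.105 ≤ Real.exp 0.1 := by
      have := Real.quadratic_le_exp_of_nonneg (x := 0.1) (by norm_num)
      refine le_trans ?_ this
      norm_num
    rw [h1]
    have := Real.exp_one_gt_d9
    nlinarith
  have h2 : 4.34 ≤ Real.sqrt (6 * Real.pi) := by
    refine Real.le_sqrt_of_sq_le ?_
    have := Real.pi_gt_d4
    norm_num at this ⊢
    linarith
  rw [le_div_iff₀ h3, hk]
  linarith

theorem three_rpow_const_ge :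
    17.8 ≤ 3 ^ ((7 : ℝ) / 4) / (Real.sqrt (2 * Real.pi) * Real.exp 1) * (8 + Real.pi ^ 2) := by
  have h1 : (6.83 : ℝ) ≤ 3 ^ ((7 : ℝ) / 4) := by
    have : ((3 : ℝ) ^ ((7 : ℝ) / 4)) ^ 4 = 2187 := by
      rw [← Real.rpow_natCast, ← Real.rpow_mul (by norm_num)]; norm_num
    refine (pow_le_pow_iff_left₀ (by norm_num) (by positivity) (four_ne_zero)).1 ?_
    rw [this]; norm_num
  have h2 : Real.sqrt (2 * Real.pi) ≤ 2.507 := by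
    rw [Real.sqrt_le_left (by norm_num)]
    have := Real.pi_lt_d4
    norm_num at this ⊢
    linarith
  have h3 := Real.exp_one_lt_d9
  have h4 : Real.sqrt (2 * Real.pi) * Real.exp 1 ≤ 2.507 * 2.7182818286 :=
    mul_le_mul h2 h3.le (Real.exp_pos 1).le (by norm_num)
  have h5 : 17.85 ≤ 8 + Real.pi ^ 2 := by nlinarith [Real.pi_gt_d2]
  have h6 : 6.83 / (2.507 * 2.7182818286) ≤
      3 ^ ((7 : ℝ) / 4) / (Real.sqrt (2 * Real.pi) * Real.exp 1) := by
    have : 0 < Real.sqrt (2 * Real.pi) * Real.exp 1 := by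
      have := Real.pi_pos; positivity
    gcongr
  refine le_trans ?_ (mul_le_mul h6 h5 (by norm_num) (le_trans (by norm_num) h6))
  norm_num

set_option maxHeartbeats 800000 in
/-- The error bound in the second case of `epsTwo`. -/
theorem exists_rate_cubic {d σ α b c : ℝ} (hd : 0 < d) (hσ : 0 < σ) (hα0 : 0 < α) (hα1 : α ≤ 1)
    (hb : 0 ≤ b) (hc : 3.1 ≤ c) :
    ∃ v : ℝ, 0 < v ∧
      4 * Real.pi * σ * Real.exp (Real.pi / σ ^ 2 * v ^ 2 + Real.sinh (2 * Real.pi * b / d * v) -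
        2 * Real.pi * (α / 2) * v) / (1 - Real.exp (-(2 * Real.pi * v))) ^ 2 ≤
      16 * (1 / α ^ 3) * (c * b + d / σ) ^ 3 * (σ / d ^ 3) := by
  have hπ := Real.pi_pos
  set s := c * b + d / σ with hs
  have hs0 : 0 < s := by positivity
  set f := d / σ / s with hf
  have hf0 : 0 < f := by positivity
  have hf1 : f ≤ 1 := by
    rw [hf, div_le_one hs0, hs]
    have : 0 ≤ c * b := by positivity
    linarith
  set Z := 4 * α * d / s with hZ
  have hZ0 : 0 < Z := by positivity
  refine ⟨2 * d / (Real.pi * s), by positivity, ?_⟩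
  have e1 : Real.pi / σ ^ 2 * (2 * d / (Real.pi * s)) ^ 2 = 4 / Real.pi * f * f := by
    rw [hf]; field_simp; ring
  have e2 : 2 * Real.pi * b / d * (2 * d / (Real.pi * s)) = (1 - f) * (4 / c) := by
    have : 1 - f = c * b / s := by rw [hf, eq_div_iff hs0.ne', sub_mul, div_mul_cancel₀ _ hs0.ne', hs]; ring
    rw [this]; field_simp; ring
  have e3 : 2 * Real.pi * (α / 2) * (2 * d / (Real.pi * s)) = Z / 2 := by
    rw [hZ]; field_simp; norm_num
  have e4 : Z ≤ 2 * Real.pi * (2 * d / (Real.pi * s)) := by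
    have : 2 * Real.pi * (2 * d / (Real.pi * s)) = 4 * 1 * d / s := by field_simp; ring
    rw [this, hZ]; gcongr
  have h1 : 4 / Real.pi * f * f ≤ 1.69 * f := by
    have h2 : 4 / Real.pi * f ≤ 1.69 := by
      have : 4 / Real.pi ≤ 1.69 := by
        rw [div_le_iff₀ hπ]; linarith [Real.pi_gt_three]
      calc 4 / Real.pi * f ≤ 1.69 * 1 := by gcongr
        _ = 1.69 := by ring
    gcongr
  have h2 : Real.sinh ((1 - f) * (4 / c)) ≤ (1 - f) * 1.69 := by
    refine (sinh_mul_le (by linarith) (by linarith) (by positivity)).trans ?_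
    refine mul_le_mul_of_nonneg_left ?_ (by linarith)
    have h3 : 4 / c ≤ 1.2904 := by
      rw [div_le_iff₀ (by linarith)]; linarith
    refine (Real.sinh_le_sinh.2 h3).trans ((sinh_le_of_exp_le exp_one_point_two_nine_le).trans ?_)
    norm_num
  have h3 : Real.exp (Real.pi / σ ^ 2 * (2 * d / (Real.pi * s)) ^ 2 +
      Real.sinh (2 * Real.pi * b / d * (2 * d / (Real.pi * s))) -
      2 * Real.pi * (α / 2) * (2 * d / (Real.pi * s))) ≤ 5.43 * Real.exp (-(Z / 2)) := by
    rw [e1, e2, e3]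
    calc Real.exp (4 / Real.pi * f * f + Real.sinh ((1 - f) * (4 / c)) - Z / 2)
        ≤ Real.exp (1.69 + -(Z / 2)) := Real.exp_le_exp.2 (by linarith)
      _ = Real.exp 1.69 * Real.exp (-(Z / 2)) := Real.exp_add _ _
      _ ≤ _ := by gcongr; exact exp_one_point_six_nine_le
  have h4 : (1 - Real.exp (-Z)) ^ 2 ≤
      (1 - Real.exp (-(2 * Real.pi * (2 * d / (Real.pi * s))))) ^ 2 := by
    have h5 : Real.exp (-Z) ≤ 1 := by rw [Real.exp_le_one_iff]; linarith
    refine pow_le_pow_left₀ (by linarith) ?_ 2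
    have : Real.exp (-(2 * Real.pi * (2 * d / (Real.pi * s)))) ≤ Real.exp (-Z) :=
      Real.exp_le_exp.2 (by linarith)
    linarith
  have h5 : 0 < (1 - Real.exp (-Z)) ^ 2 := by
    have : Real.exp (-Z) < 1 := by rw [Real.exp_lt_one_iff]; linarith
    have : 0 < 1 - Real.exp (-Z) := by linarith
    positivity
  calc _ ≤ 4 * Real.pi * σ * (5.43 * Real.exp (-(Z / 2))) / (1 - Real.exp (-Z)) ^ 2 := by
        gcongr
    _ = 4 * Real.pi * 5.43 * σ * (Real.exp (-(Z / 2)) / (1 - Real.exp (-Z)) ^ 2) := by ring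
    _ ≤ 4 * Real.pi * 5.43 * σ * (14.4 / Z ^ 3) := by
        exact mul_le_mul_of_nonneg_left (exp_neg_half_mul_cube_le hZ0) (by positivity)
    _ = (4 * Real.pi * 5.43 * 14.4 / 64) * (1 / α ^ 3 * s ^ 3 * (σ / d ^ 3)) := by
        rw [hZ]; field_simp; norm_num
    _ ≤ 16 * (1 / α ^ 3 * s ^ 3 * (σ / d ^ 3)) := by
        refine mul_le_mul_of_nonneg_right ?_ (by positivity)
        linarith [Real.pi_lt_d2]
    _ = _ := by ring

theorem cubic_leftover {d σ α b c e : ℝ} (hd : 0 < d) (hσ : 0 < σ) (hα0 : 0 < α) (hα1 : α ≤ 1)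
    (hb : 0 ≤ b) (hc : 3.1 ≤ c) (he0 : 0 < e) (he1 : e ≤ 1) :
    2 * e * (Real.pi * b / d) ≤
      1.8 * (1 / α ^ 3) * (c * b + d / σ) ^ 3 * (σ / d ^ 3) + 2 * e * (Real.pi - 1) := by
  have h1 : 3 * (c * b) ^ 2 * (d / σ) ≤ (c * b + d / σ) ^ 3 := by
    have h2 : 0 ≤ c * b := by positivity
    have h3 : 0 ≤ d / σ := by positivity
    have h4 : 0 ≤ (c * b) ^ 3 + 3 * (c * b) * (d / σ) ^ 2 + (d / σ) ^ 3 := by positivity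
    linarith
  have h2 : 1 ≤ 1 / α ^ 3 := by
    rw [le_div_iff₀ (by positivity), one_mul]
    exact pow_le_one₀ hα0.le hα1
  have h3 : 50 * (b / d) ^ 2 ≤ 1.8 * (1 / α ^ 3) * (c * b + d / σ) ^ 3 * (σ / d ^ 3) := by
    have h6 : 50 * (b / d) ^ 2 ≤ 1.8 * 1 * (3 * (c * b) ^ 2 * (d / σ)) * (σ / d ^ 3) := by
      have : 1.8 * 1 * (3 * (c * b) ^ 2 * (d / σ)) * (σ / d ^ 3) = 5.4 * c ^ 2 * (b / d) ^ 2 := by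
        field_simp; ring
      rw [this]
      refine mul_le_mul_of_nonneg_right ?_ (by positivity)
      nlinarith
    refine h6.trans ?_
    gcongr
  refine le_trans ?_ (add_le_add_left h3 _)
  set t := b / d with ht
  have ht0 : 0 ≤ t := by positivity
  rw [mul_div_assoc, ← ht]
  have h4 : e * (50 * t ^ 2) ≤ 50 * t ^ 2 := by
    have : 0 ≤ 50 * t ^ 2 := by positivity
    nlinarith
  have h5 : 2 * (Real.pi * t) ≤ 50 * t ^ 2 + 2 * (Real.pi - 1) := by
    have h7 := Real.pi_gt_three
    have h8 := Real.pi_lt_four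
    have h9 : Real.pi * t ≤ 4 * t := by gcongr
    nlinarith [sq_nonneg (10 * t - 1)]
  have h6 := mul_le_mul_of_nonneg_left h5 he0.le
  linarith

theorem normConst_pos {d : ℕ} (hd : 0 < d) (σ : ℝ) : 0 < normConst d σ 0 := by
  have h0 : (0 : ℤ) ∈ centredIntegers d 0 := by
    rw [mem_centredIntegers]
    have : (0 : ℝ) < d := by exact_mod_cast hd
    push_cast
    constructor <;> linarith
  have : 0 < gaussSum d σ 0 :=
    Finset.sum_pos (fun k _ => Real.exp_pos _) ⟨0, h0⟩
  unfold normConst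
  positivity

/-- Some contour height makes the error of one step at most `epsT`. -/
theorem exists_rate_le_epsT {d : ℕ} {σ α b : ℝ} (hd : 0 < d) (hσ : 0 < σ) (hσd : σ < d)
    (hα0 : 0 < α) (hα1 : α ≤ 1) (hb : 0 ≤ b) :
    ∃ v : ℝ, 0 < v ∧
      normConst d σ 0 * (4 * Real.pi * σ *
        Real.exp (Real.pi / σ ^ 2 * v ^ 2 + Real.sinh (2 * Real.pi * b / d * v) -
        2 * Real.pi * (α / 2) * v) / (1 - Real.exp (-(2 * Real.pi * v))) ^ 2 +
      2 * (Real.exp (-(Real.pi / σ ^ 2 * d ^ 2 / 4)) *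
        ((Real.pi * b / d + 2 * Real.pi) / (1 - Real.exp (-(Real.pi / σ ^ 2 * d))) +
          (2 * (Real.pi / σ ^ 2 * d) + 1 + 1 / d)))) ≤ epsT d σ α b := by
  have hA := normConst_pos hd σ
  set A := normConst d σ 0 with hAd
  have hπ := Real.pi_pos
  have hd' : (0 : ℝ) < d := by exact_mod_cast hd
  set e := Real.exp (-(Real.pi / σ ^ 2 * d ^ 2 / 4)) with he
  have he0 : 0 < e := Real.exp_pos _
  have he1 : e ≤ 1 := by
    rw [he, Real.exp_le_one_iff]
    have : 0 ≤ Real.pi / σ ^ 2 * d ^ 2 / 4 := by positivity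
    linarith
  obtain ⟨v, hv, hmain⟩ : ∃ v : ℝ, 0 < v ∧ A * (4 * Real.pi * σ *
        Real.exp (Real.pi / σ ^ 2 * v ^ 2 + Real.sinh (2 * Real.pi * b / d * v) -
        2 * Real.pi * (α / 2) * v) / (1 - Real.exp (-(2 * Real.pi * v))) ^ 2) +
        A * (2 * e * (Real.pi * b / d)) ≤
      epsTwo d σ α b + A * (2 * e * (Real.pi - 1)) := by
    by_cases hcase : 8 ≤ calN d σ α b ∧ 1 < Real.pi * α ^ 2 * σ ^ 2
    · have hN := (Nat.le_floor_iff' (by norm_num : 8 ≠ 0)).1 hcase.1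
      obtain ⟨hb1, v, hv, hle⟩ := exists_rate_of_eight_le_calN (υ := rateParam σ α b) hd' hσ hα0 hα1 hb
        hcase.2 rfl (by exact_mod_cast hN)
      refine ⟨v, hv, ?_⟩
      rw [epsTwo, if_pos hcase]
      refine add_le_add ((mul_le_mul_of_nonneg_left hle hA.le).trans (le_of_eq ?_)) ?_
      · rw [← hAd]; ring
      · have : Real.pi * b / d ≤ Real.pi - 1 := by linarith [Real.pi_gt_three]
        gcongr
    · obtain ⟨v, hv, hle⟩ := exists_rate_cubic hd' hσ hα0 hα1 hb kap_mul_sqrt_div_log_ge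
      refine ⟨v, hv, ?_⟩
      have hleft := cubic_leftover hd' hσ hα0 hα1 hb kap_mul_sqrt_div_log_ge he0 he1
      rw [epsTwo, if_neg hcase, ← mul_add]
      set c := kap * Real.sqrt (6 * Real.pi) / Real.log 3 with hc
      have hc0 := kap_mul_sqrt_div_log_ge
      rw [← hc] at hc0
      set W := 1 / α ^ 3 * (c * b + d / σ) ^ 3 * (σ / d ^ 3) with hW
      have hW0 : 0 ≤ W := by positivity
      have h1 : 17.8 * W ≤ 3 ^ ((7 : ℝ) / 4) / (Real.sqrt (2 * Real.pi) * Real.exp 1) *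
          (8 + Real.pi ^ 2) * W := mul_le_mul_of_nonneg_right three_rpow_const_ge hW0
      have h2 : 3 ^ ((7 : ℝ) / 4) / (Real.sqrt (2 * Real.pi) * Real.exp 1) *
          (A * (8 + Real.pi ^ 2) / α ^ 3) * (c * b + d / σ) ^ 3 * (σ / d ^ 3) =
        A * (3 ^ ((7 : ℝ) / 4) / (Real.sqrt (2 * Real.pi) * Real.exp 1) *
          (8 + Real.pi ^ 2) * W) := by rw [hW]; ring
      rw [h2, ← mul_add]
      refine mul_le_mul_of_nonneg_left ?_ hA.le
      refine (add_le_add hle hleft).trans ?_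
      have h3 : 16 * (1 / α ^ 3) * (c * b + d / σ) ^ 3 * (σ / d ^ 3) = 16 * W := by rw [hW]; ring
      have h4 : 1.8 * (1 / α ^ 3) * (c * b + d / σ) ^ 3 * (σ / d ^ 3) = 1.8 * W := by rw [hW]; ring
      rw [h3, h4]
      linarith
  refine ⟨v, hv, ?_⟩
  have hy1 : Real.pi * d / σ ^ 2 = Real.pi / σ ^ 2 * d := by ring
  set y := Real.pi / σ ^ 2 * d with hy
  have hy0 : 0 < y := by positivity
  have hr1 : 0 < 1 - Real.exp (-y) := by
    have : Real.exp (-y) < 1 := by rw [Real.exp_lt_one_iff]; linarith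
    linarith
  have hgeo : 1 / (1 - Real.exp (-y)) ≤ 1 + 1 / y := by
    have := exp_neg_div_one_sub_exp_neg_le hy0
    have h1 : 1 / (1 - Real.exp (-y)) = 1 + Real.exp (-y) / (1 - Real.exp (-y)) := by
      field_simp; ring
    linarith
  have hbb : Real.pi * b / d / (1 - Real.exp (-y)) ≤ Real.pi * b / d + b := by
    have h1 : Real.pi * b / d / (1 - Real.exp (-y)) ≤ Real.pi * b / d * (1 + 1 / y) := by
      rw [div_eq_mul_one_div (Real.pi * b / d)]
      gcongr
    have h2 : Real.pi * b / d * (1 + 1 / y) = Real.pi * b / d + b * (σ / d) ^ 2 := by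
      rw [hy]; field_simp
    have h3 : (σ / d) ^ 2 ≤ 1 := pow_le_one₀ (by positivity) ((div_le_one hd').2 hσd.le)
    nlinarith
  have hb2 : b ≤ (b + 2 * Real.pi / d) / (1 - Real.exp (-(Real.pi * d ^ 2 / σ ^ 2))) := by
    have h1 : Real.exp (-(Real.pi * d ^ 2 / σ ^ 2)) < 1 := by
      rw [Real.exp_lt_one_iff]
      have : 0 < Real.pi * d ^ 2 / σ ^ 2 := by positivity
      linarith
    rw [le_div_iff₀ (by linarith)]
    have h2 : 0 < Real.exp (-(Real.pi * d ^ 2 / σ ^ 2)) := Real.exp_pos _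
    have h3 : 0 ≤ 2 * Real.pi / d := by positivity
    nlinarith
  have hz : Real.pi ≤ Real.pi * d ^ 2 / σ ^ 2 := by
    rw [le_div_iff₀ (by positivity)]
    gcongr
  rw [epsT, ← hAd, hy1, show -(Real.pi / 4) * ((d : ℝ) ^ 2 / σ ^ 2) =
    -(Real.pi / σ ^ 2 * d ^ 2 / 4) by ring, ← he, show 2 * Real.pi * d / σ ^ 2 = 2 * y by
    rw [hy]; ring]
  have hfin : (Real.pi * b / d + 2 * Real.pi) / (1 - Real.exp (-y)) + (2 * y + 1 + 1 / d) ≤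
      2 * Real.pi / (1 - Real.exp (-y)) +
      (b + 2 * Real.pi / d) / (1 - Real.exp (-(Real.pi * d ^ 2 / σ ^ 2))) +
      (2 * y + Real.pi * d ^ 2 / σ ^ 2 + 1 / d) + (Real.pi * b / d - (Real.pi - 1)) := by
    rw [add_div]
    linarith
  have h1 := mul_le_mul_of_nonneg_left hfin (by positivity : 0 ≤ A * (2 * e))
  linarith

end QuantumClock

namespace QuantumClock

/-! ### Unitary evolution -/

section Exponential

attribute [local instance] Matrix.linftyOpNormedRing Matrix.linftyOpNormedAlgebra

theorem hasDerivAt_exp_smul_apply {ι : Type*} [Fintype ι] [DecidableEq ι] (B : Matrix ι ι ℂ)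
    (t : ℝ) (i j : ι) :
    HasDerivAt (fun s : ℝ => NormedSpace.exp (s • B) i j) ((NormedSpace.exp (t • B) * B) i j) t :=
  hasDerivAt_pi.1 (hasDerivAt_pi.1 (hasDerivAt_exp_smul_const (𝕂 := ℝ) B t) i) j

end Exponential

variable {ι κ : Type*} [Fintype ι] [DecidableEq ι] [Fintype κ] [DecidableEq κ]

theorem evolution_zero (H : Matrix ι ι ℂ) : evolution 0 H = 1 := by
  simp [evolution]

theorem evolution_add (s t : ℝ) (H : Matrix ι ι ℂ) :
    evolution (s + t) H = evolution s H * evolution t H := by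
  unfold evolution
  rw [← Matrix.exp_add_of_commute]
  · rw [← add_smul]; congr 2; push_cast; ring
  · exact ((Commute.refl H).smul_left _).smul_right _

theorem evolution_neg_mul (t : ℝ) (H : Matrix ι ι ℂ) : evolution (-t) H * evolution t H = 1 := by
  rw [← evolution_add]; simp [evolution_zero]

theorem evolution_mul_neg (t : ℝ) (H : Matrix ι ι ℂ) : evolution t H * evolution (-t) H = 1 := by
  rw [← evolution_add]; simp [evolution_zero]

theorem evolution_conjTranspose (t : ℝ) {H : Matrix ι ι ℂ} (hH : H.IsHermitian) :
    (evolution t H).conjTranspose = evolution (-t) H := by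
  unfold evolution
  rw [← Matrix.exp_conjTranspose, Matrix.conjTranspose_smul, hH.eq]
  congr 2
  simp

theorem evolution_eq_exp_smul (t : ℝ) (H : Matrix ι ι ℂ) :
    evolution t H = NormedSpace.exp (t • (-Complex.I • H)) := by
  unfold evolution
  congr 1
  ext i j
  simp
  ring

theorem hasDerivAt_evolution_apply (H : Matrix ι ι ℂ) (c t : ℝ) (i j : ι) :
    HasDerivAt (fun s : ℝ => evolution (-(c * s)) H i j)
      ((evolution (-(c * t)) H * ((Complex.I * c) • H)) i j) t := by
  have h := hasDerivAt_exp_smul_apply ((Complex.I * c) • H) t i j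
  have e : ∀ s : ℝ, NormedSpace.exp (s • ((Complex.I * c) • H)) = evolution (-(c * s)) H := by
    intro s
    rw [evolution_eq_exp_smul]
    congr 1
    ext i j
    simp
    ring
  simpa only [e] using h

theorem norm_toLp_mulVec_of_conjTranspose_mul {U : Matrix ι ι ℂ}
    (hU : U.conjTranspose * U = 1) (v : ι → ℂ) :
    ‖WithLp.toLp 2 (U.mulVec v)‖ = ‖WithLp.toLp 2 v‖ := by
  have h : ∀ w : ι → ℂ, ((‖WithLp.toLp 2 w‖ ^ 2 : ℝ) : ℂ) = star w ⬝ᵥ w := by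
    intro w
    rw [EuclideanSpace.norm_sq_eq, dotProduct]
    push_cast
    refine Finset.sum_congr rfl fun i _ => ?_
    rw [Pi.star_apply, Complex.star_def, ← Complex.normSq_eq_conj_mul_self,
      Complex.normSq_eq_norm_sq]
    push_cast
    rfl
  have h1 : ‖WithLp.toLp 2 (U.mulVec v)‖ ^ 2 = ‖WithLp.toLp 2 v‖ ^ 2 := by
    have : ((‖WithLp.toLp 2 (U.mulVec v)‖ ^ 2 : ℝ) : ℂ) = ((‖WithLp.toLp 2 v‖ ^ 2 : ℝ) : ℂ) := by
      rw [h, h, Matrix.star_mulVec, Matrix.dotProduct_mulVec, Matrix.vecMul_vecMul, hU,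
        Matrix.vecMul_one]
    exact_mod_cast this
  exact (pow_left_inj₀ (norm_nonneg _) (norm_nonneg _) two_ne_zero).1 h1

theorem norm_toLp_evolution_mulVec (t : ℝ) {H : Matrix ι ι ℂ} (hH : H.IsHermitian) (v : ι → ℂ) :
    ‖WithLp.toLp 2 ((evolution t H).mulVec v)‖ = ‖WithLp.toLp 2 v‖ := by
  refine norm_toLp_mulVec_of_conjTranspose_mul ?_ v
  rw [evolution_conjTranspose t hH, evolution_neg_mul]

/-- Duhamel's principle: an approximate solution of the Schrödinger equation stays close to the
exact one. -/
theorem norm_evolution_mulVec_sub_le {H : Matrix ι ι ℂ} (hH : H.IsHermitian)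
    {Φ Φ' : ℝ → ι → ℂ} {a b c ε : ℝ} (hab : a ≤ b)
    (hder : ∀ x ∈ Set.Icc a b, ∀ i, HasDerivAt (fun y => Φ y i) (Φ' x i) x)
    (hres : ∀ x ∈ Set.Icc a b,
      ‖WithLp.toLp 2 (Φ' x + (Complex.I * c) • H.mulVec (Φ x))‖ ≤ ε) :
    ‖WithLp.toLp 2 ((evolution (-(c * b)) H).mulVec (Φ b) -
      (evolution (-(c * a)) H).mulVec (Φ a))‖ ≤ ε * (b - a) := by
  set G : ℝ → EuclideanSpace ℂ ι := fun x =>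
    WithLp.toLp 2 ((evolution (-(c * x)) H).mulVec (Φ x)) with hG
  set G' : ℝ → EuclideanSpace ℂ ι := fun x => WithLp.toLp 2
    ((evolution (-(c * x)) H).mulVec (Φ' x + (Complex.I * c) • H.mulVec (Φ x))) with hG'
  have hd : ∀ x ∈ Set.Icc a b, HasDerivWithinAt G (G' x) (Set.Icc a b) x := by
    intro x hx
    refine HasDerivAt.hasDerivWithinAt ?_
    have h1 : HasDerivAt (fun y => (evolution (-(c * y)) H).mulVec (Φ y))
        ((evolution (-(c * x)) H).mulVec (Φ' x + (Complex.I * c) • H.mulVec (Φ x))) x := by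
      rw [hasDerivAt_pi]
      intro i
      have h2 : HasDerivAt (fun y => ∑ j, evolution (-(c * y)) H i j * Φ y j)
          (∑ j, ((evolution (-(c * x)) H * ((Complex.I * c) • H)) i j * Φ x j +
            evolution (-(c * x)) H i j * Φ' x j)) x :=
        HasDerivAt.fun_sum fun j _ => (hasDerivAt_evolution_apply H c x i j).mul (hder x hx j)
      convert! h2 using 1
      rw [Matrix.mulVec_add, ← Matrix.smul_mulVec, Matrix.mulVec_mulVec, Finset.sum_add_distrib]
      simp only [Pi.add_apply, Matrix.mulVec, dotProduct]
      ring
    have h3 := (PiLp.continuousLinearEquiv 2 ℝ (fun _ : ι => ℂ)).symm.hasFDerivAt.comp_hasDerivAt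
      x h1
    exact h3
  have h := norm_image_sub_le_of_norm_deriv_le_segment' hd (C := ε) (fun x hx => ?_) b
    (Set.right_mem_Icc.2 hab)
  · exact h
  · rw [hG', norm_toLp_evolution_mulVec _ hH]
    exact hres x ⟨hx.1, hx.2.le⟩

/-! ### The time states -/

theorem star_timeState_dotProduct {d : ℕ} (hd : 0 < d) (j k : ℤ) :
    star (timeState d j) ⬝ᵥ timeState d k = if (d : ℤ) ∣ j - k then 1 else 0 := by
  have hd' : (d : ℝ) ≠ 0 := by positivity
  have hdc : (d : ℂ) ≠ 0 := by exact_mod_cast hd.ne'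
  set z : ℂ := Complex.exp (2 * Real.pi * Complex.I * (((j - k : ℤ) : ℂ) / d)) with hz
  have hterm : ∀ n : Fin d, star (timeState d j) n * timeState d k n = (d : ℂ)⁻¹ * z ^ (n : ℕ) := by
    intro n
    simp only [Pi.star_apply, timeState, star_mul', Complex.star_def, Complex.conj_ofReal,
      ← Complex.exp_conj, map_neg, map_mul, Complex.conj_I]
    rw [mul_mul_mul_comm, ← Complex.exp_add, ← Complex.ofReal_mul, hz, ← Complex.exp_nat_mul,
      div_mul_div_comm, one_mul, Real.mul_self_sqrt (by positivity)]
    congr 1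
    · push_cast; rw [one_div]
    · congr 1
      push_cast
      field_simp
      ring
  rw [dotProduct, Finset.sum_congr rfl fun n _ => hterm n, ← Finset.mul_sum,
    Fin.sum_univ_eq_sum_range (fun n => z ^ n) d]
  have hzd : z ^ d = 1 := by
    rw [hz, ← Complex.exp_nat_mul, Complex.exp_eq_one_iff]
    exact ⟨j - k, by field_simp⟩
  split_ifs with h
  · have : z = 1 := by
      obtain ⟨q, hq⟩ := h
      rw [hz, Complex.exp_eq_one_iff]
      refine ⟨q, ?_⟩
      rw [hq]
      push_cast
      field_simp
    simp [this, hdc]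
  · have hz1 : z ≠ 1 := by
      intro h1
      rw [hz, Complex.exp_eq_one_iff] at h1
      obtain ⟨q, hq⟩ := h1
      apply h
      refine ⟨q, ?_⟩
      have hpi : (2 * Real.pi * Complex.I : ℂ) ≠ 0 := Complex.two_pi_I_ne_zero
      have h2 : (((j - k : ℤ) : ℂ) / d) = q := by
        apply mul_left_cancel₀ hpi
        rw [hq]; ring
      rw [div_eq_iff hdc] at h2
      have h3 : ((j - k : ℤ) : ℂ) = ((q * d : ℤ) : ℂ) := by rw [h2]; push_cast; ring
      rw [Int.cast_injective h3]; ring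
    have := mul_neg_geom_sum z d
    rw [hzd, sub_self] at this
    rcases mul_eq_zero.1 this with h2 | h2
    · exact absurd (sub_eq_zero.1 h2).symm hz1
    · rw [h2, mul_zero]

theorem timeState_add_mul {d : ℕ} (hd : 0 < d) (k q : ℤ) :
    timeState d (k + q * d) = timeState d k := by
  have hdc : (d : ℂ) ≠ 0 := by exact_mod_cast hd.ne'
  funext n
  unfold timeState
  congr 1
  rw [Complex.exp_eq_exp_iff_exists_int]
  refine ⟨-(n * q), ?_⟩
  push_cast
  field_simp
  ring

theorem isHermitian_clockHamiltonian (T₀ : ℝ) (d : ℕ) : (clockHamiltonian T₀ d).IsHermitian := by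
  unfold clockHamiltonian
  refine Matrix.isHermitian_diagonal_of_self_adjoint _ ?_
  funext n
  simp

theorem isHermitian_ketbra {κ : Type*} (v : κ → ℂ) : (ketbra v).IsHermitian := by
  unfold ketbra
  ext i j
  simp [Matrix.vecMulVec, mul_comm]

theorem isHermitian_real_smul {κ : Type*} {M : Matrix κ κ ℂ} (h : M.IsHermitian) (r : ℝ) :
    ((r : ℂ) • M).IsHermitian := by
  unfold Matrix.IsHermitian
  rw [Matrix.conjTranspose_smul, h.eq]
  simp

theorem isHermitian_clockPotential (T₀ : ℝ) (V₀ : ℝ → ℝ) (d : ℕ) :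
    (clockPotential T₀ V₀ d).IsHermitian := by
  unfold clockPotential
  refine isHermitian_real_smul ?_ _
  unfold Matrix.IsHermitian
  rw [Matrix.conjTranspose_sum]
  exact Finset.sum_congr rfl fun k _ => isHermitian_real_smul (isHermitian_ketbra _) _

theorem stretchedPotential_add_mul {V₀ : ℝ → ℝ} (hV : Function.Periodic V₀ (2 * Real.pi)) {d : ℕ}
    (hd : 0 < d) (x : ℝ) (q : ℤ) :
    stretchedPotential V₀ d (x + q * d) = stretchedPotential V₀ d x := by
  unfold stretchedPotential
  congr 1
  have : 2 * Real.pi * (x + q * d) / d = 2 * Real.pi * x / d + q * (2 * Real.pi) := by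
    have : (d : ℝ) ≠ 0 := by positivity
    field_simp
  rw [this]
  exact hV.int_mul q _

theorem clockPotential_mulVec_timeState (T₀ : ℝ) {V₀ : ℝ → ℝ}
    (hV : Function.Periodic V₀ (2 * Real.pi)) {d : ℕ} (hd : 0 < d) (k : ℤ) :
    (clockPotential T₀ V₀ d).mulVec (timeState d k) =
      ((d / T₀ * stretchedPotential V₀ d k : ℝ) : ℂ) • timeState d k := by
  have hket : ∀ j : ℤ, (ketbra (timeState d j)).mulVec (timeState d k) =
      (if (d : ℤ) ∣ j - k then (1 : ℂ) else 0) • timeState d j := by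
    intro j
    rw [ketbra, Matrix.vecMulVec_mulVec, star_timeState_dotProduct hd]
    simp
  have hd0 : (d : ℤ) ≠ 0 := by exact_mod_cast hd.ne'
  set r := (k % d).toNat with hr
  have hr' : (r : ℤ) = k % d := Int.toNat_of_nonneg (Int.emod_nonneg k hd0)
  have hrd : r < d := by
    have := Int.emod_lt_of_pos k (by exact_mod_cast hd : (0 : ℤ) < d)
    omega
  have hk : k = r + (k / d) * d := by rw [hr']; exact (Int.emod_add_ediv_mul k d).symm
  unfold clockPotential
  rw [Matrix.smul_mulVec, Matrix.sum_mulVec]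
  simp only [Matrix.smul_mulVec, hket]
  rw [Finset.sum_eq_single r]
  · have hdvd : (d : ℤ) ∣ (r : ℤ) - k := ⟨-(k / d), by conv_lhs => rw [hk]
                                                       ring⟩
    rw [if_pos hdvd, one_smul, smul_smul]
    have e1 : timeState d k = timeState d r := by
      rw [hk]; exact timeState_add_mul hd _ _
    have e2 : stretchedPotential V₀ d k = stretchedPotential V₀ d r := by
      have : (k : ℝ) = (r : ℝ) + ((k / d : ℤ) : ℝ) * d := by exact_mod_cast hk
      rw [this]; exact stretchedPotential_add_mul hV hd _ _
    rw [e1, e2]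
    push_cast
    rfl
  · intro j hj hjr
    have hndvd : ¬ (d : ℤ) ∣ (j : ℤ) - k := by
      rintro ⟨q, hq⟩
      apply hjr
      have hjd := Finset.mem_range.1 hj
      have h1 : (j : ℤ) % d = k % d := by
        rw [show (j : ℤ) = k + d * q by linarith, Int.add_mul_emod_self_left]
      rw [Int.emod_eq_of_lt (by positivity) (by exact_mod_cast hjd)] at h1
      omega
    rw [if_neg hndvd]
    simp
  · intro h
    exact absurd (Finset.mem_range.2 hrd) h

end QuantumClock

namespace QuantumClock

/-! ### The phase acquired by the clock -/

/-- The phase acquired at `x` by a clock state that has moved by `κ` under `Ω` times the potential. -/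
noncomputable def clockPhase (V₀ : ℝ → ℝ) (d : ℕ) (Ω κ x : ℝ) : ℝ :=
  Ω * ∫ y in (2 * Real.pi * (x - κ) / d)..(2 * Real.pi * x / d), V₀ y

theorem iteratedDeriv_periodic {f : ℝ → ℝ} {T : ℝ} (hf : Function.Periodic f T) (k : ℕ) :
    Function.Periodic (iteratedDeriv k f) T := by
  intro x
  have h := congrFun (iteratedDeriv_comp_add_const k f T) x
  rw [← h]
  congr 1
  funext y
  exact hf y

theorem IsDerivBound.nonneg {V : ℝ → ℝ} {b : ℝ} (hb : IsDerivBound V b) : 0 ≤ b :=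
  le_trans (by positivity) (hb 1 le_rfl 0 ⟨le_rfl, by positivity⟩)

theorem IsDerivBound.abs_iteratedDeriv_le {V : ℝ → ℝ} {b : ℝ} (hb : IsDerivBound V b)
    (hV : Function.Periodic V (2 * Real.pi)) (k : ℕ) (x : ℝ) :
    |iteratedDeriv k V x| ≤ b ^ (k + 1) / 2 := by
  obtain ⟨y, hy, hxy⟩ := (iteratedDeriv_periodic hV k).exists_mem_Ico₀ Real.two_pi_pos x
  have h := hb (k + 1) (by omega) y ⟨hy.1, hy.2.le⟩
  rw [Nat.add_sub_cancel] at h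
  have h1 : 2 * |iteratedDeriv k V y| ≤ b ^ (k + 1) := by
    have h2 := pow_le_pow_left₀ (by positivity) h (k + 1)
    rwa [← Real.rpow_natCast, ← Real.rpow_mul (by positivity), one_div_mul_cancel
      (by positivity), Real.rpow_one] at h2
  rw [hxy]
  linarith

theorem exists_entire_clockPhase {V₀ : ℝ → ℝ} {b Ω : ℝ} {d : ℕ} (hd : 0 < d)
    (hV : ContDiff ℝ (⊤ : ℕ∞) V₀) (hper : Function.Periodic V₀ (2 * Real.pi))
    (hpos : ∀ x, 0 ≤ V₀ x) (hb : IsDerivBound (fun x => Real.pi * V₀ x) b)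
    (hΩ : |Ω| ≤ Real.pi) (κ : ℝ) :
    ∃ P : ℂ → ℂ, Differentiable ℂ P ∧ (∀ x : ℝ, P x = clockPhase V₀ d Ω κ x) ∧
      (∀ x y : ℝ, |(P (x + y * Complex.I)).im| ≤ Real.sinh (2 * Real.pi * b / d * |y|)) ∧
      (∀ x : ℝ, deriv P x = ((Ω * (2 * Real.pi / d) *
        (V₀ (2 * Real.pi * x / d) - V₀ (2 * Real.pi * (x - κ) / d)) : ℝ) : ℂ)) ∧
      ∀ x : ℝ, ‖deriv P x‖ ≤ Real.pi * b / d := by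
  have hπ := Real.pi_pos
  have hd' : (0 : ℝ) < d := by exact_mod_cast hd
  have hdc : (d : ℂ) ≠ 0 := by exact_mod_cast hd.ne'
  have hcont := hV.continuous
  set V : ℝ → ℝ := fun x => Real.pi * V₀ x with hVd
  have hVper : Function.Periodic V (2 * Real.pi) := fun x => by simp only [hVd]; rw [hper]
  have hVsm : ContDiff ℝ (⊤ : ℕ∞) V := contDiff_const.mul hV
  set W : ℝ → ℝ := fun x => ∫ y in (0 : ℝ)..x, V y with hW
  have hWd : ∀ x, HasDerivAt W (V x) x := fun x =>
    intervalIntegral.integral_hasDerivAt_right (hVsm.continuous.intervalIntegrable _ _)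
      (hVsm.continuous.stronglyMeasurableAtFilter _ _) hVsm.continuous.continuousAt
  have hWderiv : deriv W = V := funext fun x => (hWd x).deriv
  have hWsm : ContDiff ℝ (⊤ : ℕ∞) W := by
    rw [contDiff_infty_iff_deriv, hWderiv]
    exact ⟨fun x => (hWd x).differentiableAt, hVsm⟩
  have hWb : ∀ k : ℕ, 1 ≤ k → ∀ x, |iteratedDeriv k W x| ≤ b ^ k / 2 := by
    intro k hk x
    obtain ⟨j, rfl⟩ : ∃ j, k = j + 1 := ⟨k - 1, by omega⟩
    rw [iteratedDeriv_succ', hWderiv]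
    exact hb.abs_iteratedDeriv_le hVper j x
  obtain ⟨F, hF, hFW, hFim⟩ := exists_entire_extension hb.nonneg hWsm hWb
  set c : ℂ := 2 * Real.pi / d with hc
  have hcr : c = ((2 * Real.pi / d : ℝ) : ℂ) := by rw [hc]; push_cast; rfl
  set P : ℂ → ℂ := fun z => (Ω / Real.pi : ℝ) * (F (c * z) - F (c * (z - κ))) with hP
  have hPr : ∀ x : ℝ, P x = clockPhase V₀ d Ω κ x := by
    intro x
    have e1 : c * x = ((2 * Real.pi * x / d : ℝ) : ℂ) := by rw [hc]; push_cast; ring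
    have e2 : c * (x - κ) = ((2 * Real.pi * (x - κ) / d : ℝ) : ℂ) := by rw [hc]; push_cast; ring
    rw [hP]
    simp only
    rw [e1, e2, hFW, hFW, clockPhase, ← Complex.ofReal_sub, ← Complex.ofReal_mul]
    congr 1
    rw [hW]
    simp only
    rw [intervalIntegral.integral_interval_sub_left (hVsm.continuous.intervalIntegrable _ _)
      (hVsm.continuous.intervalIntegrable _ _), hVd, intervalIntegral.integral_const_mul]
    field_simp
  have hPdiff : Differentiable ℂ P := by
    rw [hP]; fun_prop
  have hPd : ∀ x : ℝ, deriv P x = ((Ω * (2 * Real.pi / d) *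
        (V₀ (2 * Real.pi * x / d) - V₀ (2 * Real.pi * (x - κ) / d)) : ℝ) : ℂ) := by
    intro x
    have h1 : HasDerivAt (fun z : ℝ => P z) (deriv P x) x := (hPdiff x).hasDerivAt.comp_ofReal
    have h2 : (fun z : ℝ => P z) = fun z : ℝ => ((Ω / Real.pi *
        (W (2 * Real.pi / d * z) - W (2 * Real.pi / d * (z - κ))) : ℝ) : ℂ) := by
      funext z
      simp only [hP]
      rw [hcr, ← Complex.ofReal_sub z κ, ← Complex.ofReal_mul, ← Complex.ofReal_mul, hFW, hFW]
      push_cast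
      rfl
    rw [h2] at h1
    have h3 : HasDerivAt (fun z : ℝ => Ω / Real.pi *
        (W (2 * Real.pi / d * z) - W (2 * Real.pi / d * (z - κ))))
        (Ω / Real.pi * (V (2 * Real.pi / d * x) * (2 * Real.pi / d * 1) -
          V (2 * Real.pi / d * (x - κ)) * (2 * Real.pi / d * 1))) x := by
      refine HasDerivAt.const_mul _ (HasDerivAt.sub ?_ ?_)
      · exact (hWd _).comp x ((hasDerivAt_id x).const_mul _)
      · exact (hWd _).comp x (((hasDerivAt_id x).sub_const κ).const_mul _)
    rw [h1.unique h3.ofReal_comp]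
    congr 1
    simp only [hVd]
    rw [mul_div_right_comm (2 * Real.pi) x, mul_div_right_comm (2 * Real.pi) (x - κ)]
    field_simp
  refine ⟨P, hPdiff, hPr, fun x y => ?_, hPd, fun x => ?_⟩
  · have e1 : c * (x + y * Complex.I) =
        ((2 * Real.pi / d * x : ℝ) : ℂ) + ((2 * Real.pi / d * y : ℝ) : ℂ) * Complex.I := by
      rw [hc]; push_cast; ring
    have e2 : c * (x + y * Complex.I - κ) =
        ((2 * Real.pi / d * (x - κ) : ℝ) : ℂ) + ((2 * Real.pi / d * y : ℝ) : ℂ) * Complex.I := by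
      rw [hc]; push_cast; ring
    rw [hP]
    simp only
    rw [e1, e2, Complex.im_ofReal_mul, Complex.sub_im, abs_mul]
    have h1 := hFim (2 * Real.pi / d * x) (2 * Real.pi / d * y)
    have h2 := hFim (2 * Real.pi / d * (x - κ)) (2 * Real.pi / d * y)
    have e3 : b * |2 * Real.pi / d * y| = 2 * Real.pi * b / d * |y| := by
      rw [abs_mul, abs_of_pos (by positivity : 0 < 2 * Real.pi / (d : ℝ))]; ring
    rw [e3] at h1 h2
    have h3 : |Ω / Real.pi| ≤ 1 := by
      rw [abs_div, abs_of_pos hπ, div_le_one hπ]; exact hΩ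
    calc |Ω / Real.pi| * |_ - _| ≤ 1 * (|_| + |_|) :=
          mul_le_mul h3 (abs_sub _ _) (abs_nonneg _) zero_le_one
      _ ≤ _ := by linarith
  · rw [hPd, Complex.norm_real, Real.norm_eq_abs, abs_mul, abs_mul,
      abs_of_pos (by positivity : 0 < 2 * Real.pi / (d : ℝ))]
    have hVle : ∀ z, Real.pi * V₀ z ≤ b / 2 := by
      intro z
      have := hb.abs_iteratedDeriv_le hVper 0 z
      rw [iteratedDeriv_zero, zero_add, pow_one] at this
      exact (le_abs_self _).trans this
    have h1 : Real.pi * |V₀ (2 * Real.pi * x / d) - V₀ (2 * Real.pi * (x - κ) / d)| ≤ b / 2 := by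
      rw [← abs_of_pos hπ, ← abs_mul, abs_of_pos hπ, mul_sub]
      have := hVle (2 * Real.pi * x / d)
      have := hVle (2 * Real.pi * (x - κ) / d)
      have := mul_nonneg hπ.le (hpos (2 * Real.pi * x / d))
      have := mul_nonneg hπ.le (hpos (2 * Real.pi * (x - κ) / d))
      rw [abs_le]
      constructor <;> linarith
    calc |Ω| * (2 * Real.pi / d) * |_| ≤ Real.pi * (2 * Real.pi / d) * |_| := by gcongr
      _ = 2 * Real.pi / d * (Real.pi * |_|) := by ring
      _ ≤ 2 * Real.pi / d * (b / 2) := by gcongr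
      _ = _ := by ring

end QuantumClock

namespace QuantumClock

/-! ### The moving clock state -/

/-- The amplitude at `x` of the clock state moved by `κ`, with the normalisation at `κ = 0`. -/
noncomputable def movingAmplitude (V₀ : ℝ → ℝ) (d : ℕ) (σ n₀ Ω κ x : ℝ) : ℂ :=
  ((normConst d σ 0 * Real.exp (-(Real.pi / σ ^ 2) * (x - κ) ^ 2) : ℝ) : ℂ) *
    Complex.exp (Complex.I * ((2 * Real.pi * n₀ * (x - κ) / d - clockPhase V₀ d Ω κ x : ℝ) : ℂ))

/-- The moved clock state, summed over the `d` integers in `(m - d, m]`. -/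
noncomputable def movingState (V₀ : ℝ → ℝ) (d : ℕ) (σ n₀ Ω : ℝ) (m : ℤ) (κ : ℝ) : Fin d → ℂ :=
  ∑ k ∈ Finset.Ioc (m - d) m, movingAmplitude V₀ d σ n₀ Ω κ k • timeState d k

/-- The Hamiltonian of the clock for the eigenvalue `Ω` of the interaction. -/
noncomputable def sectorHamiltonian (T₀ : ℝ) (V₀ : ℝ → ℝ) (d : ℕ) (Ω : ℝ) :
    Matrix (Fin d) (Fin d) ℂ :=
  clockHamiltonian T₀ d + (Ω : ℂ) • clockPotential T₀ V₀ d

theorem isHermitian_sectorHamiltonian (T₀ : ℝ) (V₀ : ℝ → ℝ) (d : ℕ) (Ω : ℝ) :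
    (sectorHamiltonian T₀ V₀ d Ω).IsHermitian :=
  (isHermitian_clockHamiltonian T₀ d).add
    (isHermitian_real_smul (isHermitian_clockPotential T₀ V₀ d) Ω)

theorem centredIntegers_eq_Ioc (d : ℕ) (κ : ℝ) :
    centredIntegers d κ = Finset.Ioc (⌊κ + (d : ℝ) / 2⌋ - d) ⌊κ + (d : ℝ) / 2⌋ := by
  unfold centredIntegers
  congr 1
  rw [← Int.floor_sub_natCast]
  congr 1
  ring

theorem norm_movingAmplitude (V₀ : ℝ → ℝ) {d : ℕ} (hd : 0 < d) (σ n₀ Ω κ x : ℝ) :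
    ‖movingAmplitude V₀ d σ n₀ Ω κ x‖ =
      normConst d σ 0 * Real.exp (-(Real.pi / σ ^ 2) * (x - κ) ^ 2) := by
  rw [movingAmplitude, norm_mul, mul_comm Complex.I, Complex.norm_exp_ofReal_mul_I, mul_one,
    Complex.norm_real, Real.norm_eq_abs, abs_of_nonneg]
  have := normConst_pos hd σ
  positivity

theorem movingState_zero (V₀ : ℝ → ℝ) (d : ℕ) (σ n₀ Ω : ℝ) :
    movingState V₀ d σ n₀ Ω ⌊(d : ℝ) / 2⌋ 0 = clockState d σ n₀ 0 := by
  unfold movingState clockState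
  rw [centredIntegers_eq_Ioc, zero_add]
  refine Finset.sum_congr rfl fun k _ => ?_
  simp [movingAmplitude, psiNor, clockPhase]

theorem norm_toLp_timeState {d : ℕ} (hd : 0 < d) (k : ℤ) :
    ‖WithLp.toLp 2 (timeState d k)‖ = 1 := by
  have h : ‖WithLp.toLp 2 (timeState d k)‖ ^ 2 = 1 := by
    rw [EuclideanSpace.norm_sq_eq]
    have : ∀ n : Fin d, ‖(WithLp.toLp 2 (timeState d k)).ofLp n‖ ^ 2 = 1 / d := by
      intro n
      simp only [timeState]
      rw [norm_mul, ← mul_neg, ← Complex.ofReal_neg, mul_comm Complex.I,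
        Complex.norm_exp_ofReal_mul_I, mul_one, Complex.norm_real, Real.norm_eq_abs, sq_abs,
        div_pow, Real.sq_sqrt (by positivity), one_pow]
    rw [Finset.sum_congr rfl fun n _ => this n]
    have hd' : (d : ℝ) ≠ 0 := by positivity
    simp [hd']
  exact (pow_eq_one_iff_of_nonneg (norm_nonneg _) two_ne_zero).1 h

theorem hasDerivAt_movingAmplitude {V₀ : ℝ → ℝ} (hV : Continuous V₀) (d : ℕ) (σ n₀ Ω κ x : ℝ) :
    HasDerivAt (fun y => movingAmplitude V₀ d σ n₀ Ω y x)
      (movingAmplitude V₀ d σ n₀ Ω κ x * (((2 * Real.pi / σ ^ 2 * (x - κ) : ℝ) : ℂ) -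
        Complex.I * ((2 * Real.pi * n₀ / d +
          Ω * (2 * Real.pi / d) * V₀ (2 * Real.pi * (x - κ) / d) : ℝ) : ℂ))) κ := by
  have hlin : HasDerivAt (fun y : ℝ => 2 * Real.pi * (x - y) / d) (-(2 * Real.pi / d)) κ := by
    have := (((hasDerivAt_id κ).const_sub x).const_mul (2 * Real.pi)).div_const (d : ℝ)
    convert! this using 1
    ring
  have hphase : HasDerivAt (fun y => clockPhase V₀ d Ω y x)
      (Ω * (2 * Real.pi / d) * V₀ (2 * Real.pi * (x - κ) / d)) κ := by
    have h1 : HasDerivAt (fun u => ∫ y in u..(2 * Real.pi * x / d), V₀ y)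
        (-V₀ (2 * Real.pi * (x - κ) / d)) (2 * Real.pi * (x - κ) / d) :=
      intervalIntegral.integral_hasDerivAt_left (hV.intervalIntegrable _ _)
        (hV.stronglyMeasurableAtFilter _ _) hV.continuousAt
    have h2 := (h1.comp κ hlin).const_mul Ω
    convert! h2 using 1
    ring
  have hexp : HasDerivAt (fun y : ℝ => normConst d σ 0 *
      Real.exp (-(Real.pi / σ ^ 2) * (x - y) ^ 2))
      (normConst d σ 0 * Real.exp (-(Real.pi / σ ^ 2) * (x - κ) ^ 2) *
        (2 * Real.pi / σ ^ 2 * (x - κ))) κ := by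
    have h := ((((hasDerivAt_id κ).const_sub x).pow 2).const_mul (-(Real.pi / σ ^ 2))).exp.const_mul
      (normConst d σ 0)
    convert! h using 1
    simp only [id, Pi.pow_apply]
    push_cast
    ring
  have harg : HasDerivAt (fun y : ℝ => 2 * Real.pi * n₀ * (x - y) / d - clockPhase V₀ d Ω y x)
      (-(2 * Real.pi * n₀ / d +
          Ω * (2 * Real.pi / d) * V₀ (2 * Real.pi * (x - κ) / d))) κ := by
    have h := (hlin.const_mul n₀).sub hphase
    convert! h using 1
    · funext y; simp only [Pi.sub_apply]; ring
    · ring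
  have h := hexp.ofReal_comp.mul ((harg.ofReal_comp.const_mul Complex.I).cexp)
  unfold movingAmplitude
  convert! h using 1
  push_cast
  ring

theorem movingAmplitude_mul_timeState {V₀ : ℝ → ℝ} {d : ℕ} (σ n₀ Ω κ : ℝ) {P : ℂ → ℂ}
    (hP : ∀ x : ℝ, P x = clockPhase V₀ d Ω κ x) (k : ℤ) (n : Fin d) :
    movingAmplitude V₀ d σ n₀ Ω κ k * timeState d k n =
      (((1 / Real.sqrt d : ℝ) : ℂ) * ((normConst d σ 0 : ℝ) : ℂ) *
        Complex.exp ((-(2 * Real.pi * n₀ * κ / d) : ℝ) * Complex.I)) *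
        gaussPacket σ κ (((n : ℕ) - n₀) / d) P (k : ℝ) := by
  unfold movingAmplitude timeState gaussPacket
  rw [hP]
  have hcalc : ∀ (s A : ℂ) (g : ℝ) (u v w z : ℂ), (g : ℂ) + u + v = w + z →
      (A * Complex.exp g * Complex.exp u) * (s * Complex.exp v) =
        s * A * Complex.exp w * Complex.exp z := by
    intro s A g u v w z h
    rw [show (A * Complex.exp g * Complex.exp u) * (s * Complex.exp v) =
      s * A * (Complex.exp g * Complex.exp u * Complex.exp v) by ring, ← Complex.exp_add,
      ← Complex.exp_add, h, Complex.exp_add]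
    ring
  rw [Complex.ofReal_mul, Complex.ofReal_exp]
  apply hcalc
  push_cast
  ring

/-- The residual of the Schrödinger equation for the moving clock state. -/
theorem norm_residual_le {T₀ : ℝ} {V₀ : ℝ → ℝ} {d : ℕ} {σ n₀ Ω b κ : ℝ} {m : ℤ}
    (hT₀ : 0 < T₀) (hd : 2 ≤ d) (hσ : 0 < σ) (hσd : σ < d) (hn₀ : 0 < n₀) (hn₀' : n₀ < (d : ℝ) - 1)
    (hV : ContDiff ℝ (⊤ : ℕ∞) V₀) (hper : Function.Periodic V₀ (2 * Real.pi))
    (hpos : ∀ x, 0 ≤ V₀ x) (hb : IsDerivBound (fun x => Real.pi * V₀ x) b)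
    (hΩ : |Ω| ≤ Real.pi) (hκ₁ : m - (d : ℝ) / 2 ≤ κ) (hκ₂ : κ ≤ m + 1 - (d : ℝ) / 2) :
    ∃ Φ' : Fin d → ℂ,
      (∀ i, HasDerivAt (fun y => movingState V₀ d σ n₀ Ω m y i) (Φ' i) κ) ∧
      ‖WithLp.toLp 2 (Φ' + (Complex.I * ((T₀ / d : ℝ) : ℂ)) •
        (sectorHamiltonian T₀ V₀ d Ω).mulVec (movingState V₀ d σ n₀ Ω m κ))‖ ≤
        epsT d σ (alphaZero d n₀) b := by
  have hd0 : 0 < d := by omega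
  have hd' : (0 : ℝ) < d := by exact_mod_cast hd0
  have hd2 : (2 : ℝ) ≤ d := by exact_mod_cast hd
  have hdc : (d : ℂ) ≠ 0 := by exact_mod_cast hd0.ne'
  have hTc : (T₀ : ℂ) ≠ 0 := by exact_mod_cast hT₀.ne'
  have hπ := Real.pi_pos
  obtain ⟨P, hPd, hPr, hPim, hPder, hPM⟩ :=
    exists_entire_clockPhase hd0 hV hper hpos hb hΩ κ
  set α := alphaZero d n₀ with hα
  have hd1 : (0 : ℝ) < (d : ℝ) - 1 := by linarith
  have hmin0 : 0 < min n₀ ((d : ℝ) - 1 - n₀) := lt_min hn₀ (by linarith)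
  have hα0 : 0 < α := by rw [hα, alphaZero]; positivity
  have hαle : α * ((d : ℝ) - 1) / 2 = min n₀ ((d : ℝ) - 1 - n₀) := by
    rw [hα, alphaZero]; field_simp
  have hm1 := min_le_left n₀ ((d : ℝ) - 1 - n₀)
  have hm2 := min_le_right n₀ ((d : ℝ) - 1 - n₀)
  have hα1 : α ≤ 1 := by
    have : α * ((d : ℝ) - 1) ≤ 1 * ((d : ℝ) - 1) := by linarith
    exact le_of_mul_le_mul_right this hd1
  obtain ⟨v, hv, hrate⟩ := exists_rate_le_epsT hd0 hσ hσd hα0 hα1 hb.nonneg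
  set A := normConst d σ 0 with hA
  have hA0 : 0 < A := normConst_pos hd0 σ
  set D : ℤ → ℂ := fun k => ((2 * Real.pi / σ ^ 2 * (k - κ) : ℝ) : ℂ) -
        Complex.I * ((2 * Real.pi * n₀ / d +
          Ω * (2 * Real.pi / d) * V₀ (2 * Real.pi * (k - κ) / d) : ℝ) : ℂ) with hD
  refine ⟨fun i => ∑ k ∈ Finset.Ioc (m - (d : ℤ)) m,
    movingAmplitude V₀ d σ n₀ Ω κ k * D k * timeState d k i, fun i => ?_, ?_⟩
  · have h : HasDerivAt (fun y => ∑ k ∈ Finset.Ioc (m - (d : ℤ)) m,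
        movingAmplitude V₀ d σ n₀ Ω y k * timeState d k i)
        (∑ k ∈ Finset.Ioc (m - (d : ℤ)) m,
          movingAmplitude V₀ d σ n₀ Ω κ k * D k * timeState d k i) κ :=
      HasDerivAt.fun_sum fun k _ =>
        (hasDerivAt_movingAmplitude hV.continuous d σ n₀ Ω κ k).mul_const _
    simpa [movingState, Finset.sum_apply] using h
  · set R : Fin d → ℂ := (fun i => ∑ k ∈ Finset.Ioc (m - (d : ℤ)) m,
      movingAmplitude V₀ d σ n₀ Ω κ k * D k * timeState d k i) +
      (Complex.I * ((T₀ / d : ℝ) : ℂ)) •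
        (sectorHamiltonian T₀ V₀ d Ω).mulVec (movingState V₀ d σ n₀ Ω m κ) with hR
    set C : ℂ := (((1 / Real.sqrt d : ℝ) : ℂ) * ((A : ℝ) : ℂ) *
        Complex.exp ((-(2 * Real.pi * n₀ * κ / d) : ℝ) * Complex.I)) with hC
    have hCn : ‖C‖ = 1 / Real.sqrt d * A := by
      rw [hC, norm_mul, norm_mul, Complex.norm_exp_ofReal_mul_I, mul_one, Complex.norm_real,
        Complex.norm_real, Real.norm_eq_abs, Real.norm_eq_abs, abs_of_nonneg (by positivity),
        abs_of_pos hA0]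
    have hsec : ∀ (k : ℤ) (i : Fin d), ((sectorHamiltonian T₀ V₀ d Ω).mulVec (timeState d k)) i =
        ((((i : ℕ) : ℝ) * (2 * Real.pi / T₀) +
          Ω * (d / T₀ * stretchedPotential V₀ d k) : ℝ) : ℂ) * timeState d k i := by
      intro k i
      rw [sectorHamiltonian, Matrix.add_mulVec, Matrix.smul_mulVec,
        clockPotential_mulVec_timeState T₀ hper hd0, clockHamiltonian, Pi.add_apply,
        Matrix.mulVec_diagonal]
      simp only [Pi.smul_apply, smul_eq_mul]
      push_cast
      ring
    have hRi : ∀ i : Fin d, R i = -(C * ∑ k ∈ Finset.Ioc (m - (d : ℤ)) m,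
        gaussPacket σ κ (((i : ℕ) - n₀) / d) P (k : ℝ) *
          packetLogDeriv σ κ (((i : ℕ) - n₀) / d) P k) := by
      intro i
      have e1 : ((sectorHamiltonian T₀ V₀ d Ω).mulVec (movingState V₀ d σ n₀ Ω m κ)) i =
          ∑ k ∈ Finset.Ioc (m - (d : ℤ)) m, movingAmplitude V₀ d σ n₀ Ω κ k *
            (((((i : ℕ) : ℝ) * (2 * Real.pi / T₀) +
              Ω * (d / T₀ * stretchedPotential V₀ d k) : ℝ) : ℂ) * timeState d k i) := by
        rw [movingState, Matrix.mulVec_sum, Finset.sum_apply]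
        refine Finset.sum_congr rfl fun k _ => ?_
        rw [Matrix.mulVec_smul, Pi.smul_apply, hsec, smul_eq_mul]
      rw [hR, Pi.add_apply, Pi.smul_apply, e1, smul_eq_mul, Finset.mul_sum, ← Finset.sum_add_distrib,
        Finset.mul_sum, ← Finset.sum_neg_distrib]
      refine Finset.sum_congr rfl fun k _ => ?_
      have e2 := movingAmplitude_mul_timeState σ n₀ Ω κ hPr k i
      rw [← hC] at e2
      rw [← mul_assoc C, ← e2, packetLogDeriv, hPder, hD]
      simp only [stretchedPotential]
      push_cast
      field_simp
      ring
    have hRn : ∀ i : Fin d, ‖R i‖ ≤ 1 / Real.sqrt d * epsT d σ α b := by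
      intro i
      rw [hRi, norm_neg, norm_mul, hCn, mul_assoc]
      refine mul_le_mul_of_nonneg_left ?_ (by positivity)
      refine le_trans ?_ hrate
      refine mul_le_mul_of_nonneg_left ?_ hA0.le
      have hi : ((i : ℕ) : ℝ) ≤ (d : ℝ) - 1 := by
        have : ((i : ℕ) : ℝ) + 1 ≤ d := by exact_mod_cast i.2
        linarith
      have hi0 : (0 : ℝ) ≤ (i : ℕ) := Nat.cast_nonneg _
      have hμ : |(((i : ℕ) : ℝ) - n₀) / d| ≤ 1 := by
        rw [abs_div, abs_of_pos hd', div_le_one hd', abs_le]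
        constructor <;> linarith
      have hma : ∀ s : ℤ, s ≠ 0 → |(s : ℝ)| - 1 + α / 2 ≤ |(((i : ℕ) : ℝ) - n₀) / d + s| := by
        intro s hs
        have e : (((i : ℕ) : ℝ) - n₀) / d + s = (((i : ℕ) : ℝ) - n₀ + s * d) / d := by field_simp
        rw [e, abs_div, abs_of_pos hd', le_div_iff₀ hd']
        rcases lt_or_gt_of_ne hs with h | h
        · have hs1 : (s : ℝ) ≤ -1 := by exact_mod_cast (by omega : s ≤ -1)
          rw [abs_of_nonpos (by linarith : (s : ℝ) ≤ 0)]
          refine le_trans ?_ (neg_le_abs _)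
          nlinarith
        · have hs1 : (1 : ℝ) ≤ s := by exact_mod_cast (by omega : 1 ≤ s)
          rw [abs_of_nonneg (by linarith : (0 : ℝ) ≤ s)]
          refine le_trans ?_ (le_abs_self _)
          nlinarith
      have hβ : 0 ≤ 2 * Real.pi * b / d := by have := hb.nonneg; positivity
      refine (norm_sum_deriv_gaussPacket_le hσ hd hv hβ hPd hPim hPM hma hκ₁ hκ₂).trans ?_
      have hr1 : 0 < 1 - Real.exp (-(Real.pi / σ ^ 2 * d)) := by
        have : Real.exp (-(Real.pi / σ ^ 2 * d)) < 1 := by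
          rw [Real.exp_lt_one_iff]
          have : 0 < Real.pi / σ ^ 2 * d := by positivity
          linarith
        linarith
      have hμ' : 2 * Real.pi * |(((i : ℕ) : ℝ) - n₀) / d| ≤ 2 * Real.pi :=
        mul_le_of_le_one_right (by positivity) hμ
      have hnum : (Real.pi * b / d + 2 * Real.pi * |(((i : ℕ) : ℝ) - n₀) / d|) /
          (1 - Real.exp (-(Real.pi / σ ^ 2 * d))) ≤
          (Real.pi * b / d + 2 * Real.pi) / (1 - Real.exp (-(Real.pi / σ ^ 2 * d))) :=
        div_le_div_of_nonneg_right (by linarith) hr1.le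
      gcongr
    rw [EuclideanSpace.norm_eq]
    have hε : 0 ≤ 1 / Real.sqrt d * epsT d σ α b := (norm_nonneg _).trans (hRn ⟨0, hd0⟩)
    have hε' : 0 ≤ epsT d σ α b := by
      have : 0 < 1 / Real.sqrt d := by positivity
      exact nonneg_of_mul_nonneg_right hε this
    rw [Real.sqrt_le_left hε']
    calc ∑ i, ‖R i‖ ^ 2 ≤ ∑ _i : Fin d, (1 / Real.sqrt d * epsT d σ α b) ^ 2 :=
          Finset.sum_le_sum fun i _ => pow_le_pow_left₀ (norm_nonneg _) (hRn i) 2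
      _ = epsT d σ α b ^ 2 := by
          rw [Finset.sum_const, Finset.card_univ, Fintype.card_fin, nsmul_eq_mul, mul_pow, div_pow,
            Real.sq_sqrt hd'.le]
          field_simp

end QuantumClock

namespace QuantumClock

theorem norm_movingState_succ_sub_le (V₀ : ℝ → ℝ) {d : ℕ} (hd : 0 < d) (σ n₀ Ω : ℝ) (m : ℤ) :
    ‖WithLp.toLp 2 (movingState V₀ d σ n₀ Ω (m + 1) (m + 1 - (d : ℝ) / 2) -
      movingState V₀ d σ n₀ Ω m (m + 1 - (d : ℝ) / 2))‖ ≤ epsStep d σ := by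
  set κ : ℝ := m + 1 - (d : ℝ) / 2 with hκ
  set c : ℤ → Fin d → ℂ := fun k => movingAmplitude V₀ d σ n₀ Ω κ k • timeState d k with hc
  have hd1 : (1 : ℤ) ≤ d := by exact_mod_cast hd
  have h1 : Finset.Ioc (m + 1 - (d : ℤ)) (m + 1) =
      insert (m + 1) (Finset.Ioc (m + 1 - (d : ℤ)) m) := by
    ext k; simp only [Finset.mem_insert, Finset.mem_Ioc]; omega
  have h2 : Finset.Ioc (m - (d : ℤ)) m =
      insert (m + 1 - (d : ℤ)) (Finset.Ioc (m + 1 - (d : ℤ)) m) := by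
    ext k; simp only [Finset.mem_insert, Finset.mem_Ioc]; omega
  have hdiff : movingState V₀ d σ n₀ Ω (m + 1) κ - movingState V₀ d σ n₀ Ω m κ =
      c (m + 1) - c (m + 1 - d) := by
    unfold movingState
    rw [h1, h2, Finset.sum_insert (by simp), Finset.sum_insert (by simp)]
    abel
  have hnorm : ∀ k : ℤ, ((k : ℝ) - κ) ^ 2 = (d : ℝ) ^ 2 / 4 → ‖WithLp.toLp 2 (c k)‖ ≤
      normConst d σ 0 * Real.exp (-(Real.pi * d ^ 2 / (4 * σ ^ 2))) := by
    intro k hk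
    rw [hc]
    simp only
    rw [WithLp.toLp_smul, norm_smul, norm_toLp_timeState hd, norm_movingAmplitude V₀ hd, mul_one, hk]
    refine le_of_eq ?_
    congr 2
    ring
  rw [hdiff, WithLp.toLp_sub]
  refine (norm_sub_le _ _).trans ?_
  have e1 := hnorm (m + 1) (by rw [hκ]; push_cast; ring)
  have e2 := hnorm (m + 1 - d) (by rw [hκ]; push_cast; ring)
  rw [epsStep]
  linarith

/-- The evolved clock state is close to the moving Gaussian state. -/
theorem norm_evolution_clockState_sub_le {T₀ : ℝ} {V₀ : ℝ → ℝ} {d : ℕ} {σ n₀ Ω b κ : ℝ}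
    (hT₀ : 0 < T₀) (hd : 2 ≤ d) (hσ : 0 < σ) (hσd : σ < d) (hn₀ : 0 < n₀) (hn₀' : n₀ < (d : ℝ) - 1)
    (hV : ContDiff ℝ (⊤ : ℕ∞) V₀) (hper : Function.Periodic V₀ (2 * Real.pi))
    (hpos : ∀ x, 0 ≤ V₀ x) (hb : IsDerivBound (fun x => Real.pi * V₀ x) b)
    (hΩ : |Ω| ≤ Real.pi) (hκ : 0 ≤ κ) :
    ‖WithLp.toLp 2 ((evolution (T₀ / d * κ) (sectorHamiltonian T₀ V₀ d Ω)).mulVec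
      (clockState d σ n₀ 0) - movingState V₀ d σ n₀ Ω ⌊κ + (d : ℝ) / 2⌋ κ)‖ ≤
      κ * epsT d σ (alphaZero d n₀) b + (κ + 1) * epsStep d σ := by
  set H := sectorHamiltonian T₀ V₀ d Ω with hH
  have hHh : H.IsHermitian := isHermitian_sectorHamiltonian T₀ V₀ d Ω
  set ε := epsT d σ (alphaZero d n₀) b with hε
  set Φ : ℤ → ℝ → Fin d → ℂ := movingState V₀ d σ n₀ Ω with hΦ
  set U : ℝ → Matrix (Fin d) (Fin d) ℂ := fun x => evolution (-(T₀ / d * x)) H with hU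
  have hd0 : 0 < d := by omega
  have hstep0 : 0 ≤ epsStep d σ := by
    unfold epsStep; have := normConst_pos hd0 σ; positivity
  have hseg : ∀ (m : ℤ) (x y : ℝ), m - (d : ℝ) / 2 ≤ x → x ≤ y → y ≤ m + 1 - (d : ℝ) / 2 →
      ‖WithLp.toLp 2 ((U y).mulVec (Φ m y) - (U x).mulVec (Φ m x))‖ ≤ ε * (y - x) := by
    intro m x y h1 h2 h3
    have hres : ∀ z : ℝ, ∃ Φ' : Fin d → ℂ, z ∈ Set.Icc x y →
        (∀ i, HasDerivAt (fun w => Φ m w i) (Φ' i) z) ∧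
        ‖WithLp.toLp 2 (Φ' + (Complex.I * ((T₀ / d : ℝ) : ℂ)) • H.mulVec (Φ m z))‖ ≤ ε := by
      intro z
      by_cases hz : z ∈ Set.Icc x y
      · obtain ⟨Φ', h⟩ := norm_residual_le hT₀ hd hσ hσd hn₀ hn₀' hV hper hpos hb hΩ
          (h1.trans hz.1) (hz.2.trans h3)
        exact ⟨Φ', fun _ => h⟩
      · exact ⟨0, fun h => absurd h hz⟩
    choose Φ' hΦ' using hres
    exact norm_evolution_mulVec_sub_le hHh h2 (fun z hz => (hΦ' z hz).1) (fun z hz => (hΦ' z hz).2)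
  set m₀ : ℤ := ⌊(d : ℝ) / 2⌋ with hm₀
  have hm₀1 : (m₀ : ℝ) ≤ (d : ℝ) / 2 := Int.floor_le _
  have hm₀2 : (d : ℝ) / 2 < m₀ + 1 := Int.lt_floor_add_one _
  have hind : ∀ (j : ℕ) (x : ℝ), 0 ≤ x → (m₀ + j : ℤ) - (d : ℝ) / 2 ≤ x →
      x ≤ (m₀ + j : ℤ) + 1 - (d : ℝ) / 2 →
      ‖WithLp.toLp 2 ((U x).mulVec (Φ (m₀ + j) x) - clockState d σ n₀ 0)‖ ≤
        ε * x + j * epsStep d σ := by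
    intro j
    induction j with
    | zero =>
      intro x hx h1 h2
      have h := hseg m₀ 0 x (by linarith) hx (by simpa using h2)
      have e0 : (U 0).mulVec (Φ m₀ 0) = clockState d σ n₀ 0 := by
        rw [hU, hΦ, movingState_zero]
        simp [evolution_zero]
      rw [e0] at h
      simpa using h
    | succ j ih =>
      intro x hx h1 h2
      set y : ℝ := (m₀ + j : ℤ) + 1 - (d : ℝ) / 2 with hy
      have hy0 : 0 ≤ y := by
        rw [hy]; push_cast
        have : (0 : ℝ) ≤ j := j.cast_nonneg
        linarith
      have hyx : y ≤ x := by
        refine le_trans (le_of_eq ?_) h1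
        rw [hy]; push_cast; ring
      have i1 := ih y hy0 (by rw [hy]; linarith) le_rfl
      have i2 : ‖WithLp.toLp 2 ((U y).mulVec (Φ (m₀ + j + 1) y) - (U y).mulVec (Φ (m₀ + j) y))‖ ≤
          epsStep d σ := by
        rw [← Matrix.mulVec_sub, hU]
        simp only
        rw [norm_toLp_evolution_mulVec _ hHh]
        exact norm_movingState_succ_sub_le V₀ hd0 σ n₀ Ω (m₀ + j)
      have i3 := hseg (m₀ + j + 1) y x (by rw [hy]; push_cast; linarith) hyx (by
        refine h2.trans (le_of_eq ?_); push_cast; ring)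
      have e : (m₀ + (j + 1 : ℕ) : ℤ) = m₀ + j + 1 := by push_cast; ring
      rw [e]
      have hsplit : (U x).mulVec (Φ (m₀ + j + 1) x) - clockState d σ n₀ 0 =
          ((U x).mulVec (Φ (m₀ + j + 1) x) - (U y).mulVec (Φ (m₀ + j + 1) y)) +
          ((U y).mulVec (Φ (m₀ + j + 1) y) - (U y).mulVec (Φ (m₀ + j) y)) +
          ((U y).mulVec (Φ (m₀ + j) y) - clockState d σ n₀ 0) := by abel
      rw [hsplit, WithLp.toLp_add, WithLp.toLp_add]
      refine (norm_add₃_le).trans ?_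
      push_cast
      linarith
  set m : ℤ := ⌊κ + (d : ℝ) / 2⌋ with hm
  have hm1 : (m : ℝ) ≤ κ + (d : ℝ) / 2 := Int.floor_le _
  have hm2 : κ + (d : ℝ) / 2 < m + 1 := Int.lt_floor_add_one _
  have hmm : m₀ ≤ m := Int.floor_le_floor (by linarith)
  obtain ⟨j, hj⟩ := Int.eq_ofNat_of_zero_le (sub_nonneg.2 hmm)
  have hmj : m = m₀ + j := by linarith
  have hjκ : (j : ℝ) ≤ κ + 1 := by
    have : (m : ℝ) = m₀ + j := by exact_mod_cast hmj
    linarith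
  have h := hind j κ hκ (by rw [← hmj]; linarith) (by rw [← hmj]; linarith)
  rw [← hmj] at h
  have hback : (evolution (T₀ / d * κ) H).mulVec (clockState d σ n₀ 0) - Φ m κ =
      (evolution (T₀ / d * κ) H).mulVec (-((U κ).mulVec (Φ m κ) - clockState d σ n₀ 0)) := by
    rw [Matrix.mulVec_neg, Matrix.mulVec_sub, Matrix.mulVec_mulVec, hU]
    simp only
    rw [evolution_mul_neg, Matrix.one_mulVec]
    abel
  rw [hback, norm_toLp_evolution_mulVec _ hHh, WithLp.toLp_neg, norm_neg]
  refine h.trans ?_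
  have := mul_le_mul_of_nonneg_right hjκ hstep0
  linarith

end QuantumClock

namespace QuantumClock

/-! ### Overlaps of evolved clock states -/

theorem gaussSum_zero_pos {d : ℕ} (hd : 0 < d) (σ : ℝ) : 0 < gaussSum d σ 0 := by
  have h0 : (0 : ℤ) ∈ centredIntegers d 0 := by
    rw [mem_centredIntegers]
    have : (0 : ℝ) < d := by exact_mod_cast hd
    push_cast
    constructor <;> linarith
  exact Finset.sum_pos (fun k _ => Real.exp_pos _) ⟨0, h0⟩

theorem normConst_sq {d : ℕ} (hd : 0 < d) (σ : ℝ) : normConst d σ 0 ^ 2 = 1 / gaussSum d σ 0 := by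
  rw [normConst, div_pow, one_pow, Real.sq_sqrt (gaussSum_zero_pos hd σ).le]

/-- The weight `|ψ(x)|²` of the Gaussian clock state at distance `x` from its centre. -/
noncomputable def gaussWeight (d : ℕ) (σ x : ℝ) : ℝ :=
  normConst d σ 0 ^ 2 * Real.exp (-(2 * Real.pi / σ ^ 2) * x ^ 2)

theorem gaussWeight_nonneg (d : ℕ) (σ x : ℝ) : 0 ≤ gaussWeight d σ x := by
  unfold gaussWeight; positivity

theorem sum_gaussWeight {d : ℕ} (hd : 0 < d) (σ κ : ℝ) :
    ∑ k ∈ centredIntegers d κ, gaussWeight d σ (k - κ) = gaussSum d σ κ / gaussSum d σ 0 := by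
  unfold gaussWeight
  rw [← Finset.mul_sum, normConst_sq hd, one_div_mul_eq_div]
  rfl

theorem star_movingState_dotProduct (V₀ : ℝ → ℝ) {d : ℕ} (hd : 0 < d) (σ n₀ Ω Ω' κ : ℝ) (m : ℤ) :
    star (movingState V₀ d σ n₀ Ω' m κ) ⬝ᵥ movingState V₀ d σ n₀ Ω m κ =
      ∑ k ∈ Finset.Ioc (m - d) m, star (movingAmplitude V₀ d σ n₀ Ω' κ k) *
        movingAmplitude V₀ d σ n₀ Ω κ k := by
  unfold movingState
  rw [star_sum, sum_dotProduct]
  refine Finset.sum_congr rfl fun j hj => ?_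
  rw [dotProduct_sum, Finset.sum_eq_single j]
  · rw [star_smul, smul_dotProduct, dotProduct_smul, star_timeState_dotProduct hd]
    simp
  · intro k hk hkj
    rw [star_smul, smul_dotProduct, dotProduct_smul, star_timeState_dotProduct hd, if_neg]
    · simp
    · rintro ⟨q, hq⟩
      rw [Finset.mem_Ioc] at hj hk
      have hd' : (0 : ℤ) < d := by exact_mod_cast hd
      have h1 : q < 1 := by nlinarith
      have h2 : -1 < q := by nlinarith
      have h3 : q = 0 := by omega
      rw [h3, mul_zero] at hq
      exact hkj (by omega)
  · exact fun h => absurd hj h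

theorem star_movingAmplitude_mul (V₀ : ℝ → ℝ) {d : ℕ} (σ n₀ Ω Ω' κ x : ℝ) :
    star (movingAmplitude V₀ d σ n₀ Ω' κ x) * movingAmplitude V₀ d σ n₀ Ω κ x =
      (gaussWeight d σ (x - κ) : ℝ) * Complex.exp (-(Complex.I * (((Ω - Ω') *
        ∫ y in (2 * Real.pi * (x - κ) / d)..(2 * Real.pi * x / d), V₀ y : ℝ) : ℂ))) := by
  unfold movingAmplitude clockPhase gaussWeight
  rw [star_mul', Complex.star_def, Complex.conj_ofReal, ← Complex.exp_conj,
    map_mul, Complex.conj_I, Complex.conj_ofReal, mul_mul_mul_comm, ← Complex.exp_add,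
    ← Complex.ofReal_mul]
  congr 1
  · congr 1
    rw [mul_mul_mul_comm, ← Real.exp_add, ← sq]
    congr 2
    ring
  · congr 1
    push_cast
    ring

theorem norm_exp_neg_I_mul_sub_le (x y : ℝ) :
    ‖Complex.exp (-(Complex.I * (x : ℂ))) - Complex.exp (-(Complex.I * (y : ℂ)))‖ ≤ |x - y| := by
  have e : Complex.exp (-(Complex.I * (x : ℂ))) - Complex.exp (-(Complex.I * (y : ℂ))) =
      Complex.exp ((-y : ℝ) * Complex.I) * (Complex.exp (Complex.I * ((y - x : ℝ) : ℂ)) - 1) := by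
    rw [mul_sub, mul_one, ← Complex.exp_add]
    congr 2 <;> push_cast <;> ring
  rw [e, norm_mul, Complex.norm_exp_ofReal_mul_I, one_mul, abs_sub_comm]
  exact Real.norm_exp_I_mul_ofReal_sub_one_le

theorem norm_star_dotProduct_le {ι : Type*} [Fintype ι] (v w : ι → ℂ) :
    ‖star v ⬝ᵥ w‖ ≤ ‖WithLp.toLp 2 v‖ * ‖WithLp.toLp 2 w‖ := by
  have h := norm_inner_le_norm (𝕜 := ℂ) (WithLp.toLp 2 v) (WithLp.toLp 2 w)
  rwa [EuclideanSpace.inner_eq_star_dotProduct, dotProduct_comm] at h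

theorem norm_sq_movingState (V₀ : ℝ → ℝ) {d : ℕ} (hd : 0 < d) (σ n₀ Ω κ : ℝ) :
    ‖WithLp.toLp 2 (movingState V₀ d σ n₀ Ω ⌊κ + (d : ℝ) / 2⌋ κ)‖ ^ 2 =
      gaussSum d σ κ / gaussSum d σ 0 := by
  have h := star_movingState_dotProduct V₀ hd σ n₀ Ω Ω κ ⌊κ + (d : ℝ) / 2⌋
  have h2 : ∀ k : ℤ, star (movingAmplitude V₀ d σ n₀ Ω κ k) * movingAmplitude V₀ d σ n₀ Ω κ k =
      ((gaussWeight d σ (k - κ) : ℝ) : ℂ) := by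
    intro k; rw [star_movingAmplitude_mul]; simp
  simp only [h2] at h
  rw [← centredIntegers_eq_Ioc, ← Complex.ofReal_sum, sum_gaussWeight hd] at h
  rw [← Complex.ofReal_inj, ← h, EuclideanSpace.norm_sq_eq, dotProduct]
  push_cast
  refine Finset.sum_congr rfl fun i _ => ?_
  rw [Pi.star_apply, Complex.star_def, ← Complex.normSq_eq_conj_mul_self,
    Complex.normSq_eq_norm_sq]
  push_cast
  rfl

theorem two_pi_mul_abs_integral_sub_eq_epsK {T₀ : ℝ} {V₀ : ℝ → ℝ} {d : ℕ} (hT₀ : 0 < T₀)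
    (hd : 0 < d) (hV : Continuous V₀) (t x : ℝ) :
    2 * Real.pi * |(∫ y in (2 * Real.pi * (x - d / T₀ * t) / d)..(2 * Real.pi * x / d), V₀ y) -
      ∫ y in (0 : ℝ)..(t * (2 * Real.pi) / T₀), V₀ y| = epsK T₀ V₀ d t (x - d / T₀ * t) := by
  have hd' : (d : ℝ) ≠ 0 := by positivity
  unfold epsK
  rw [intervalIntegral.integral_sub (hV.intervalIntegrable _ _)
    ((Continuous.intervalIntegrable (by fun_prop) _ _)),
    intervalIntegral.integral_comp_add_right (fun y => V₀ y), abs_sub_comm]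
  congr 4
  · ring
  · field_simp; ring

theorem norm_overlap_sub_le {T₀ : ℝ} {V₀ : ℝ → ℝ} {d : ℕ} {σ n₀ Ω Ω' b t : ℝ}
    (hT₀ : 0 < T₀) (hd : 2 ≤ d) (hσ : 0 < σ) (hσd : σ < d) (hn₀ : 0 < n₀) (hn₀' : n₀ < (d : ℝ) - 1)
    (hV : ContDiff ℝ (⊤ : ℕ∞) V₀) (hper : Function.Periodic V₀ (2 * Real.pi))
    (hpos : ∀ x, 0 ≤ V₀ x) (hb : IsDerivBound (fun x => Real.pi * V₀ x) b)
    (hΩ : |Ω| ≤ Real.pi) (hΩ' : |Ω'| ≤ Real.pi) (ht : 0 ≤ t) (G : ℝ) :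
    ‖star ((evolution t (sectorHamiltonian T₀ V₀ d Ω')).mulVec (clockState d σ n₀ 0)) ⬝ᵥ
        (evolution t (sectorHamiltonian T₀ V₀ d Ω)).mulVec (clockState d σ n₀ 0) -
      Complex.exp (-(Complex.I * (((Ω - Ω') * G : ℝ) : ℂ)))‖ ≤
      2 * epsClock T₀ d σ (alphaZero d n₀) b t + epsClock T₀ d σ (alphaZero d n₀) b t ^ 2 +
      (∑ k ∈ centredIntegers d (d / T₀ * t), epsK T₀ V₀ d t (k - d / T₀ * t) *
        gaussWeight d σ (k - d / T₀ * t) +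
      2 * Real.pi * |(∫ y in (0 : ℝ)..(t * (2 * Real.pi) / T₀), V₀ y) - G|) := by
  have hd0 : 0 < d := by omega
  have hd' : (0 : ℝ) < d := by exact_mod_cast hd0
  have hπ := Real.pi_pos
  set κ : ℝ := d / T₀ * t with hκ
  have hκ0 : 0 ≤ κ := by positivity
  have htκ : T₀ / d * κ = t := by rw [hκ]; field_simp
  set w := ∫ y in (0 : ℝ)..(t * (2 * Real.pi) / T₀), V₀ y with hw
  set Ψ := clockState d σ n₀ 0 with hΨ
  set a := (evolution t (sectorHamiltonian T₀ V₀ d Ω)).mulVec Ψ with ha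
  set a' := (evolution t (sectorHamiltonian T₀ V₀ d Ω')).mulVec Ψ with ha'
  set φ := movingState V₀ d σ n₀ Ω ⌊κ + (d : ℝ) / 2⌋ κ with hφ
  set φ' := movingState V₀ d σ n₀ Ω' ⌊κ + (d : ℝ) / 2⌋ κ with hφ'
  set ε := κ * epsT d σ (alphaZero d n₀) b + (κ + 1) * epsStep d σ with hε
  have h1 : ‖WithLp.toLp 2 (a - φ)‖ ≤ ε := by
    have := norm_evolution_clockState_sub_le hT₀ hd hσ hσd hn₀ hn₀' hV hper hpos hb hΩ hκ0
    rwa [htκ] at this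
  have h1' : ‖WithLp.toLp 2 (a' - φ')‖ ≤ ε := by
    have := norm_evolution_clockState_sub_le hT₀ hd hσ hσd hn₀ hn₀' hV hper hpos hb hΩ' hκ0
    rwa [htκ] at this
  have hS0 := gaussSum_zero_pos hd0 σ
  have hSκ : 0 ≤ gaussSum d σ κ := Finset.sum_nonneg fun k _ => (Real.exp_pos _).le
  set r := Real.sqrt (gaussSum d σ κ / gaussSum d σ 0) with hr
  have hr0 : 0 ≤ r := Real.sqrt_nonneg _
  have hr2 : r ^ 2 = gaussSum d σ κ / gaussSum d σ 0 := Real.sq_sqrt (by positivity)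
  have hΨn : ‖WithLp.toLp 2 Ψ‖ = 1 := by
    have := norm_sq_movingState V₀ hd0 σ n₀ Ω 0
    rw [zero_add, movingState_zero, div_self hS0.ne'] at this
    exact (pow_eq_one_iff_of_nonneg (norm_nonneg _) two_ne_zero).1 this
  have han : ‖WithLp.toLp 2 a‖ = 1 := by
    rw [ha, norm_toLp_evolution_mulVec _ (isHermitian_sectorHamiltonian T₀ V₀ d Ω), hΨn]
  have hφn : ‖WithLp.toLp 2 φ'‖ = r := by
    rw [hr, ← norm_sq_movingState V₀ hd0 σ n₀ Ω' κ, Real.sqrt_sq (norm_nonneg _)]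
  set δ := epsNor T₀ d σ t with hδ
  have hδr : δ = |r - 1| := rfl
  have hclock : epsClock T₀ d σ (alphaZero d n₀) b t = ε + δ := by
    rw [epsClock, abs_of_nonneg ht, hε, hκ]; ring
  have hε0 : 0 ≤ ε := (norm_nonneg _).trans h1
  have hrle : r ≤ 1 + δ := by rw [hδr]; linarith [le_abs_self (r - 1)]
  have hδ0 : 0 ≤ δ := by rw [hδr]; positivity
  -- the error of replacing both states
  have hA : ‖star a' ⬝ᵥ a - star φ' ⬝ᵥ φ‖ ≤ ε + (1 + δ) * ε := by
    have e : star a' ⬝ᵥ a - star φ' ⬝ᵥ φ = star (a' - φ') ⬝ᵥ a + star φ' ⬝ᵥ (a - φ) := by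
      rw [star_sub, sub_dotProduct, dotProduct_sub]; ring
    rw [e]
    refine (norm_add_le _ _).trans (add_le_add ?_ ?_)
    · refine (norm_star_dotProduct_le _ _).trans ?_
      rw [han, mul_one]; exact h1'
    · refine (norm_star_dotProduct_le _ _).trans ?_
      rw [hφn]
      exact mul_le_mul hrle h1 (norm_nonneg _) (by positivity)
  set e : ℝ → ℂ := fun s => Complex.exp (-(Complex.I * (((Ω - Ω') * s : ℝ) : ℂ))) with he
  have hΩΩ : |Ω - Ω'| ≤ 2 * Real.pi := (abs_sub _ _).trans (by linarith)
  have hee : ∀ s s' : ℝ, ‖e s - e s'‖ ≤ 2 * Real.pi * |s - s'| := by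
    intro s s'
    refine (norm_exp_neg_I_mul_sub_le _ _).trans ?_
    rw [← mul_sub, abs_mul]
    gcongr
  have hen : ∀ s : ℝ, ‖e s‖ = 1 := by
    intro s
    rw [he]
    simp only
    rw [mul_comm Complex.I, ← neg_mul, ← Complex.ofReal_neg, Complex.norm_exp_ofReal_mul_I]
  have hB : star φ' ⬝ᵥ φ - e G =
      (∑ k ∈ centredIntegers d κ, (gaussWeight d σ (k - κ) : ℂ) *
        (e (∫ y in (2 * Real.pi * (k - κ) / d)..(2 * Real.pi * k / d), V₀ y) - e w)) +
      ((r ^ 2 - 1 : ℝ) : ℂ) * e w + (e w - e G) := by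
    rw [hφ, hφ', star_movingState_dotProduct V₀ hd0]
    simp only [star_movingAmplitude_mul]
    rw [← centredIntegers_eq_Ioc, hr2, ← sum_gaussWeight hd0]
    simp only [mul_sub, Finset.sum_sub_distrib, ← Finset.sum_mul]
    push_cast
    simp only [he]
    push_cast
    ring
  have hBn : ‖star φ' ⬝ᵥ φ - e G‖ ≤ (∑ k ∈ centredIntegers d κ, epsK T₀ V₀ d t (k - κ) *
        gaussWeight d σ (k - κ)) + (2 * δ + δ ^ 2) + 2 * Real.pi * |w - G| := by
    rw [hB]
    refine (norm_add₃_le).trans (add_le_add (add_le_add ?_ ?_) (hee _ _))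
    · refine (norm_sum_le _ _).trans (Finset.sum_le_sum fun k _ => ?_)
      rw [norm_mul, Complex.norm_real, Real.norm_eq_abs, abs_of_nonneg (gaussWeight_nonneg _ _ _),
        mul_comm]
      refine mul_le_mul_of_nonneg_right ((hee _ _).trans (le_of_eq ?_)) (gaussWeight_nonneg _ _ _)
      exact two_pi_mul_abs_integral_sub_eq_epsK hT₀ hd0 hV.continuous t k
    · rw [norm_mul, hen, mul_one, Complex.norm_real, Real.norm_eq_abs]
      have e1 : r ^ 2 - 1 = (r - 1) * (2 + (r - 1)) := by ring
      have e2 : |2 + (r - 1)| ≤ 2 + δ := by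
        rw [hδr]
        refine (abs_add_le _ _).trans ?_
        norm_num
      rw [e1, abs_mul, ← hδr]
      calc δ * |2 + (r - 1)| ≤ δ * (2 + δ) := by gcongr
        _ = _ := by ring
  have hfin : star a' ⬝ᵥ a - e G = (star a' ⬝ᵥ a - star φ' ⬝ᵥ φ) + (star φ' ⬝ᵥ φ - e G) := by ring
  change ‖star a' ⬝ᵥ a - e G‖ ≤ _
  rw [hfin, hclock]
  refine (norm_add_le _ _).trans ((add_le_add hA hBn).trans ?_)
  nlinarith [mul_nonneg hε0 hδ0, sq_nonneg ε]

end QuantumClock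

namespace QuantumClock

/-! ### Reduction of the system to the eigenspaces of the interaction -/

section Intertwiner

attribute [local instance] Matrix.linftyOpNormedRing Matrix.linftyOpNormedAlgebra

theorem hasSum_exp_matrix {ι : Type*} [Fintype ι] [DecidableEq ι] (A : Matrix ι ι ℂ) :
    HasSum (fun n : ℕ => ((n.factorial : ℂ)⁻¹) • A ^ n) (NormedSpace.exp A) :=
  NormedSpace.exp_series_hasSum_exp' (𝕂 := ℂ) A

end Intertwiner

theorem exp_mul_eq_mul_exp {ι κ : Type*} [Fintype ι] [DecidableEq ι] [Fintype κ] [DecidableEq κ]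
    {A : Matrix ι ι ℂ} {B : Matrix ι κ ℂ} {C : Matrix κ κ ℂ} (h : A * B = B * C) :
    NormedSpace.exp A * B = B * NormedSpace.exp C := by
  have hpow : ∀ n : ℕ, A ^ n * B = B * C ^ n := by
    intro n
    induction n with
    | zero => simp
    | succ n ih => rw [pow_succ, Matrix.mul_assoc, h, ← Matrix.mul_assoc, ih, Matrix.mul_assoc,
        pow_succ]
  have h1 := (hasSum_exp_matrix A).map
    (AddMonoidHom.mk' (fun M : Matrix ι ι ℂ => M * B) fun _ _ => Matrix.add_mul _ _ _)
    (by exact Continuous.matrix_mul continuous_id continuous_const)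
  have h2 := (hasSum_exp_matrix C).map
    (AddMonoidHom.mk' (fun M : Matrix κ κ ℂ => B * M) fun _ _ => Matrix.mul_add _ _ _)
    (by exact Continuous.matrix_mul continuous_const continuous_id)
  refine h1.unique ?_
  convert! h2 using 1
  funext n
  simp [hpow]

theorem evolution_mul_eq_mul_evolution {ι κ : Type*} [Fintype ι] [DecidableEq ι] [Fintype κ]
    [DecidableEq κ] {A : Matrix ι ι ℂ} {B : Matrix ι κ ℂ} {C : Matrix κ κ ℂ} (h : A * B = B * C)
    (t : ℝ) : evolution t A * B = B * evolution t C := by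
  unfold evolution
  apply exp_mul_eq_mul_exp
  rw [Matrix.smul_mul, h, Matrix.mul_smul]

theorem evolution_add_of_commute {ι : Type*} [Fintype ι] [DecidableEq ι] {A B : Matrix ι ι ℂ}
    (h : Commute A B) (t : ℝ) : evolution t (A + B) = evolution t A * evolution t B := by
  unfold evolution
  rw [smul_add, Matrix.exp_add_of_commute]
  exact (h.smul_left _).smul_right _

theorem evolution_diagonal {ι : Type*} [Fintype ι] [DecidableEq ι] (t : ℝ) (v : ι → ℝ) :
    evolution t (Matrix.diagonal fun i => (v i : ℂ)) =
      Matrix.diagonal fun i => Complex.exp (-(Complex.I * ((v i * t : ℝ) : ℂ))) := by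
  unfold evolution
  rw [← Matrix.diagonal_smul, Matrix.exp_diagonal]
  congr 1
  funext i
  rw [Pi.coe_exp, ← Complex.exp_eq_exp_ℂ]
  simp only [Pi.smul_apply, smul_eq_mul]
  congr 1
  push_cast
  ring

theorem evolution_total_mul_column {dS d : ℕ} {T₀ : ℝ} {V₀ : ℝ → ℝ}
    {Hs Hint : Matrix (Fin dS) (Fin dS) ℂ} (hcomm : Commute Hs Hint) {w : Fin dS → ℂ} {Ω : ℝ}
    (hw : Hint.mulVec w = (Ω : ℂ) • w) (Ψ : Fin d → ℂ) (t : ℝ) :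
    (evolution t (totalHamiltonian T₀ V₀ d Hs Hint)).mulVec (fun p => w p.1 * Ψ p.2) =
      fun p => ((evolution t Hs).mulVec w) p.1 *
        ((evolution t (sectorHamiltonian T₀ V₀ d Ω)).mulVec Ψ) p.2 := by
  set I₂ : Matrix (Fin d) (Fin d) ℂ := 1 with hI2
  set I₁ : Matrix (Fin dS) (Fin dS) ℂ := 1 with hI1
  set R := I₁ ⊗ₖ clockHamiltonian T₀ d + Hint ⊗ₖ clockPotential T₀ V₀ d with hR
  have hsplit : totalHamiltonian T₀ V₀ d Hs Hint = Hs ⊗ₖ I₂ + R := by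
    rw [totalHamiltonian, hR, add_assoc]
  have hcommR : Commute (Hs ⊗ₖ I₂) R := by
    refine Commute.add_right ?_ ?_
    · unfold Commute SemiconjBy
      rw [← Matrix.mul_kronecker_mul, ← Matrix.mul_kronecker_mul]
      simp [hI1, hI2]
    · unfold Commute SemiconjBy
      rw [← Matrix.mul_kronecker_mul, ← Matrix.mul_kronecker_mul, hcomm.eq]
      simp [hI2]
  set B : Matrix (Fin dS × Fin d) (Fin d) ℂ := Matrix.of fun p l => w p.1 * I₂ p.2 l with hB
  have hRB : R * B = B * sectorHamiltonian T₀ V₀ d Ω := by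
    ext ⟨x, k⟩ l
    have h1 : ∀ (M : Matrix (Fin dS) (Fin dS) ℂ) (N : Matrix (Fin d) (Fin d) ℂ),
        ((M ⊗ₖ N) * B) (x, k) l = (M.mulVec w) x * N k l := by
      intro M N
      rw [Matrix.mul_apply, Fintype.sum_prod_type, Matrix.mulVec, dotProduct, Finset.sum_mul]
      refine Finset.sum_congr rfl fun y _ => ?_
      rw [Finset.sum_eq_single l]
      · simp [hB, hI2, Matrix.kroneckerMap_apply]; ring
      · intro j _ hj; simp [hB, hI2, Matrix.one_apply, hj]
      · simp
    have h2 : ∀ N : Matrix (Fin d) (Fin d) ℂ, (B * N) (x, k) l = w x * N k l := by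
      intro N
      rw [Matrix.mul_apply, Finset.sum_eq_single k]
      · simp [hB, hI2]
      · intro j _ hj; simp [hB, hI2, Matrix.one_apply, hj.symm]
      · simp
    rw [hR, Matrix.add_mul, Matrix.add_apply, h1, h1, h2, hw, sectorHamiltonian]
    simp [hI1]
    ring
  have hBΨ : B.mulVec Ψ = fun p => w p.1 * Ψ p.2 := by
    funext p
    rw [Matrix.mulVec, dotProduct, Finset.sum_eq_single p.2]
    · simp [hB, hI2]
    · intro j _ hj; simp [hB, hI2, Matrix.one_apply, hj.symm]
    · simp
  set a := (evolution t (sectorHamiltonian T₀ V₀ d Ω)).mulVec Ψ with ha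
  set C : Matrix (Fin dS × Fin d) (Fin dS) ℂ := Matrix.of fun p y => I₁ p.1 y * a p.2 with hC
  have hHC : (Hs ⊗ₖ I₂) * C = C * Hs := by
    ext ⟨x, k⟩ y
    rw [Matrix.mul_apply, Matrix.mul_apply, Fintype.sum_prod_type, Finset.sum_eq_single y,
      Finset.sum_eq_single k, Finset.sum_eq_single x]
    · simp [hC, hI1, hI2]; ring
    · intro j _ hj; simp [hC, hI1, Matrix.one_apply, hj.symm]
    · simp
    · intro j _ hj; simp [hI2, hj.symm]
    · simp
    · intro j _ hj; simp [hC, hI1, Matrix.one_apply, hj]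
    · simp
  have hCw : ∀ u : Fin dS → ℂ, C.mulVec u = fun p => u p.1 * a p.2 := by
    intro u
    funext p
    rw [Matrix.mulVec, dotProduct, Finset.sum_eq_single p.1]
    · simp [hC, hI1]; ring
    · intro j _ hj; simp [hC, hI1, Matrix.one_apply, hj.symm]
    · simp
  have hBa : B.mulVec a = fun p => w p.1 * a p.2 := by
    funext p
    rw [Matrix.mulVec, dotProduct, Finset.sum_eq_single p.2]
    · simp [hB, hI2]
    · intro j _ hj; simp [hB, hI2, Matrix.one_apply, hj.symm]
    · simp
  rw [hsplit, evolution_add_of_commute hcommR, ← hBΨ, ← Matrix.mulVec_mulVec,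
    Matrix.mulVec_mulVec Ψ, evolution_mul_eq_mul_evolution hRB, ← Matrix.mulVec_mulVec, ← ha, hBa,
    ← hCw w, Matrix.mulVec_mulVec, evolution_mul_eq_mul_evolution hHC, ← Matrix.mulVec_mulVec, hCw]

/-! ### The trace norm -/

theorem traceNorm_le_sqrt {dS : ℕ} (M : Matrix (Fin dS) (Fin dS) ℂ) :
    traceNorm M ≤ Real.sqrt (dS * (M.conjTranspose * M).trace.re) := by
  set hH := Matrix.isHermitian_conjTranspose_mul_self M with hHd
  have hnn : ∀ i, 0 ≤ hH.eigenvalues i :=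
    fun i => (Matrix.posSemidef_conjTranspose_mul_self M).eigenvalues_nonneg i
  have htr : (M.conjTranspose * M).trace.re = ∑ i, hH.eigenvalues i := by
    rw [hH.trace_eq_sum_eigenvalues]
    simp
  rw [traceNorm, htr]
  refine Real.le_sqrt_of_sq_le ?_
  have h := sq_sum_le_card_mul_sum_sq (s := Finset.univ)
    (f := fun i => Real.sqrt (hH.eigenvalues i))
  rw [Finset.card_univ, Fintype.card_fin] at h
  refine h.trans (le_of_eq ?_)
  congr 1
  exact Finset.sum_congr rfl fun i _ => Real.sq_sqrt (hnn i)

theorem trace_conjTranspose_mul_self_re {ι : Type*} [Fintype ι] (M : Matrix ι ι ℂ) :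
    (M.conjTranspose * M).trace.re = ∑ i, ∑ j, ‖M i j‖ ^ 2 := by
  rw [Matrix.trace, Complex.re_sum, Finset.sum_comm]
  refine Finset.sum_congr rfl fun j _ => ?_
  rw [Matrix.diag_apply, Matrix.mul_apply, Complex.re_sum]
  refine Finset.sum_congr rfl fun i _ => ?_
  rw [Matrix.conjTranspose_apply, Complex.star_def, ← Complex.normSq_eq_conj_mul_self,
    Complex.ofReal_re, Complex.normSq_eq_norm_sq]

theorem trace_conj_of_unitary {ι : Type*} [Fintype ι] [DecidableEq ι] {Q : Matrix ι ι ℂ}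
    (hQ : Q.conjTranspose * Q = 1) (N : Matrix ι ι ℂ) :
    ((Q * N * Q.conjTranspose).conjTranspose * (Q * N * Q.conjTranspose)).trace =
      (N.conjTranspose * N).trace := by
  have e : (Q * N * Q.conjTranspose).conjTranspose * (Q * N * Q.conjTranspose) =
      Q * (N.conjTranspose * N) * Q.conjTranspose := by
    rw [Matrix.conjTranspose_mul, Matrix.conjTranspose_mul, Matrix.conjTranspose_conjTranspose]
    calc Q * (N.conjTranspose * Q.conjTranspose) * (Q * N * Q.conjTranspose) =
        Q * N.conjTranspose * (Q.conjTranspose * Q) * N * Q.conjTranspose := by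
          simp only [Matrix.mul_assoc]
      _ = _ := by rw [hQ]; simp only [Matrix.mul_assoc, Matrix.one_mul]
  rw [e, Matrix.trace_mul_comm, ← Matrix.mul_assoc, hQ, Matrix.one_mul]

/-- The trace norm of the difference of the pulse-driven and the autonomous state is bounded
through the overlaps of the clock states evolved in the sectors of the interaction. -/
theorem traceNorm_pulse_sub_autonomous_le {dS d : ℕ} {T₀ : ℝ} {V₀ : ℝ → ℝ} {σ n₀ t tᵢ η : ℝ}
    {Hs Hint ρ : Matrix (Fin dS) (Fin dS) ℂ} {g : ℝ → ℝ} (hsys : IsSystem Hs Hint ρ) (hη : 0 ≤ η)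
    (hov : ∀ Ω Ω' : ℝ, |Ω| ≤ Real.pi → |Ω'| ≤ Real.pi →
      ‖star ((evolution t (sectorHamiltonian T₀ V₀ d Ω')).mulVec (clockState d σ n₀ 0)) ⬝ᵥ
        (evolution t (sectorHamiltonian T₀ V₀ d Ω)).mulVec (clockState d σ n₀ 0) -
      Complex.exp (-(Complex.I * (((Ω - Ω') * (∫ x in tᵢ..t, g x) : ℝ) : ℂ)))‖ ≤ η) :
    traceNorm (pulseState g tᵢ Hs Hint ρ t - autonomousState T₀ V₀ d σ n₀ Hs Hint ρ t) ≤
      systemFactor ρ * η := by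
  obtain ⟨hHs, ⟨hHi, hev⟩, hcomm, hρ, -⟩ := hsys
  set γ := ∫ x in tᵢ..t, g x with hγ
  set Ω : Fin dS → ℝ := hHi.eigenvalues with hΩ
  set W : Matrix (Fin dS) (Fin dS) ℂ := (hHi.eigenvectorUnitary : Matrix (Fin dS) (Fin dS) ℂ) with hW
  have hWW : W.conjTranspose * W = 1 := Matrix.mem_unitaryGroup_iff'.1 hHi.eigenvectorUnitary.2
  have hWW' : W * W.conjTranspose = 1 := Matrix.mem_unitaryGroup_iff.1 hHi.eigenvectorUnitary.2
  have hHW : Hint * W = W * Matrix.diagonal fun i => (Ω i : ℂ) := by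
    have h := hHi.spectral_theorem
    rw [Unitary.conjStarAlgAut_apply] at h
    have h2 : Hint * W = (W * Matrix.diagonal (RCLike.ofReal ∘ hHi.eigenvalues) *
        W.conjTranspose) * W := congrArg (· * W) h
    rw [h2, Matrix.mul_assoc, hWW, Matrix.mul_one]
    rfl
  have hWcol : ∀ i, Hint.mulVec (fun x => W x i) = (Ω i : ℂ) • fun x => W x i := by
    intro i
    funext x
    have h := congrFun (congrFun hHW x) i
    rw [Matrix.mul_diagonal] at h
    rw [Pi.smul_apply, smul_eq_mul, mul_comm, ← h, Matrix.mul_apply, Matrix.mulVec, dotProduct]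
  have hΩπ : ∀ i, |Ω i| ≤ Real.pi := fun i => abs_le.2 ⟨(hev i).1, (hev i).2.le⟩
  set S := evolution t Hs with hS
  have hSS : S.conjTranspose * S = 1 := by
    rw [hS, evolution_conjTranspose t hHs, evolution_neg_mul]
  set Q := S * W with hQ
  have hQQ : Q.conjTranspose * Q = 1 := by
    rw [hQ, Matrix.conjTranspose_mul, Matrix.mul_assoc, ← Matrix.mul_assoc S.conjTranspose, hSS,
      Matrix.one_mul, hWW]
  set R := W.conjTranspose * ρ * W with hR
  have hρR : ρ = W * R * W.conjTranspose := by
    rw [hR]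
    calc ρ = (W * W.conjTranspose) * ρ * (W * W.conjTranspose) := by
          rw [hWW', Matrix.one_mul, Matrix.mul_one]
      _ = _ := by simp only [Matrix.mul_assoc]
  set a : Fin dS → Fin d → ℂ := fun i =>
    (evolution t (sectorHamiltonian T₀ V₀ d (Ω i))).mulVec (clockState d σ n₀ 0) with ha
  set K : Matrix (Fin dS) (Fin dS) ℂ := Matrix.of fun i j => star (a j) ⬝ᵥ a i with hK
  set K₀ : Matrix (Fin dS) (Fin dS) ℂ := Matrix.of fun i j =>
    Complex.exp (-(Complex.I * (((Ω i - Ω j) * γ : ℝ) : ℂ))) with hK0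
  -- the pulse-driven state
  have hpulse : pulseState g tᵢ Hs Hint ρ t =
      Q * Matrix.of (fun i j => R i j * K₀ i j) * Q.conjTranspose := by
    have h1 : evolution γ Hint * W = W * evolution γ (Matrix.diagonal fun i => (Ω i : ℂ)) :=
      evolution_mul_eq_mul_evolution hHW γ
    have h2 : W.conjTranspose * evolution (-γ) Hint =
        evolution (-γ) (Matrix.diagonal fun i => (Ω i : ℂ)) * W.conjTranspose := by
      have h3 := evolution_mul_eq_mul_evolution hHW (-γ)
      calc W.conjTranspose * evolution (-γ) Hint =
          W.conjTranspose * (evolution (-γ) Hint * W) * W.conjTranspose := by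
            rw [Matrix.mul_assoc, Matrix.mul_assoc, hWW', Matrix.mul_one]
        _ = _ := by rw [h3, ← Matrix.mul_assoc, hWW, Matrix.one_mul]
    have h4 : evolution γ (Matrix.diagonal fun i => (Ω i : ℂ)) * R *
        evolution (-γ) (Matrix.diagonal fun i => (Ω i : ℂ)) =
        Matrix.of (fun i j => R i j * K₀ i j) := by
      rw [evolution_diagonal, evolution_diagonal]
      ext i j
      rw [Matrix.mul_diagonal, Matrix.diagonal_mul, Matrix.of_apply, hK0, Matrix.of_apply,
        mul_comm (Complex.exp _) (R i j), mul_assoc, ← Complex.exp_add]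
      congr 2
      push_cast
      ring
    rw [pulseState, ← hγ, ← h4, hQ, Matrix.conjTranspose_mul, hS, evolution_conjTranspose t hHs]
    conv_lhs => rw [hρR]
    calc evolution t Hs * evolution γ Hint * (W * R * W.conjTranspose) *
          (evolution (-γ) Hint * evolution (-t) Hs)
        = evolution t Hs * (evolution γ Hint * W) * R *
          (W.conjTranspose * evolution (-γ) Hint) * evolution (-t) Hs := by
          simp only [Matrix.mul_assoc]
      _ = _ := by rw [h1, h2]; simp only [Matrix.mul_assoc]
  -- the autonomous state
  have hauto : autonomousState T₀ V₀ d σ n₀ Hs Hint ρ t =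
      Q * Matrix.of (fun i j => R i j * K i j) * Q.conjTranspose := by
    set E := evolution t (totalHamiltonian T₀ V₀ d Hs Hint) with hE
    set Ψ := clockState d σ n₀ 0 with hΨ
    have hHh : (totalHamiltonian T₀ V₀ d Hs Hint).IsHermitian := by
      unfold totalHamiltonian Matrix.IsHermitian
      rw [Matrix.conjTranspose_add, Matrix.conjTranspose_add, Matrix.conjTranspose_kronecker,
        Matrix.conjTranspose_kronecker, Matrix.conjTranspose_kronecker, hHs.eq, hHi.eq,
        (isHermitian_clockHamiltonian T₀ d).eq, (isHermitian_clockPotential T₀ V₀ d).eq,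
        Matrix.conjTranspose_one, Matrix.conjTranspose_one]
    have hEc : evolution (-t) (totalHamiltonian T₀ V₀ d Hs Hint) = E.conjTranspose :=
      (evolution_conjTranspose t hHh).symm
    set Wb : Matrix (Fin dS × Fin d) (Fin dS) ℂ := Matrix.of fun p i => W p.1 i * Ψ p.2 with hWb
    set Y : Matrix (Fin dS × Fin d) (Fin dS) ℂ := Matrix.of fun p i => Q p.1 i * a i p.2 with hY
    have hEW : E * Wb = Y := by
      ext p i
      have h := congrFun (evolution_total_mul_column (T₀ := T₀) (V₀ := V₀) hcomm (hWcol i) Ψ t) p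
      rw [Matrix.mul_apply]
      exact h
    have hρW : ρ ⊗ₖ ketbra Ψ = Wb * R * Wb.conjTranspose := by
      ext ⟨x, k⟩ ⟨y, l⟩
      have h := congrFun (congrFun hρR x) y
      rw [Matrix.kroneckerMap_apply, h]
      simp only [Matrix.mul_apply, Matrix.conjTranspose_apply, hWb, Matrix.of_apply, ketbra,
        Matrix.vecMulVec_apply, Pi.star_apply, star_mul', Finset.sum_mul]
      refine Finset.sum_congr rfl fun j _ => Finset.sum_congr rfl fun i _ => ?_
      ring
    have hEE : E * (ρ ⊗ₖ ketbra Ψ) * E.conjTranspose = Y * R * Y.conjTranspose := by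
      rw [hρW, ← hEW, Matrix.conjTranspose_mul]
      simp only [Matrix.mul_assoc]
    rw [autonomousState, hEc, ← hE, ← hΨ, hEE]
    ext x y
    simp only [partialTrace, Matrix.of_apply, Matrix.mul_apply, Matrix.conjTranspose_apply, hY,
      Finset.sum_mul, star_mul', hK, dotProduct, Finset.mul_sum]
    rw [Finset.sum_comm]
    refine Finset.sum_congr rfl fun j _ => ?_
    rw [Finset.sum_comm]
    refine Finset.sum_congr rfl fun i _ => Finset.sum_congr rfl fun k _ => ?_
    rw [Pi.star_apply]
    ring
  set N : Matrix (Fin dS) (Fin dS) ℂ := Matrix.of fun i j => R i j * (K₀ i j - K i j) with hN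
  have hdiff : pulseState g tᵢ Hs Hint ρ t - autonomousState T₀ V₀ d σ n₀ Hs Hint ρ t =
      Q * N * Q.conjTranspose := by
    rw [hpulse, hauto, ← Matrix.sub_mul, ← Matrix.mul_sub]
    congr 2
    ext i j
    simp only [hN, Matrix.sub_apply, Matrix.of_apply]
    ring
  rw [hdiff]
  refine (traceNorm_le_sqrt _).trans ?_
  rw [trace_conj_of_unitary hQQ, trace_conjTranspose_mul_self_re, systemFactor]
  have hNle : ∑ i, ∑ j, ‖N i j‖ ^ 2 ≤ η ^ 2 * ∑ i, ∑ j, ‖R i j‖ ^ 2 := by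
    rw [Finset.mul_sum]
    refine Finset.sum_le_sum fun i _ => ?_
    rw [Finset.mul_sum]
    refine Finset.sum_le_sum fun j _ => ?_
    rw [hN, Matrix.of_apply, norm_mul, mul_pow, mul_comm]
    refine mul_le_mul_of_nonneg_right (pow_le_pow_left₀ (norm_nonneg _) ?_ 2) (by positivity)
    rw [norm_sub_rev]
    exact hov (Ω i) (Ω j) (hΩπ i) (hΩπ j)
  have hRρ : ∑ i, ∑ j, ‖R i j‖ ^ 2 = (ρ * ρ).trace.re := by
    rw [← trace_conjTranspose_mul_self_re, ← trace_conj_of_unitary hWW, ← hρR, hρ.isHermitian.eq]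
  rw [hRρ] at hNle
  calc Real.sqrt (dS * ∑ i, ∑ j, ‖N i j‖ ^ 2) ≤ Real.sqrt (dS * (ρ * ρ).trace.re * η ^ 2) := by
        refine Real.sqrt_le_sqrt ?_
        rw [mul_assoc, mul_comm _ (η ^ 2)]
        gcongr
    _ = Real.sqrt (dS * (ρ * ρ).trace.re) * η := by
        rw [Real.sqrt_mul', Real.sqrt_sq hη]
        positivity

end QuantumClock

namespace QuantumClock

/-! ### The mass of the potential outside the peak window -/

/-- A continuous nonnegative `2π`-periodic potential of integral one over a period. -/
structure IsUnitPotential (V₀ : ℝ → ℝ) : Prop where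
  continuous : Continuous V₀
  periodic : Function.Periodic V₀ (2 * Real.pi)
  integral_eq_one : ∫ x in (0 : ℝ)..(2 * Real.pi), V₀ x = 1
  nonneg : ∀ x, 0 ≤ V₀ x

theorem IsPeakedPotential.isUnitPotential {V₀ : ℝ → ℝ} {x₀ : ℝ} (h : IsPeakedPotential V₀ x₀) :
    IsUnitPotential V₀ := ⟨h.1.continuous, h.2.1, h.2.2.1, h.2.2.2.1⟩

namespace IsUnitPotential

variable {V₀ : ℝ → ℝ}

theorem intervalIntegrable (hV : IsUnitPotential V₀) (u v : ℝ) :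
    IntervalIntegrable V₀ MeasureTheory.volume u v := hV.continuous.intervalIntegrable u v

theorem integral_add_integral (hV : IsUnitPotential V₀) (u v w : ℝ) :
    (∫ x in u..v, V₀ x) + ∫ x in v..w, V₀ x = ∫ x in u..w, V₀ x :=
  intervalIntegral.integral_add_adjacent_intervals (hV.intervalIntegrable u v)
    (hV.intervalIntegrable v w)

theorem integral_nonneg (hV : IsUnitPotential V₀) {u v : ℝ} (h : u ≤ v) :
    0 ≤ ∫ x in u..v, V₀ x :=
  intervalIntegral.integral_nonneg h fun x _ => hV.nonneg x

theorem integral_period (hV : IsUnitPotential V₀) (u : ℝ) :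
    ∫ x in u..(u + 2 * Real.pi), V₀ x = 1 := by
  rw [hV.periodic.intervalIntegral_add_eq u 0, zero_add, hV.integral_eq_one]

theorem integral_sub_period (hV : IsUnitPotential V₀) (u v : ℝ) :
    ∫ x in (u - 2 * Real.pi)..(v - 2 * Real.pi), V₀ x = ∫ x in u..v, V₀ x := by
  rw [← intervalIntegral.integral_comp_sub_right (fun x => V₀ x)]
  exact intervalIntegral.integral_congr fun x _ => hV.periodic.sub_eq x

theorem integral_le_one (hV : IsUnitPotential V₀) {u v : ℝ} (h : v ≤ u + 2 * Real.pi) :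
    ∫ x in u..v, V₀ x ≤ 1 := by
  have h1 := hV.integral_add_integral u v (u + 2 * Real.pi)
  rw [hV.integral_period] at h1
  linarith [hV.integral_nonneg h]

theorem outsideMass_eq (hV : IsUnitPotential V₀) (x₀ xvr : ℝ) :
    outsideMass V₀ x₀ xvr = ∫ x in (x₀ + xvr - 2 * Real.pi)..(x₀ - xvr), V₀ x := by
  unfold outsideMass
  rw [intervalIntegral.integral_comp_add_right (fun x => V₀ x), neg_add_eq_sub, add_comm xvr]
  have h1 := hV.integral_add_integral (x₀ + xvr - 2 * Real.pi) (x₀ - xvr) (x₀ + xvr)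
  have h2 := hV.integral_period (x₀ + xvr - 2 * Real.pi)
  rw [sub_add_cancel] at h2
  linarith

theorem integral_le_outsideMass (hV : IsUnitPotential V₀) {x₀ xvr u v : ℝ}
    (hu : x₀ + xvr - 2 * Real.pi ≤ u) (hv : v ≤ x₀ - xvr) :
    ∫ x in u..v, V₀ x ≤ outsideMass V₀ x₀ xvr := by
  rw [hV.outsideMass_eq]
  have h1 := hV.integral_add_integral (x₀ + xvr - 2 * Real.pi) u v
  have h2 := hV.integral_add_integral (x₀ + xvr - 2 * Real.pi) v (x₀ - xvr)
  linarith [hV.integral_nonneg hu, hV.integral_nonneg hv]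

theorem outsideMass_nonneg (hV : IsUnitPotential V₀) {x₀ xvr : ℝ} (h : xvr ≤ Real.pi) :
    0 ≤ outsideMass V₀ x₀ xvr := by
  rw [hV.outsideMass_eq]
  exact hV.integral_nonneg (by linarith)

theorem epsK_eq (hV : IsUnitPotential V₀) (T₀ : ℝ) (d : ℕ) (t k : ℝ) :
    epsK T₀ V₀ d t k = 2 * Real.pi * |(∫ x in (0 : ℝ)..(2 * Real.pi * k / d), V₀ x) -
      ∫ x in (t * (2 * Real.pi) / T₀)..(t * (2 * Real.pi) / T₀ + 2 * Real.pi * k / d), V₀ x| := by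
  unfold epsK
  have hc : Continuous fun x => V₀ (x + 2 * Real.pi * k / d) :=
    hV.continuous.comp (continuous_id.add continuous_const)
  rw [intervalIntegral.integral_sub (hV.intervalIntegrable _ _) (hc.intervalIntegrable _ _),
    intervalIntegral.integral_comp_add_right (fun y => V₀ y), zero_add]
  set a := 2 * Real.pi * k / d
  set τ := t * (2 * Real.pi) / T₀
  have h1 := hV.integral_add_integral 0 τ (τ + a)
  have h2 := hV.integral_add_integral 0 a (τ + a)
  congr 2
  linarith

end IsUnitPotential

theorem epsK_nonneg (T₀ : ℝ) (V₀ : ℝ → ℝ) (d : ℕ) (t k : ℝ) : 0 ≤ epsK T₀ V₀ d t k := by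
  unfold epsK
  have := Real.pi_pos
  positivity

theorem epsK_le_two_pi {T₀ : ℝ} {V₀ : ℝ → ℝ} {d : ℕ} {t k : ℝ} (hV : IsUnitPotential V₀)
    (hd : 0 < d) (hk : |k| ≤ d) : epsK T₀ V₀ d t k ≤ 2 * Real.pi := by
  have hd' : (0 : ℝ) < d := by exact_mod_cast hd
  have hπ := Real.pi_pos
  rw [hV.epsK_eq]
  refine mul_le_of_le_one_right (by positivity) ?_
  set τ := t * (2 * Real.pi) / T₀
  obtain ⟨hk1, hk2⟩ := abs_le.1 hk
  set a := 2 * Real.pi * k / d with ha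
  have ha1 : a ≤ 2 * Real.pi := by
    rw [ha, div_le_iff₀ hd']
    exact mul_le_mul_of_nonneg_left hk2 (by positivity)
  have ha2 : -(2 * Real.pi) ≤ a := by
    rw [ha, le_div_iff₀ hd', neg_mul, ← mul_neg]
    exact mul_le_mul_of_nonneg_left hk1 (by positivity)
  rcases le_total 0 a with h | h
  · have h1 := hV.integral_nonneg h
    have h2 := hV.integral_le_one (u := 0) (v := a) (by linarith)
    have h3 := hV.integral_nonneg (u := τ) (v := τ + a) (by linarith)
    have h4 := hV.integral_le_one (u := τ) (v := τ + a) (by linarith)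
    rw [abs_le]; constructor <;> linarith
  · rw [intervalIntegral.integral_symm, intervalIntegral.integral_symm (τ + a)]
    have h1 := hV.integral_nonneg h
    have h2 := hV.integral_le_one (u := a) (v := 0) (by linarith)
    have h3 := hV.integral_nonneg (u := τ + a) (v := τ) (by linarith)
    have h4 := hV.integral_le_one (u := τ + a) (v := τ) (by linarith)
    rw [abs_le]; constructor <;> linarith

/-- The angle `τ` lies before or after the peak window. -/
def IsOffPeak (x₀ xvr γ τ : ℝ) : Prop :=
  (0 ≤ τ ∧ τ ≤ x₀ - xvr - Real.pi * γ) ∨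
    (x₀ + xvr + Real.pi * γ ≤ τ ∧ τ ≤ 2 * Real.pi + x₀ - xvr - Real.pi * γ)

theorem epsK_le_outsideMass {T₀ : ℝ} {V₀ : ℝ → ℝ} {d : ℕ} {t k x₀ xvr γ : ℝ}
    (hV : IsUnitPotential V₀) (hw : IsWindow x₀ xvr γ) (hd : 0 < d)
    (hτ : IsOffPeak x₀ xvr γ (t * (2 * Real.pi) / T₀)) (hk : |k| ≤ d * γ / 2) :
    epsK T₀ V₀ d t k ≤ 2 * Real.pi * outsideMass V₀ x₀ xvr := by
  have hd' : (0 : ℝ) < d := by exact_mod_cast hd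
  have hπ := Real.pi_pos
  obtain ⟨hx, hxπ, hγ, hγ1, hw1, hw2⟩ := hw
  rw [hV.epsK_eq]
  refine mul_le_mul_of_nonneg_left ?_ (by positivity)
  set τ := t * (2 * Real.pi) / T₀
  obtain ⟨hk1, hk2⟩ := abs_le.1 hk
  set a := 2 * Real.pi * k / d with ha
  have ha1 : a ≤ Real.pi * γ := by
    rw [ha, div_le_iff₀ hd']
    calc 2 * Real.pi * k ≤ 2 * Real.pi * (d * γ / 2) :=
          mul_le_mul_of_nonneg_left hk2 (by positivity)
      _ = _ := by ring
  have ha2 : -(Real.pi * γ) ≤ a := by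
    rw [ha, le_div_iff₀ hd']
    calc -(Real.pi * γ) * d = 2 * Real.pi * -(d * γ / 2) := by ring
      _ ≤ _ := mul_le_mul_of_nonneg_left hk1 (by positivity)
  have key : ∀ u v : ℝ, (u = τ ∧ v = τ + a ∨ u = τ + a ∧ v = τ) →
      ∫ x in u..v, V₀ x ≤ outsideMass V₀ x₀ xvr := by
    intro u v huv
    rcases hτ with ⟨h1, h2⟩ | ⟨h1, h2⟩
    · refine hV.integral_le_outsideMass ?_ ?_ <;> rcases huv with ⟨rfl, rfl⟩ | ⟨rfl, rfl⟩ <;>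
        linarith
    · rw [← hV.integral_sub_period]
      refine hV.integral_le_outsideMass ?_ ?_ <;> rcases huv with ⟨rfl, rfl⟩ | ⟨rfl, rfl⟩ <;>
        linarith
  rcases le_total 0 a with h | h
  · have h1 := hV.integral_nonneg h
    have h2 := hV.integral_le_outsideMass (x₀ := x₀) (xvr := xvr) (u := 0) (v := a)
      (by linarith) (by linarith)
    have h3 := hV.integral_nonneg (u := τ) (v := τ + a) (by linarith)
    have h4 := key _ _ (Or.inl ⟨rfl, rfl⟩)
    rw [abs_le]; constructor <;> linarith
  · rw [intervalIntegral.integral_symm, intervalIntegral.integral_symm (τ + a)]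
    have h1 := hV.integral_nonneg h
    have h2 := hV.integral_le_outsideMass (x₀ := x₀) (xvr := xvr) (u := a) (v := 0)
      (by linarith) (by linarith)
    have h3 := hV.integral_nonneg (u := τ + a) (v := τ) (by linarith)
    have h4 := key _ _ (Or.inr ⟨rfl, rfl⟩)
    rw [abs_le]; constructor <;> linarith

/-! ### Gaussian weights on shifted integers -/

theorem gaussWeight_neg (d : ℕ) (σ x : ℝ) : gaussWeight d σ (-x) = gaussWeight d σ x := by
  simp [gaussWeight]

theorem gaussWeight_le_of_le (d : ℕ) (σ : ℝ) {x y : ℝ} (hx : 0 ≤ x) (hxy : x ≤ y) :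
    gaussWeight d σ y ≤ gaussWeight d σ x := by
  unfold gaussWeight
  refine mul_le_mul_of_nonneg_left (Real.exp_le_exp.2 ?_) (by positivity)
  rw [neg_mul, neg_mul, neg_le_neg_iff]
  exact mul_le_mul_of_nonneg_left (pow_le_pow_left₀ hx hxy 2)
    (by have := Real.pi_pos; positivity)

theorem sum_gaussWeight_near_right_le {d : ℕ} (hd : 0 < d) (σ c : ℝ) (T : Finset ℤ)
    (hT : ∀ k ∈ T, 0 ≤ (k : ℝ) - c ∧ (k : ℝ) - c ≤ d / 2) :
    ∑ k ∈ T, gaussWeight d σ (k - c) ≤ 1 := by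
  have hd' : (0 : ℝ) < d := by exact_mod_cast hd
  have h1 : ∑ k ∈ centredIntegers d 0, gaussWeight d σ k = 1 := by
    have h := sum_gaussWeight hd σ 0
    rw [div_self (gaussSum_zero_pos hd σ).ne'] at h
    simpa using h
  rw [← h1]
  calc ∑ k ∈ T, gaussWeight d σ (k - c) ≤ ∑ k ∈ T, gaussWeight d σ (⌊(k : ℝ) - c⌋ : ℤ) := by
        refine Finset.sum_le_sum fun k hk => gaussWeight_le_of_le d σ ?_ (Int.floor_le _)
        exact_mod_cast Int.floor_nonneg.2 (hT k hk).1
    _ = ∑ m ∈ T.image fun k : ℤ => ⌊(k : ℝ) - c⌋, gaussWeight d σ m := by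
        rw [Finset.sum_image]
        intro k _ l _ hkl
        have e : ∀ k : ℤ, ⌊(k : ℝ) - c⌋ = k + ⌊-c⌋ := fun k => by
          rw [sub_eq_add_neg, Int.floor_intCast_add]
        simp only [e] at hkl
        omega
    _ ≤ _ := by
        refine Finset.sum_le_sum_of_subset_of_nonneg ?_ fun k _ _ => gaussWeight_nonneg d σ k
        intro m hm
        obtain ⟨k, hk, rfl⟩ := Finset.mem_image.1 hm
        have h0 : (0 : ℝ) ≤ (⌊(k : ℝ) - c⌋ : ℤ) := by
          exact_mod_cast Int.floor_nonneg.2 (hT k hk).1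
        have h2 := Int.floor_le ((k : ℝ) - c)
        have h3 := (hT k hk).2
        rw [mem_centredIntegers]
        constructor <;> linarith

/-- A sum over shifted integers is controlled by its two one-sided parts. -/
theorem sum_le_two_mul_of_one_sided {f : ℝ → ℝ} {P : ℝ → Prop} {M : ℝ} (hf : ∀ x, f (-x) = f x)
    (h : ∀ (c : ℝ) (T : Finset ℤ), (∀ k ∈ T, 0 ≤ (k : ℝ) - c ∧ P |(k : ℝ) - c|) →
      ∑ k ∈ T, f (k - c) ≤ M) (c : ℝ) (T : Finset ℤ) (hT : ∀ k ∈ T, P |(k : ℝ) - c|) :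
    ∑ k ∈ T, f (k - c) ≤ 2 * M := by
  classical
  rw [← Finset.sum_filter_add_sum_filter_not T (fun k : ℤ => 0 ≤ (k : ℝ) - c), two_mul]
  refine add_le_add (h c _ fun k hk => ?_) ?_
  · rw [Finset.mem_filter] at hk
    exact ⟨hk.2, hT k hk.1⟩
  · have e : ∑ k ∈ T.filter fun k : ℤ => ¬0 ≤ (k : ℝ) - c, f (k - c) =
        ∑ k ∈ (T.filter fun k : ℤ => ¬0 ≤ (k : ℝ) - c).image (fun k : ℤ => -k), f (k - -c) := by
      rw [Finset.sum_image fun k _ l _ hkl => neg_injective hkl]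
      refine Finset.sum_congr rfl fun k _ => ?_
      rw [← hf]
      congr 1
      push_cast
      ring
    rw [e]
    refine h _ _ fun k hk => ?_
    obtain ⟨l, hl, rfl⟩ := Finset.mem_image.1 hk
    rw [Finset.mem_filter, not_le] at hl
    have e2 : ((-l : ℤ) : ℝ) - -c = -((l : ℝ) - c) := by push_cast; ring
    rw [e2, abs_neg]
    exact ⟨by linarith [hl.2], hT l hl.1⟩

theorem sum_gaussWeight_near_le {d : ℕ} (hd : 0 < d) (σ c : ℝ) (T : Finset ℤ)
    (hT : ∀ k ∈ T, |(k : ℝ) - c| ≤ d / 2) : ∑ k ∈ T, gaussWeight d σ (k - c) ≤ 2 := by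
  have h := sum_le_two_mul_of_one_sided (f := gaussWeight d σ) (P := fun x => x ≤ d / 2) (M := 1)
    (gaussWeight_neg d σ) (fun c T hT => sum_gaussWeight_near_right_le hd σ c T fun k hk =>
      ⟨(hT k hk).1, (le_abs_self _).trans (hT k hk).2⟩) c T hT
  linarith

/-- The geometric bound on the Gaussian weights at distance at least `q` from the centre. -/
noncomputable def geomTail (d : ℕ) (σ q : ℝ) : ℝ :=
  normConst d σ 0 ^ 2 * (Real.exp (-(2 * Real.pi / σ ^ 2 * q ^ 2)) /
    (1 - Real.exp (-(4 * Real.pi / σ ^ 2 * q))))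

theorem sum_gaussWeight_far_right_le {d : ℕ} {σ q : ℝ} (hσ : 0 < σ) (hq : 0 < q) (c : ℝ)
    (T : Finset ℤ) (hT : ∀ k ∈ T, 0 ≤ (k : ℝ) - c ∧ q + 1 < |(k : ℝ) - c|) :
    ∑ k ∈ T, gaussWeight d σ (k - c) ≤ geomTail d σ q := by
  have hπ := Real.pi_pos
  set a := 2 * Real.pi / σ ^ 2 with ha
  have ha0 : 0 < a := by positivity
  set r := Real.exp (-(4 * Real.pi / σ ^ 2 * q)) with hr
  have hr1 : r < 1 := Real.exp_lt_one_iff.2 (by rw [neg_lt_zero]; positivity)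
  have hr0 : 0 ≤ r := (Real.exp_pos _).le
  set k₀ : ℤ := ⌊c + q⌋ + 1 with hk0
  have hk0' : c + q < k₀ := by rw [hk0]; push_cast; exact Int.lt_floor_add_one _
  have hk0'' : (k₀ : ℝ) ≤ c + q + 1 := by
    rw [hk0]; push_cast; linarith [Int.floor_le (c + q)]
  have hmem : ∀ k ∈ T, k₀ ≤ k := by
    intro k hk
    obtain ⟨h1, h2⟩ := hT k hk
    rw [abs_of_nonneg h1] at h2
    have : (k₀ : ℝ) < k := by linarith
    exact_mod_cast this.le
  have hterm : ∀ k ∈ T, gaussWeight d σ (k - c) ≤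
      normConst d σ 0 ^ 2 * (Real.exp (-(a * q ^ 2)) * r ^ (k - k₀).toNat) := by
    intro k hk
    have hm : (((k - k₀).toNat : ℕ) : ℝ) = (k : ℝ) - k₀ := by
      have : (((k - k₀).toNat : ℤ)) = k - k₀ := Int.toNat_of_nonneg (by linarith [hmem k hk])
      exact_mod_cast this
    have hm0 : (0 : ℝ) ≤ (k : ℝ) - k₀ := by rw [← hm]; positivity
    unfold gaussWeight
    refine mul_le_mul_of_nonneg_left ?_ (by positivity)
    rw [hr, ← Real.exp_nat_mul, ← Real.exp_add, hm]
    refine Real.exp_le_exp.2 ?_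
    have e : 4 * Real.pi / σ ^ 2 = 2 * a := by rw [ha]; ring
    rw [e]
    have h1 : (q + (k - k₀)) ^ 2 ≤ ((k : ℝ) - c) ^ 2 :=
      pow_le_pow_left₀ (by linarith) (by linarith) 2
    have h2 : q ^ 2 + 2 * q * (k - k₀) ≤ ((k : ℝ) - c) ^ 2 := by
      nlinarith [sq_nonneg ((k : ℝ) - k₀)]
    have h3 := mul_le_mul_of_nonneg_left h2 ha0.le
    linarith
  refine (Finset.sum_le_sum hterm).trans ?_
  rw [← Finset.mul_sum, ← Finset.mul_sum, geomTail, ← hr, div_eq_mul_inv]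
  refine mul_le_mul_of_nonneg_left (mul_le_mul_of_nonneg_left ?_ (Real.exp_pos _).le)
    (by positivity)
  rw [← tsum_geometric_of_lt_one hr0 hr1]
  calc ∑ k ∈ T, r ^ (k - k₀).toNat = ∑ m ∈ T.image fun k => (k - k₀).toNat, r ^ m := by
        rw [Finset.sum_image]
        intro k hk l hl hkl
        have := hmem k hk
        have := hmem l hl
        have hkl' : (k - k₀).toNat = (l - k₀).toNat := hkl
        omega
    _ ≤ _ := (summable_geometric_of_lt_one hr0 hr1).sum_le_tsum _ fun m _ => pow_nonneg hr0 m

theorem sum_gaussWeight_far_le {d : ℕ} {σ q : ℝ} (hσ : 0 < σ) (hq : 0 < q) (c : ℝ)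
    (T : Finset ℤ) (hT : ∀ k ∈ T, q + 1 < |(k : ℝ) - c|) :
    ∑ k ∈ T, gaussWeight d σ (k - c) ≤ 2 * geomTail d σ q :=
  sum_le_two_mul_of_one_sided (P := fun x => q + 1 < x) (gaussWeight_neg d σ)
    (sum_gaussWeight_far_right_le hσ hq) c T hT

theorem sum_mul_gaussWeight_le {d : ℕ} {σ q γ M₁ M₂ : ℝ} {f : ℝ → ℝ} (hd : 0 < d) (hσ : 0 < σ)
    (hq : 0 < q) (hqγ : q + 1 = d * γ / 2) (hγ : γ ≤ 1) (hM₁ : 0 ≤ M₁) (hM₂ : 0 ≤ M₂)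
    (c : ℝ) (T : Finset ℤ)
    (h₁ : ∀ k ∈ T, |(k : ℝ) - c| ≤ d * γ / 2 → f (k - c) ≤ M₁) (h₂ : ∀ k ∈ T, f (k - c) ≤ M₂) :
    ∑ k ∈ T, f (k - c) * gaussWeight d σ (k - c) ≤ 2 * M₁ + 2 * M₂ * geomTail d σ q := by
  classical
  have hd' : (0 : ℝ) < d := by exact_mod_cast hd
  rw [← Finset.sum_filter_add_sum_filter_not T (fun k : ℤ => |(k : ℝ) - c| ≤ d * γ / 2)]
  have hdγ : (d : ℝ) * γ / 2 ≤ d / 2 := by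
    have := mul_le_mul_of_nonneg_left hγ hd'.le
    linarith
  refine add_le_add ?_ ?_
  · calc _ ≤ ∑ k ∈ T.filter fun k : ℤ => |(k : ℝ) - c| ≤ d * γ / 2, M₁ * gaussWeight d σ (k - c) := by
          refine Finset.sum_le_sum fun k hk => ?_
          rw [Finset.mem_filter] at hk
          exact mul_le_mul_of_nonneg_right (h₁ k hk.1 hk.2) (gaussWeight_nonneg d σ _)
      _ ≤ _ := by
          rw [← Finset.mul_sum, mul_comm 2]
          refine mul_le_mul_of_nonneg_left (sum_gaussWeight_near_le hd σ c _ fun k hk => ?_) hM₁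
          exact (Finset.mem_filter.1 hk).2.trans hdγ
  · calc _ ≤ ∑ k ∈ T.filter fun k : ℤ => ¬|(k : ℝ) - c| ≤ d * γ / 2, M₂ * gaussWeight d σ (k - c) := by
          refine Finset.sum_le_sum fun k hk => ?_
          rw [Finset.mem_filter] at hk
          exact mul_le_mul_of_nonneg_right (h₂ k hk.1) (gaussWeight_nonneg d σ _)
      _ ≤ _ := by
          rw [← Finset.mul_sum, mul_comm 2, mul_assoc]
          refine mul_le_mul_of_nonneg_left (sum_gaussWeight_far_le hσ hq c _ fun k hk => ?_) hM₂
          rw [hqγ]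
          exact not_le.1 (Finset.mem_filter.1 hk).2

theorem exists_sqrt_kappaTilde {d : ℕ} {γ : ℝ} (hd : 0 < d) (hκ : 0 < kappaTilde d γ) :
    0 < (d : ℝ) * Real.sqrt (kappaTilde d γ) ∧
      (d : ℝ) * Real.sqrt (kappaTilde d γ) + 1 = d * γ / 2 := by
  have hd' : (0 : ℝ) < d := by exact_mod_cast hd
  refine ⟨mul_pos hd' (Real.sqrt_pos.2 hκ), ?_⟩
  unfold kappaTilde at hκ ⊢
  split_ifs at hκ ⊢ with h
  · exact absurd hκ (lt_irrefl 0)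
  · rw [Real.sqrt_sq]
    · field_simp; ring
    · rw [sub_nonneg, div_le_div_iff₀ hd' two_pos]
      linarith [not_le.1 h]

theorem geomTail_kappaTilde {d : ℕ} (σ : ℝ) {γ : ℝ} :
    normConst d σ 0 ^ 2 * (Real.exp (-(2 * Real.pi * kappaTilde d γ * (d ^ 2 / σ ^ 2))) /
      (1 - Real.exp (-(4 * Real.pi * Real.sqrt (kappaTilde d γ) * d / σ ^ 2)))) =
      geomTail d σ (d * Real.sqrt (kappaTilde d γ)) := by
  have h : 0 ≤ kappaTilde d γ := by unfold kappaTilde; split_ifs <;> positivity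
  unfold geomTail
  rw [mul_pow, Real.sq_sqrt h,
    show 2 * Real.pi / σ ^ 2 * (d ^ 2 * kappaTilde d γ) =
      2 * Real.pi * kappaTilde d γ * (d ^ 2 / σ ^ 2) by ring,
    show 4 * Real.pi / σ ^ 2 * (d * Real.sqrt (kappaTilde d γ)) =
      4 * Real.pi * Real.sqrt (kappaTilde d γ) * d / σ ^ 2 by ring]

theorem epsVBound_eq (d : ℕ) (σ γ ε : ℝ) :
    epsVBound d σ γ ε = 4 * Real.pi * ((1 + 2 * Real.pi) *
      geomTail d σ (d * Real.sqrt (kappaTilde d γ)) + 2 * ε * (1 + 8 * Real.pi * ε)) := by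
  unfold epsVBound
  rw [← geomTail_kappaTilde]
  ring

theorem geomTail_nonneg (d : ℕ) {σ q : ℝ} (hq : 0 ≤ q) : 0 ≤ geomTail d σ q := by
  unfold geomTail
  have hπ := Real.pi_pos
  have : Real.exp (-(4 * Real.pi / σ ^ 2 * q)) ≤ 1 := Real.exp_le_one_iff.2 (by
    rw [neg_nonpos]; positivity)
  refine mul_nonneg (by positivity) (div_nonneg (Real.exp_pos _).le (by linarith))

/-! ### The error `ε_V` -/

theorem norm_sq_psiNor {d : ℕ} (hd : 0 < d) (σ n₀ x : ℝ) :
    ‖psiNor d σ n₀ 0 x‖ ^ 2 = gaussWeight d σ x := by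
  unfold psiNor gaussWeight
  rw [norm_mul, mul_comm Complex.I, Complex.norm_exp_ofReal_mul_I, mul_one, Complex.norm_real,
    Real.norm_of_nonneg (mul_nonneg (normConst_pos hd σ).le (Real.exp_pos _).le), mul_pow,
    ← Real.exp_nat_mul]
  congr 2
  push_cast
  ring

/-- The sum over `d + 1` shifted positions whose supremum is `ε_V`. -/
noncomputable def epsVSum (T₀ : ℝ) (V₀ : ℝ → ℝ) (d : ℕ) (σ t s : ℝ) : ℝ :=
  ∑ k ∈ Finset.Icc (0 : ℤ) d, (epsK T₀ V₀ d t (k - (d / 2 - s)) ^ 2 +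
    epsK T₀ V₀ d t (k - (d / 2 - s))) * gaussWeight d σ (k - (d / 2 - s))

theorem epsV_eq_sSup {d : ℕ} (hd : 0 < d) (T₀ : ℝ) (V₀ : ℝ → ℝ) (σ n₀ t : ℝ) :
    epsV T₀ V₀ d σ n₀ 0 t = sSup (epsVSum T₀ V₀ d σ t '' Set.Icc (0 : ℝ) 1) := by
  unfold epsV
  congr 2
  funext s
  unfold epsVSum
  rw [show Finset.Icc (0 : ℤ) d = (Finset.range (d + 1)).image (fun j : ℕ => (j : ℤ)) from ?_,
    Finset.sum_image fun i _ j _ h => by exact_mod_cast h]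
  · refine Finset.sum_congr rfl fun j _ => ?_
    rw [norm_sq_psiNor hd]
    have e : 0 - (d : ℝ) / 2 + s + j = ((j : ℤ) : ℝ) - (d / 2 - s) := by push_cast; ring
    rw [e]
  · ext k
    rw [Finset.mem_Icc, Finset.mem_image]
    constructor
    · rintro ⟨h1, h2⟩
      exact ⟨k.toNat, by rw [Finset.mem_range]; omega, by omega⟩
    · rintro ⟨j, hj, rfl⟩
      rw [Finset.mem_range] at hj
      omega

theorem abs_intCast_sub_le_of_mem_Icc {d : ℕ} (hd : 2 ≤ d) {k : ℤ} (hk : k ∈ Finset.Icc (0 : ℤ) d)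
    {s : ℝ} (hs : s ∈ Set.Icc (0 : ℝ) 1) : |(k : ℝ) - (d / 2 - s)| ≤ d := by
  have hd' : (2 : ℝ) ≤ d := by exact_mod_cast hd
  rw [Finset.mem_Icc] at hk
  have h1 : (0 : ℝ) ≤ k := by exact_mod_cast hk.1
  have h2 : (k : ℝ) ≤ d := by exact_mod_cast hk.2
  rw [abs_le]
  constructor <;> linarith [hs.1, hs.2]

theorem bddAbove_epsVSum {T₀ : ℝ} {V₀ : ℝ → ℝ} {d : ℕ} {σ : ℝ} (hV : IsUnitPotential V₀)
    (hd : 2 ≤ d) (t : ℝ) : BddAbove (epsVSum T₀ V₀ d σ t '' Set.Icc (0 : ℝ) 1) := by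
  refine ⟨∑ k ∈ Finset.Icc (0 : ℤ) d, ((2 * Real.pi) ^ 2 + 2 * Real.pi) * normConst d σ 0 ^ 2, ?_⟩
  rintro _ ⟨s, hs, rfl⟩
  refine Finset.sum_le_sum fun k hk => ?_
  have h1 := epsK_le_two_pi (T₀ := T₀) (t := t) hV (by omega)
    (abs_intCast_sub_le_of_mem_Icc hd hk hs)
  have h0 := epsK_nonneg T₀ V₀ d t (k - (d / 2 - s))
  refine mul_le_mul (add_le_add (pow_le_pow_left₀ h0 h1 2) h1) ?_ (gaussWeight_nonneg d σ _)
    (by have := Real.pi_pos; positivity)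
  unfold gaussWeight
  refine mul_le_of_le_one_right (by positivity) (Real.exp_le_one_iff.2 ?_)
  rw [neg_mul, neg_nonpos]
  have := Real.pi_pos
  positivity

theorem epsV_le_epsVBound {T₀ : ℝ} {V₀ : ℝ → ℝ} {d : ℕ} {σ n₀ x₀ xvr γ t : ℝ} (hd : 2 ≤ d)
    (hσ : 0 < σ) (hV : IsUnitPotential V₀) (hw : IsWindow x₀ xvr γ) (hκ : 0 < kappaTilde d γ)
    (hτ : IsOffPeak x₀ xvr γ (t * (2 * Real.pi) / T₀)) :
    epsV T₀ V₀ d σ n₀ 0 t ≤ epsVBound d σ γ (outsideMass V₀ x₀ xvr) := by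
  have hd0 : 0 < d := by omega
  have hπ := Real.pi_pos
  rw [epsV_eq_sSup hd0]
  refine csSup_le ((Set.nonempty_Icc.2 zero_le_one).image _) ?_
  rintro _ ⟨s, hs, rfl⟩
  obtain ⟨hq, hqγ⟩ := exists_sqrt_kappaTilde hd0 hκ
  set ε := outsideMass V₀ x₀ xvr with hε
  have hε0 : 0 ≤ ε := hV.outsideMass_nonneg hw.2.1
  have h := sum_mul_gaussWeight_le (σ := σ) (γ := γ) (M₁ := (2 * Real.pi * ε) ^ 2 + 2 * Real.pi * ε)
    (M₂ := (2 * Real.pi) ^ 2 + 2 * Real.pi)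
    (f := fun x => epsK T₀ V₀ d t x ^ 2 + epsK T₀ V₀ d t x)
    hd0 hσ hq hqγ hw.2.2.2.1 (by positivity) (by positivity) (d / 2 - s) (Finset.Icc (0 : ℤ) d)
    (fun k hk hk' => by
      have h1 := epsK_le_outsideMass hV hw hd0 hτ hk'
      exact add_le_add (pow_le_pow_left₀ (epsK_nonneg ..) h1 2) h1)
    (fun k hk => by
      have h1 := epsK_le_two_pi (T₀ := T₀) (t := t) hV hd0 (abs_intCast_sub_le_of_mem_Icc hd hk hs)
      exact add_le_add (pow_le_pow_left₀ (epsK_nonneg ..) h1 2) h1)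
  refine h.trans ?_
  rw [epsVBound_eq]
  have e : 4 * Real.pi * (2 * ε * (1 + 8 * Real.pi * ε)) -
      2 * ((2 * Real.pi * ε) ^ 2 + 2 * Real.pi * ε) =
      4 * Real.pi * ε + 56 * Real.pi ^ 2 * ε ^ 2 := by ring
  have e0 : 0 ≤ 4 * Real.pi * ε + 56 * Real.pi ^ 2 * ε ^ 2 := by positivity
  linarith

/-- The sum bounding the deviation of the accumulated phases is at most `ε_V`. -/
theorem sum_epsK_le_epsV {T₀ : ℝ} {V₀ : ℝ → ℝ} {d : ℕ} (σ n₀ : ℝ) (hd : 2 ≤ d)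
    (hV : IsUnitPotential V₀) (t κ : ℝ) :
    ∑ k ∈ centredIntegers d κ, epsK T₀ V₀ d t (k - κ) * gaussWeight d σ (k - κ) ≤
      epsV T₀ V₀ d σ n₀ 0 t := by
  have hd0 : 0 < d := by omega
  rw [epsV_eq_sSup hd0]
  set m : ℤ := ⌊κ - (d : ℝ) / 2⌋ with hm
  set s : ℝ := m + 1 - (κ - d / 2) with hs
  have hs1 : s ∈ Set.Icc (0 : ℝ) 1 := by
    constructor <;> rw [hs]
    · linarith [Int.lt_floor_add_one (κ - (d : ℝ) / 2)]
    · linarith [Int.floor_le (κ - (d : ℝ) / 2)]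
  refine le_trans ?_ (le_csSup (bddAbove_epsVSum hV hd t) ⟨s, hs1, rfl⟩)
  unfold epsVSum
  have e : ∀ k : ℤ, (k : ℝ) - κ = ((k - (m + 1) : ℤ) : ℝ) - (d / 2 - s) := by
    intro k; rw [hs]; push_cast; ring
  have hinj : Set.InjOn (fun k : ℤ => k - (m + 1)) (centredIntegers d κ) := by
    intro k _ l _ h
    have h' : k - (m + 1) = l - (m + 1) := h
    omega
  calc _ = ∑ l ∈ (centredIntegers d κ).image (fun k : ℤ => k - (m + 1)),
        epsK T₀ V₀ d t (l - (d / 2 - s)) * gaussWeight d σ (l - (d / 2 - s)) := by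
        rw [Finset.sum_image hinj]
        refine Finset.sum_congr rfl fun k _ => ?_
        rw [e k]
    _ ≤ ∑ l ∈ (centredIntegers d κ).image (fun k : ℤ => k - (m + 1)),
        (epsK T₀ V₀ d t (l - (d / 2 - s)) ^ 2 + epsK T₀ V₀ d t (l - (d / 2 - s))) *
          gaussWeight d σ (l - (d / 2 - s)) := by
        refine Finset.sum_le_sum fun k _ => ?_
        refine mul_le_mul_of_nonneg_right ?_ (gaussWeight_nonneg d σ _)
        have := sq_nonneg (epsK T₀ V₀ d t (k - (d / 2 - s)))
        linarith
    _ ≤ _ := by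
        refine Finset.sum_le_sum_of_subset_of_nonneg ?_ fun k _ _ =>
          mul_nonneg (add_nonneg (sq_nonneg _) (epsK_nonneg ..)) (gaussWeight_nonneg d σ _)
        intro l hl
        obtain ⟨k, hk, rfl⟩ := Finset.mem_image.1 hl
        have h1 := (mem_centredIntegers d κ k).1 hk
        unfold centredIntegers at hk
        rw [Finset.mem_Ioc, ← hm] at hk
        rw [Finset.mem_Icc]
        refine ⟨by omega, ?_⟩
        have h2 : ((k - (m + 1) : ℤ) : ℝ) ≤ d := by
          push_cast
          linarith [h1.1, hs1.1]
        exact_mod_cast h2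

theorem sum_epsK_add_le_epsVBound {T₀ : ℝ} {V₀ : ℝ → ℝ} {d : ℕ} {σ x₀ xvr γ t : ℝ} (hd : 2 ≤ d)
    (hσ : 0 < σ) (hV : IsUnitPotential V₀) (hw : IsWindow x₀ xvr γ) (hκ : 0 < kappaTilde d γ)
    (hτ : IsOffPeak x₀ xvr γ (t * (2 * Real.pi) / T₀)) (κ : ℝ) :
    ∑ k ∈ centredIntegers d κ, epsK T₀ V₀ d t (k - κ) * gaussWeight d σ (k - κ) +
      2 * Real.pi * outsideMass V₀ x₀ xvr ≤ epsVBound d σ γ (outsideMass V₀ x₀ xvr) := by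
  have hd0 : 0 < d := by omega
  have hd' : (0 : ℝ) < d := by exact_mod_cast hd0
  have hπ := Real.pi_pos
  obtain ⟨hq, hqγ⟩ := exists_sqrt_kappaTilde hd0 hκ
  set ε := outsideMass V₀ x₀ xvr with hε
  have hε0 : 0 ≤ ε := hV.outsideMass_nonneg hw.2.1
  have h := sum_mul_gaussWeight_le (σ := σ) (γ := γ) (M₁ := 2 * Real.pi * ε)
    (M₂ := 2 * Real.pi) (f := fun x => epsK T₀ V₀ d t x)
    hd0 hσ hq hqγ hw.2.2.2.1 (by positivity) (by positivity) κ (centredIntegers d κ)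
    (fun k hk hk' => epsK_le_outsideMass hV hw hd0 hτ hk')
    (fun k hk => epsK_le_two_pi (T₀ := T₀) (t := t) hV hd0 (by
      rw [mem_centredIntegers] at hk
      rw [abs_le]
      constructor <;> linarith [hk.1, hk.2]))
  rw [epsVBound_eq]
  have hg := geomTail_nonneg d (σ := σ) hq.le
  have e1 : 0 ≤ 8 * Real.pi ^ 2 * geomTail d σ (d * Real.sqrt (kappaTilde d γ)) := by positivity
  have e2 : 0 ≤ 2 * Real.pi * ε + 64 * Real.pi ^ 2 * ε ^ 2 := by positivity
  nlinarith [h, e1, e2]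

end QuantumClock

namespace QuantumClock

/-! ### The trace norm bound -/

theorem IsPulse.integral_eq_zero_of_le {g : ℝ → ℝ} {tᵢ t_f t : ℝ} (hg : IsPulse g tᵢ t_f)
    (ht : t ≤ tᵢ) : ∫ x in tᵢ..t, g x = 0 := by
  rw [intervalIntegral.integral_symm, intervalIntegral.integral_of_le ht,
    MeasureTheory.integral_Ioc_eq_integral_Ioo,
    MeasureTheory.setIntegral_eq_zero_of_forall_eq_zero, neg_zero]
  exact fun x hx => hg.2.2.1 x fun h => absurd hx.2 (not_lt.2 h.1)

theorem IsPulse.integral_eq_one_of_le {g : ℝ → ℝ} {tᵢ t_f t : ℝ} (hg : IsPulse g tᵢ t_f)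
    (ht : t_f ≤ t) : ∫ x in tᵢ..t, g x = 1 := by
  have h1 := intervalIntegral.integral_add_adjacent_intervals
    (hg.1.intervalIntegrable (a := tᵢ) (b := t_f)) (hg.1.intervalIntegrable (a := t_f) (b := t))
  have h2 : ∫ x in t_f..t, g x = 0 := by
    rw [intervalIntegral.integral_of_le ht]
    exact MeasureTheory.setIntegral_eq_zero_of_forall_eq_zero fun x hx =>
      hg.2.2.1 x fun h => absurd hx.1 (not_lt.2 h.2)
  rw [← h1, h2, hg.2.2.2, add_zero]

/-- The times before the beginning and after the end of the peak window within one period. -/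
theorem off_peak_of_mem {T₀ x₀ xvr γ t : ℝ} (hT₀ : 0 < T₀) (hw : IsWindow x₀ xvr γ)
    (ht : t ∈ Set.Icc 0 (startTime T₀ x₀ xvr γ) ∪ Set.Icc (stopTime T₀ x₀ xvr γ) T₀) :
    0 ≤ t ∧ (t ≤ startTime T₀ x₀ xvr γ ∧ 0 ≤ t * (2 * Real.pi) / T₀ ∧
        t * (2 * Real.pi) / T₀ ≤ x₀ - xvr - Real.pi * γ ∨
      stopTime T₀ x₀ xvr γ ≤ t ∧ x₀ + xvr + Real.pi * γ ≤ t * (2 * Real.pi) / T₀ ∧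
        t * (2 * Real.pi) / T₀ ≤ 2 * Real.pi) := by
  have hπ := Real.pi_pos
  obtain ⟨hx, hxπ, hγ, hγ1, hw1, hw2⟩ := hw
  rcases ht with ht | ht
  · refine ⟨ht.1, Or.inl ⟨ht.2, by have := ht.1; positivity, ?_⟩⟩
    have h := ht.2
    unfold startTime at h
    rw [le_div_iff₀ (by positivity)] at h
    rw [div_le_iff₀ hT₀]
    linarith
  · have h := ht.1
    have h0 : 0 ≤ stopTime T₀ x₀ xvr γ := by
      unfold stopTime
      have : 0 ≤ x₀ := le_trans (by positivity) hw1
      positivity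
    refine ⟨h0.trans ht.1, Or.inr ⟨h, ?_, ?_⟩⟩
    · unfold stopTime at h
      rw [div_le_iff₀ (by positivity)] at h
      rw [le_div_iff₀ hT₀]
      linarith
    · rw [div_le_iff₀ hT₀, mul_comm (2 * Real.pi)]
      exact mul_le_mul_of_nonneg_right ht.2 (by positivity)

theorem abs_integral_sub_pulse_le {T₀ : ℝ} {V₀ : ℝ → ℝ} {x₀ xvr γ t : ℝ} {g : ℝ → ℝ}
    (hT₀ : 0 < T₀) (hV : IsUnitPotential V₀) (hw : IsWindow x₀ xvr γ)
    (hg : IsPulse g (startTime T₀ x₀ xvr γ) (stopTime T₀ x₀ xvr γ))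
    (ht : t ∈ Set.Icc 0 (startTime T₀ x₀ xvr γ) ∪ Set.Icc (stopTime T₀ x₀ xvr γ) T₀) :
    |(∫ x in (0 : ℝ)..(t * (2 * Real.pi) / T₀), V₀ x) - ∫ x in (startTime T₀ x₀ xvr γ)..t, g x| ≤
      outsideMass V₀ x₀ xvr := by
  have hπ := Real.pi_pos
  have h := (off_peak_of_mem hT₀ hw ht).2
  obtain ⟨hx, hxπ, hγ, hγ1, hw1, hw2⟩ := hw
  have hπγ : 0 < Real.pi * γ := by positivity
  set τ := t * (2 * Real.pi) / T₀
  rcases h with ⟨h1, h2, h3⟩ | ⟨h1, h2, h3⟩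
  · rw [hg.integral_eq_zero_of_le h1, sub_zero, abs_of_nonneg (hV.integral_nonneg h2)]
    exact hV.integral_le_outsideMass (by linarith) (by linarith)
  · have h4 := hV.integral_add_integral 0 τ (2 * Real.pi)
    rw [hV.integral_eq_one] at h4
    have h5 := hV.integral_nonneg h3
    have h6 : ∫ x in τ..(2 * Real.pi), V₀ x ≤ outsideMass V₀ x₀ xvr := by
      rw [← hV.integral_sub_period]
      exact hV.integral_le_outsideMass (by linarith) (by linarith)
    rw [hg.integral_eq_one_of_le h1, abs_le]
    constructor <;> linarith

theorem traceNorm_le_sum_epsK {T₀ : ℝ} {V₀ : ℝ → ℝ} {d : ℕ} {σ n₀ b t : ℝ} {x₀ xvr γ : ℝ}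
    {g : ℝ → ℝ} {dS : ℕ} {Hs Hint ρ : Matrix (Fin dS) (Fin dS) ℂ}
    (hT₀ : 0 < T₀) (hσ : 0 < σ) (hσd : σ < d) (hn₀ : 0 < n₀) (hn₀' : n₀ < (d : ℝ) - 1)
    (hV : IsPeakedPotential V₀ x₀) (hw : IsWindow x₀ xvr γ)
    (hb : IsDerivBound (fun x => Real.pi * V₀ x) b) (hsys : IsSystem Hs Hint ρ)
    (hg : IsPulse g (startTime T₀ x₀ xvr γ) (stopTime T₀ x₀ xvr γ))
    (ht : t ∈ Set.Icc 0 (startTime T₀ x₀ xvr γ) ∪ Set.Icc (stopTime T₀ x₀ xvr γ) T₀) :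
    traceNorm (pulseState g (startTime T₀ x₀ xvr γ) Hs Hint ρ t -
        autonomousState T₀ V₀ d σ n₀ Hs Hint ρ t) ≤
      systemFactor ρ * (2 * epsClock T₀ d σ (alphaZero d n₀) b t +
        epsClock T₀ d σ (alphaZero d n₀) b t ^ 2 +
        (∑ k ∈ centredIntegers d (d / T₀ * t),
          epsK T₀ V₀ d t (k - d / T₀ * t) * gaussWeight d σ (k - d / T₀ * t) +
        2 * Real.pi * outsideMass V₀ x₀ xvr)) := by
  have hd : 2 ≤ d := by
    have : (1 : ℝ) < d := by linarith
    exact_mod_cast this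
  have hU := hV.isUnitPotential
  set s := startTime T₀ x₀ xvr γ with hs
  have key : ∀ Ω Ω' : ℝ, |Ω| ≤ Real.pi → |Ω'| ≤ Real.pi →
      ‖star ((evolution t (sectorHamiltonian T₀ V₀ d Ω')).mulVec (clockState d σ n₀ 0)) ⬝ᵥ
        (evolution t (sectorHamiltonian T₀ V₀ d Ω)).mulVec (clockState d σ n₀ 0) -
      Complex.exp (-(Complex.I * (((Ω - Ω') * (∫ x in s..t, g x) : ℝ) : ℂ)))‖ ≤ _ :=
    fun Ω Ω' hΩ hΩ' => (norm_overlap_sub_le hT₀ hd hσ hσd hn₀ hn₀' hV.1 hV.2.1 hV.2.2.2.1 hb hΩ hΩ'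
      (off_peak_of_mem hT₀ hw ht).1 _).trans (add_le_add le_rfl (add_le_add le_rfl
        (mul_le_mul_of_nonneg_left (abs_integral_sub_pulse_le hT₀ hU hw hg ht)
          (by have := Real.pi_pos; positivity))))
  have hη := (norm_nonneg _).trans (key 0 0 (by simp [Real.pi_pos.le]) (by simp [Real.pi_pos.le]))
  exact traceNorm_pulse_sub_autonomous_le hsys hη key

theorem systemFactor_nonneg {dS : ℕ} (ρ : Matrix (Fin dS) (Fin dS) ℂ) : 0 ≤ systemFactor ρ :=
  Real.sqrt_nonneg _

theorem isOffPeak_of_mem {T₀ x₀ xvr γ t : ℝ} (hT₀ : 0 < T₀) (hw : IsWindow x₀ xvr γ)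
    (ht : t ∈ Set.Icc 0 (startTime T₀ x₀ xvr γ) ∪ Set.Icc (stopTime T₀ x₀ xvr γ) T₀) :
    IsOffPeak x₀ xvr γ (t * (2 * Real.pi) / T₀) := by
  rcases (off_peak_of_mem hT₀ hw ht).2 with h | h
  · exact Or.inl h.2
  · exact Or.inr ⟨h.2.1, h.2.2.trans (by linarith [hw.2.2.2.2.1])⟩

theorem traceNorm_le_epsV {T₀ : ℝ} {V₀ : ℝ → ℝ} {d : ℕ} {σ n₀ b t : ℝ} {x₀ xvr γ : ℝ}
    {g : ℝ → ℝ} {dS : ℕ} {Hs Hint ρ : Matrix (Fin dS) (Fin dS) ℂ}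
    (hT₀ : 0 < T₀) (hσ : 0 < σ) (hσd : σ < d) (hn₀ : 0 < n₀) (hn₀' : n₀ < (d : ℝ) - 1)
    (hV : IsPeakedPotential V₀ x₀) (hw : IsWindow x₀ xvr γ)
    (hb : IsDerivBound (fun x => Real.pi * V₀ x) b) (hsys : IsSystem Hs Hint ρ)
    (hg : IsPulse g (startTime T₀ x₀ xvr γ) (stopTime T₀ x₀ xvr γ))
    (ht : t ∈ Set.Icc 0 (startTime T₀ x₀ xvr γ) ∪ Set.Icc (stopTime T₀ x₀ xvr γ) T₀) :
    traceNorm (pulseState g (startTime T₀ x₀ xvr γ) Hs Hint ρ t -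
        autonomousState T₀ V₀ d σ n₀ Hs Hint ρ t) ≤
      systemFactor ρ * (2 * epsClock T₀ d σ (alphaZero d n₀) b t +
        epsClock T₀ d σ (alphaZero d n₀) b t ^ 2 +
        (epsV T₀ V₀ d σ n₀ 0 t + 2 * Real.pi * outsideMass V₀ x₀ xvr *
          (2 * Real.pi * outsideMass V₀ x₀ xvr + 1))) := by
  have hd : 2 ≤ d := by
    have : (1 : ℝ) < d := by linarith
    exact_mod_cast this
  refine (traceNorm_le_sum_epsK hT₀ hσ hσd hn₀ hn₀' hV hw hb hsys hg ht).trans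
    (mul_le_mul_of_nonneg_left (add_le_add le_rfl (add_le_add
      (sum_epsK_le_epsV σ n₀ hd hV.isUnitPotential t _) ?_)) (systemFactor_nonneg ρ))
  have h0 : 0 ≤ 2 * Real.pi * outsideMass V₀ x₀ xvr :=
    mul_nonneg (by have := Real.pi_pos; positivity) (hV.isUnitPotential.outsideMass_nonneg hw.2.1)
  nlinarith [mul_nonneg h0 h0]

theorem traceNorm_le_epsS {T₀ : ℝ} {V₀ : ℝ → ℝ} {d : ℕ} {σ n₀ b t : ℝ} {x₀ xvr γ : ℝ}
    {g : ℝ → ℝ} {dS : ℕ} {Hs Hint ρ : Matrix (Fin dS) (Fin dS) ℂ}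
    (hT₀ : 0 < T₀) (hσ : 0 < σ) (hσd : σ < d) (hn₀ : 0 < n₀) (hn₀' : n₀ < (d : ℝ) - 1)
    (hV : IsPeakedPotential V₀ x₀) (hw : IsWindow x₀ xvr γ)
    (hb : IsDerivBound (fun x => Real.pi * V₀ x) b) (hsys : IsSystem Hs Hint ρ)
    (hg : IsPulse g (startTime T₀ x₀ xvr γ) (stopTime T₀ x₀ xvr γ))
    (ht : t ∈ Set.Icc 0 (startTime T₀ x₀ xvr γ) ∪ Set.Icc (stopTime T₀ x₀ xvr γ) T₀)
    (hκ : 0 < kappaTilde d γ) :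
    traceNorm (pulseState g (startTime T₀ x₀ xvr γ) Hs Hint ρ t -
        autonomousState T₀ V₀ d σ n₀ Hs Hint ρ t) ≤
      systemFactor ρ * (2 * epsClock T₀ d σ (alphaZero d n₀) b t +
        epsClock T₀ d σ (alphaZero d n₀) b t ^ 2 +
        epsS T₀ d σ γ (outsideMass V₀ x₀ xvr)) := by
  have hd : 2 ≤ d := by
    have : (1 : ℝ) < d := by linarith
    exact_mod_cast this
  have hU := hV.isUnitPotential
  have hπ := Real.pi_pos
  have hε := hU.outsideMass_nonneg (x₀ := x₀) hw.2.1
  have h := sum_epsK_add_le_epsVBound hd hσ hU hw hκ (isOffPeak_of_mem hT₀ hw ht) (d / T₀ * t)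
  refine (traceNorm_le_sum_epsK hT₀ hσ hσd hn₀ hn₀' hV hw hb hsys hg ht).trans
    (mul_le_mul_of_nonneg_left (add_le_add le_rfl (h.trans ?_)) (systemFactor_nonneg ρ))
  unfold epsS
  exact le_add_of_nonneg_right (by positivity)

end QuantumClock

namespace QuantumClock

/-! ### The cosine potential -/

theorem hasDerivAt_sum_cos {ι : Type*} (s : Finset ι) (c ω φ : ι → ℝ) (x : ℝ) :
    HasDerivAt (fun x => ∑ j ∈ s, c j * Real.cos (ω j * x + φ j))
      (∑ j ∈ s, c j * ω j * Real.cos (ω j * x + (φ j + Real.pi / 2))) x := by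
  refine HasDerivAt.fun_sum fun j _ => ?_
  have h1 : HasDerivAt (fun x : ℝ => ω j * x + φ j) (ω j) x := by
    simpa using ((hasDerivAt_id x).const_mul (ω j)).add_const (φ j)
  have h := (h1.cos).const_mul (c j)
  rw [← add_assoc, Real.cos_add_pi_div_two, mul_assoc, mul_neg, mul_comm (ω j), ← neg_mul]
  exact h

theorem iteratedDeriv_sum_cos {ι : Type*} (s : Finset ι) (ω : ι → ℝ) (k : ℕ) :
    ∀ c φ : ι → ℝ, iteratedDeriv k (fun x => ∑ j ∈ s, c j * Real.cos (ω j * x + φ j)) =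
      fun x => ∑ j ∈ s, c j * ω j ^ k * Real.cos (ω j * x + (φ j + k * (Real.pi / 2))) := by
  induction k with
  | zero => intro c φ; simp
  | succ k ih =>
    intro c φ
    rw [iteratedDeriv_succ', show deriv (fun x => ∑ j ∈ s, c j * Real.cos (ω j * x + φ j)) = _ from
      funext fun x => (hasDerivAt_sum_cos s c ω φ x).deriv,
      ih (fun j => c j * ω j) fun j => φ j + Real.pi / 2]
    funext x
    refine Finset.sum_congr rfl fun j _ => ?_
    push_cast
    rw [pow_succ']
    ring_nf

theorem cos_half_pow_eq_sum (n : ℕ) (y : ℝ) :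
    4 ^ n * Real.cos (y / 2) ^ (2 * n) =
      ∑ j ∈ Finset.range (2 * n + 1), ((2 * n).choose j : ℝ) * Real.cos (((j : ℝ) - n) * y) := by
  have h : (4 : ℂ) ^ n * Complex.cos (y / 2) ^ (2 * n) = ∑ j ∈ Finset.range (2 * n + 1),
      ((2 * n).choose j : ℂ) * Complex.exp ((((j : ℝ) - n) * y : ℝ) * Complex.I) := by
    have e : (4 : ℂ) ^ n * Complex.cos (y / 2) ^ (2 * n) =
        (Complex.exp (y / 2 * Complex.I) + Complex.exp (-(y / 2) * Complex.I)) ^ (2 * n) := by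
      rw [Complex.cos, div_pow, pow_mul 2, mul_div_assoc', mul_div_right_comm]
      norm_num
    rw [e, add_pow]
    refine Finset.sum_congr rfl fun j hj => ?_
    rw [mul_comm, ← Complex.exp_nat_mul, ← Complex.exp_nat_mul, ← Complex.exp_add,
      Nat.cast_sub (Nat.lt_succ_iff.1 (Finset.mem_range.1 hj))]
    congr 2
    push_cast
    ring
  have h2 := congrArg Complex.re h
  rw [Complex.re_sum] at h2
  have e1 : ((4 : ℂ) ^ n * Complex.cos (y / 2) ^ (2 * n)).re =
      4 ^ n * Real.cos (y / 2) ^ (2 * n) := by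
    rw [← Complex.ofReal_re (4 ^ n * Real.cos (y / 2) ^ (2 * n))]
    push_cast
    rfl
  rw [e1] at h2
  rw [h2]
  refine Finset.sum_congr rfl fun j _ => ?_
  rw [← Complex.ofReal_natCast, Complex.re_ofReal_mul, Complex.exp_ofReal_mul_I_re]

theorem centralBinom_pos_real (n : ℕ) : (0 : ℝ) < ((2 * n).choose n : ℝ) := by
  exact_mod_cast Nat.choose_pos (by omega)

theorem cosPotential_eq_sum (n : ℕ) (x₀ x : ℝ) :
    cosPotential n x₀ x = ∑ j ∈ Finset.range (2 * n + 1),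
      ((2 * n).choose j : ℝ) / (2 * Real.pi * (2 * n).choose n) *
        Real.cos (((j : ℝ) - n) * x + -(((j : ℝ) - n) * x₀)) := by
  have h := cos_half_pow_eq_sum n (x - x₀)
  unfold cosPotential
  rw [pow_mul 2, show (2 : ℝ) ^ 2 = 4 by norm_num, div_mul_eq_mul_div, h, Finset.sum_div]
  refine Finset.sum_congr rfl fun j _ => ?_
  rw [← sub_eq_add_neg, ← mul_sub]
  ring

theorem integral_cos_int_mul {m : ℤ} (hm : m ≠ 0) (φ : ℝ) :
    ∫ x in (0 : ℝ)..(2 * Real.pi), Real.cos (m * x + φ) = 0 := by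
  have hm' : (m : ℝ) ≠ 0 := by exact_mod_cast hm
  rw [intervalIntegral.integral_comp_mul_add (fun x => Real.cos x) hm', integral_cos]
  have : Real.sin (m * (2 * Real.pi) + φ) = Real.sin (m * 0 + φ) := by
    rw [mul_zero, zero_add, add_comm, Real.sin_add_int_mul_two_pi]
  rw [this, sub_self, smul_zero]

theorem integral_cosPotential (n : ℕ) (x₀ : ℝ) :
    ∫ x in (0 : ℝ)..(2 * Real.pi), cosPotential n x₀ x = 1 := by
  have hπ := Real.pi_pos
  simp only [cosPotential_eq_sum]
  rw [intervalIntegral.integral_finsetSum fun j _ => Continuous.intervalIntegrable (by fun_prop) _ _,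
    Finset.sum_eq_single n]
  · have := centralBinom_pos_real n
    simp only [sub_self, zero_mul, neg_zero, add_zero, Real.cos_zero, mul_one,
      intervalIntegral.integral_const, sub_zero, smul_eq_mul]
    field_simp
  · intro j _ hj
    have hm : (j : ℤ) - n ≠ 0 := by omega
    have h := integral_cos_int_mul hm (-(((j : ℝ) - n) * x₀))
    push_cast at h
    rw [intervalIntegral.integral_const_mul, h, mul_zero]
  · intro h
    exact absurd (Finset.mem_range.2 (by omega)) h

theorem cos_sq_lt_one {y : ℝ} (h1 : -Real.pi < y) (h2 : y < Real.pi) (h0 : y ≠ 0) :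
    Real.cos y ^ 2 < 1 := by
  have h : Real.sin y ≠ 0 := fun h => h0 ((Real.sin_eq_zero_iff_of_lt_of_lt h1 h2).1 h)
  have := Real.sin_sq_add_cos_sq y
  have := pow_pos (abs_pos.2 h) 2
  rw [sq_abs] at this
  linarith

theorem cosPotential_coeff_pos (n : ℕ) :
    0 < 2 ^ (2 * n) / (2 * Real.pi * ((2 * n).choose n : ℝ)) := by
  have := centralBinom_pos_real n
  have := Real.pi_pos
  positivity

theorem isPeakedPotential_cosPotential {n : ℕ} (hn : 1 ≤ n) {x₀ : ℝ} (h0 : 0 < x₀)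
    (h1 : x₀ < 2 * Real.pi) : IsPeakedPotential (cosPotential n x₀) x₀ := by
  have hπ := Real.pi_pos
  have hA := cosPotential_coeff_pos n
  refine ⟨?_, ?_, integral_cosPotential n x₀, ?_, ⟨h0.le, h1.le⟩, ?_⟩
  · unfold cosPotential
    have h : ContDiff ℝ (⊤ : ℕ∞) fun x : ℝ => (x - x₀) / 2 :=
      (contDiff_id.sub contDiff_const).div_const 2
    exact contDiff_const.mul (h.cos.pow _)
  · intro x
    unfold cosPotential
    rw [show (x + 2 * Real.pi - x₀) / 2 = (x - x₀) / 2 + Real.pi by ring, Real.cos_add_pi,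
      Even.neg_pow ⟨n, two_mul n⟩]
  · intro x
    unfold cosPotential
    exact mul_nonneg hA.le (Even.pow_nonneg ⟨n, two_mul n⟩ _)
  · intro x hx hne
    unfold cosPotential
    refine mul_lt_mul_of_pos_left ?_ hA
    rw [sub_self, zero_div, Real.cos_zero, one_pow, pow_mul]
    refine pow_lt_one₀ (sq_nonneg _) (cos_sq_lt_one ?_ ?_ ?_) (by omega)
    · linarith [hx.1]
    · linarith [hx.2]
    · intro h
      exact hne (by linarith)

theorem four_pow_div_choose_le {n : ℕ} (hn : 1 ≤ n) :
    (4 : ℝ) ^ n / (2 * n).choose n ≤ 2 * n := by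
  have h := Nat.four_pow_le_two_mul_self_mul_centralBinom n (by omega)
  rw [Nat.centralBinom] at h
  rw [div_le_iff₀ (centralBinom_pos_real n)]
  exact_mod_cast h

theorem abs_iteratedDeriv_cosPotential_le {n : ℕ} (hn : 1 ≤ n) (x₀ : ℝ) (k : ℕ) (x : ℝ) :
    |iteratedDeriv k (fun x => Real.pi * cosPotential n x₀ x) x| ≤ (n : ℝ) ^ (k + 1) := by
  have hπ := Real.pi_pos
  have hC := centralBinom_pos_real n
  have e : (fun x => Real.pi * cosPotential n x₀ x) = fun x => ∑ j ∈ Finset.range (2 * n + 1),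
      ((2 * n).choose j : ℝ) / (2 * (2 * n).choose n) *
        Real.cos (((j : ℝ) - n) * x + -(((j : ℝ) - n) * x₀)) := by
    funext x
    rw [cosPotential_eq_sum, Finset.mul_sum]
    refine Finset.sum_congr rfl fun j _ => ?_
    field_simp
  rw [e, iteratedDeriv_sum_cos (Finset.range (2 * n + 1)) (fun j => (j : ℝ) - n) k
    (fun j => ((2 * n).choose j : ℝ) / (2 * (2 * n).choose n)) fun j => -(((j : ℝ) - n) * x₀)]
  refine (Finset.abs_sum_le_sum_abs _ _).trans ?_
  calc _ ≤ ∑ j ∈ Finset.range (2 * n + 1),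
        ((2 * n).choose j : ℝ) / (2 * (2 * n).choose n) * (n : ℝ) ^ k := by
        refine Finset.sum_le_sum fun j hj => ?_
        rw [abs_mul, abs_mul, abs_pow, abs_of_nonneg (by positivity :
          0 ≤ ((2 * n).choose j : ℝ) / (2 * (2 * n).choose n))]
        have hj' : (j : ℝ) ≤ 2 * n := by
          exact_mod_cast Nat.lt_succ_iff.1 (Finset.mem_range.1 hj)
        have h1 : |(j : ℝ) - n| ≤ n := by
          rw [abs_le]
          constructor <;> linarith [(Nat.cast_nonneg j : (0 : ℝ) ≤ j)]
        refine (mul_le_of_le_one_right (by positivity) (Real.abs_cos_le_one _)).trans ?_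
        exact mul_le_mul_of_nonneg_left (pow_le_pow_left₀ (abs_nonneg _) h1 k) (by positivity)
    _ = (4 : ℝ) ^ n / (2 * n).choose n / 2 * n ^ k := by
        rw [← Finset.sum_mul, ← Finset.sum_div]
        have h := Nat.sum_range_choose (2 * n)
        have h' : ∑ j ∈ Finset.range (2 * n + 1), ((2 * n).choose j : ℝ) = 4 ^ n := by
          rw [pow_mul] at h
          exact_mod_cast h
        rw [h']
        ring
    _ ≤ n * n ^ k := by
        refine mul_le_mul_of_nonneg_right ?_ (by positivity)
        linarith [four_pow_div_choose_le hn]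
    _ = _ := by rw [pow_succ, mul_comm]

theorem cosDerivBound_eq (n : ℕ) :
    cosDerivBound n = Real.exp 2 / (2 * Real.sqrt Real.pi) * (n * Real.sqrt n) := by
  have hπ := Real.pi_pos
  unfold cosDerivBound
  congr 1
  rw [rpow_three_halves (by positivity), Real.sqrt_mul (by norm_num)]
  have h2 : Real.sqrt 2 * Real.sqrt 2 = 2 := Real.mul_self_sqrt (by norm_num)
  have h3 : 0 < Real.sqrt 2 := by positivity
  have h4 : 0 < Real.sqrt Real.pi := by positivity
  field_simp
  nlinarith

theorem two_mul_le_cosDerivBound {n : ℕ} (hn : 1 ≤ n) : 2 * (n : ℝ) ≤ cosDerivBound n := by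
  rw [cosDerivBound_eq]
  have hn' : (1 : ℝ) ≤ n := by exact_mod_cast hn
  have h1 : 1 ≤ Real.sqrt n := Real.one_le_sqrt.2 hn'
  have hs : 0 < Real.sqrt Real.pi := Real.sqrt_pos.2 Real.pi_pos
  have hsq := Real.sq_sqrt Real.pi_pos.le
  have hs1 : Real.sqrt Real.pi ≤ 1.78 := by
    rw [Real.sqrt_le_left (by norm_num)]
    linarith [Real.pi_lt_d2]
  have he : 7.3 ≤ Real.exp 2 := by
    have h := Real.exp_one_gt_d9
    have e : Real.exp 2 = Real.exp 1 * Real.exp 1 := by rw [← Real.exp_add]; norm_num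
    rw [e]
    nlinarith
  have h2 : 2 ≤ Real.exp 2 / (2 * Real.sqrt Real.pi) := by
    rw [le_div_iff₀ (by positivity)]
    linarith
  calc 2 * (n : ℝ) = 2 * (n * 1) := by ring
    _ ≤ _ := mul_le_mul h2 (mul_le_mul_of_nonneg_left h1 (by positivity)) (by positivity)
        (by positivity)

theorem isDerivBound_cosPotential {n : ℕ} (hn : 1 ≤ n) (x₀ : ℝ) :
    IsDerivBound (fun x => Real.pi * cosPotential n x₀ x) (cosDerivBound n) := by
  intro k hk x _
  refine le_trans ?_ (two_mul_le_cosDerivBound hn)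
  have h := abs_iteratedDeriv_cosPotential_le hn x₀ (k - 1) x
  rw [Nat.sub_add_cancel hk] at h
  have hk0 : k ≠ 0 := by omega
  have h2 : 2 * |iteratedDeriv (k - 1) (fun x => Real.pi * cosPotential n x₀ x) x| ≤
      (2 * (n : ℝ)) ^ k := by
    rw [mul_pow]
    refine mul_le_mul ?_ h (abs_nonneg _) (by positivity)
    calc (2 : ℝ) = 2 ^ 1 := by norm_num
      _ ≤ 2 ^ k := pow_le_pow_right₀ (by norm_num) hk
  calc _ ≤ ((2 * (n : ℝ)) ^ k) ^ ((1 : ℝ) / k) :=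
        Real.rpow_le_rpow (by positivity) h2 (by positivity)
    _ = 2 * n := by rw [one_div, Real.pow_rpow_inv_natCast (by positivity) hk0]

end QuantumClock

namespace QuantumClock

/-! ### Dependence of the Gaussian sum on its centre -/

theorem summable_exp_neg_mul_sub_sq {a : ℝ} (ha : 0 < a) (κ : ℝ) :
    Summable fun k : ℤ => Real.exp (-a * ((k : ℝ) - κ) ^ 2) := by
  have h := (summable_exp_neg_mul_int_sq (half_pos ha)).mul_left (Real.exp (a * κ ^ 2))
  refine Summable.of_nonneg_of_le (fun k => (Real.exp_pos _).le) (fun k => ?_) h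
  rw [← Real.exp_add]
  refine Real.exp_le_exp.2 ?_
  have h1 : (k : ℝ) ^ 2 / 2 ≤ (k - κ) ^ 2 + κ ^ 2 := by nlinarith [sq_nonneg ((k : ℝ) - 2 * κ)]
  have h2 := mul_le_mul_of_nonneg_left h1 ha.le
  linarith

theorem abs_gaussSum_sub_tsum_le {d : ℕ} (hd : 2 ≤ d) {σ : ℝ} (hσ : 0 < σ) (κ : ℝ) :
    |gaussSum d σ κ - ∑' k : ℤ, Real.exp (-(2 * Real.pi / σ ^ 2) * ((k : ℝ) - κ) ^ 2)| ≤
      2 * (Real.exp (-(2 * Real.pi / σ ^ 2 * d ^ 2 / 4)) /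
        (1 - Real.exp (-(2 * Real.pi / σ ^ 2 * d)))) := by
  have hπ := Real.pi_pos
  have hd' : (2 : ℝ) ≤ d := by exact_mod_cast hd
  set a := 2 * Real.pi / σ ^ 2 with ha
  have ha0 : 0 < a := by positivity
  set m := ⌊κ + (d : ℝ) / 2⌋ with hm
  have hm1 : (m : ℝ) ≤ κ + d / 2 := Int.floor_le _
  have hm2 : κ + d / 2 < m + 1 := Int.lt_floor_add_one _
  have h1 := sum_Ioc_eq_tsum_sub (summable_exp_neg_mul_sub_sq ha0 κ) m d
  obtain ⟨-, h2⟩ := tsum_exp_neg_mul_sq_tail_le (x₀ := m + 1 - κ) ha0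
    (by linarith : (0 : ℝ) < d) (by linarith)
  obtain ⟨-, h3⟩ := tsum_exp_neg_mul_sq_tail_le (x₀ := κ - m + d) ha0
    (by linarith : (0 : ℝ) < d) (by linarith)
  have e2 : ∀ j : ℕ, Real.exp (-a * (((m + 1 + j : ℤ) : ℝ) - κ) ^ 2) =
      Real.exp (-a * (m + 1 - κ + j) ^ 2) := fun j => by
    congr 2; push_cast; ring
  have e3 : ∀ j : ℕ, Real.exp (-a * (((m - d - j : ℤ) : ℝ) - κ) ^ 2) =
      Real.exp (-a * (κ - m + d + j) ^ 2) := fun j => by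
    congr 1; push_cast; ring
  simp only [e2, e3] at h1
  have h4 : gaussSum d σ κ = ∑ k ∈ Finset.Ioc (m - (d : ℤ)) m,
      Real.exp (-a * ((k : ℝ) - κ) ^ 2) := by
    rw [gaussSum, centredIntegers_eq_Ioc]
  have p2 : 0 ≤ ∑' j : ℕ, Real.exp (-a * (m + 1 - κ + j) ^ 2) :=
    tsum_nonneg fun j => (Real.exp_pos _).le
  have p3 : 0 ≤ ∑' j : ℕ, Real.exp (-a * (κ - m + d + j) ^ 2) :=
    tsum_nonneg fun j => (Real.exp_pos _).le
  rw [h4, h1, abs_le]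
  constructor <;> linarith

theorem abs_tsum_exp_sub_tsum_exp_le {D : ℝ} (hD : 1 ≤ D) (κ : ℝ) :
    |(∑' k : ℤ, Real.exp (-(2 * Real.pi / D) * ((k : ℝ) - κ) ^ 2)) -
      ∑' k : ℤ, Real.exp (-(2 * Real.pi / D) * ((k : ℝ) - 0) ^ 2)| ≤
      D * (2 * Real.exp (-(Real.pi / 4 * D)) *
        ∑' k : ℤ, Real.exp (-(Real.pi / 4) * (k : ℝ) ^ 2)) := by
  have hπ := Real.pi_pos
  set a : ℝ := D / 2 with ha
  have ha0 : 0 < a := by rw [ha]; linarith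
  set L : ℝ → ℤ → ℂ := fun κ n =>
    Complex.exp (-Real.pi * (a : ℂ) * n ^ 2 + 2 * Real.pi * (Complex.I * κ) * n) with hL
  have hnorm : ∀ κ n, ‖L κ n‖ = Real.exp (-(Real.pi * a) * (n : ℝ) ^ 2) := by
    intro κ n
    rw [hL, Complex.norm_exp]
    congr 1
    have e : -Real.pi * (a : ℂ) * n ^ 2 + 2 * Real.pi * (Complex.I * κ) * n =
        ((-(Real.pi * a) * (n : ℝ) ^ 2 : ℝ) : ℂ) + ((2 * Real.pi * κ * n : ℝ) : ℂ) * Complex.I := by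
      push_cast; ring
    rw [e, Complex.add_re, Complex.re_ofReal_mul, Complex.I_re, mul_zero, add_zero,
      Complex.ofReal_re]
  have hs : ∀ κ, Summable (L κ) := fun κ => by
    refine Summable.of_norm ?_
    simp only [hnorm]
    exact summable_exp_neg_mul_int_sq (by positivity)
  have hθ : ∀ κ : ℝ, ((∑' k : ℤ, Real.exp (-(2 * Real.pi / D) * ((k : ℝ) - κ) ^ 2) : ℝ) : ℂ) =
      (a : ℂ) ^ (1 / 2 : ℂ) * ∑' n, L κ n := by
    intro κ
    have h := Complex.tsum_exp_neg_quadratic (a := (a : ℂ)) (by simpa using ha0) (Complex.I * κ)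
    have hne : (a : ℂ) ^ (1 / 2 : ℂ) ≠ 0 := by
      rw [Ne, Complex.cpow_eq_zero_iff]
      exact fun h => ha0.ne' (by exact_mod_cast h.1)
    rw [hL]
    simp only
    rw [h, ← mul_assoc, mul_one_div_cancel hne, one_mul, Complex.ofReal_tsum]
    refine tsum_congr fun k => ?_
    rw [← mul_assoc, Complex.I_mul_I, ha]
    push_cast
    congr 1
    have hDc : (D : ℂ) ≠ 0 := by
      have : D ≠ 0 := by linarith
      exact_mod_cast this
    field_simp
    ring
  have hsq : ‖(a : ℂ) ^ (1 / 2 : ℂ)‖ ≤ D := by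
    rw [Complex.norm_cpow_eq_rpow_re_of_pos ha0]
    have e : (1 / 2 : ℂ).re = 1 / 2 := by norm_num
    rw [e, ← Real.sqrt_eq_rpow]
    refine Real.sqrt_le_iff.2 ⟨by linarith, ?_⟩
    rw [ha]
    nlinarith
  have hdiff : ‖∑' n, L κ n - ∑' n, L 0 n‖ ≤ 2 * Real.exp (-(Real.pi / 4 * D)) *
      ∑' k : ℤ, Real.exp (-(Real.pi / 4) * (k : ℝ) ^ 2) := by
    rw [← (hs κ).tsum_sub (hs 0), ← tsum_mul_left]
    have hsm : Summable fun k : ℤ => 2 * Real.exp (-(Real.pi / 4 * D)) *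
        Real.exp (-(Real.pi / 4) * (k : ℝ) ^ 2) :=
      (summable_exp_neg_mul_int_sq (by positivity)).mul_left _
    refine tsum_of_norm_bounded hsm.hasSum fun n => ?_
    by_cases hn : n = 0
    · subst hn
      simp only [hL]
      simp only [Int.cast_zero, mul_zero, add_zero, sub_self, norm_zero]
      positivity
    · refine (norm_sub_le _ _).trans ?_
      rw [hnorm, hnorm, ← two_mul, mul_assoc, ← Real.exp_add]
      refine mul_le_mul_of_nonneg_left (Real.exp_le_exp.2 ?_) (by norm_num)
      have h1 : (1 : ℝ) ≤ (n : ℝ) ^ 2 := by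
        have : (1 : ℤ) ≤ n ^ 2 := by
          have := pow_pos (abs_pos.2 hn) 2
          rw [sq_abs] at this
          omega
        exact_mod_cast this
      have h2 : D + (n : ℝ) ^ 2 ≤ 2 * D * n ^ 2 := by
        nlinarith [mul_nonneg (by linarith : (0 : ℝ) ≤ D - 1) (by linarith : (0 : ℝ) ≤ (n : ℝ) ^ 2 - 1)]
      have h3 := mul_le_mul_of_nonneg_left h2 (by positivity : 0 ≤ Real.pi / 4)
      rw [ha]
      linarith
  rw [← Real.norm_eq_abs, ← Complex.norm_real, Complex.ofReal_sub, hθ, hθ,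
    ← mul_sub, norm_mul]
  exact mul_le_mul hsq hdiff (norm_nonneg _) (by linarith)

/-- For the width `σ = √d` the Gaussian sum depends on its centre only up to an exponentially
small error. -/
theorem exists_abs_gaussSum_sub_le : ∃ C : ℝ, 0 ≤ C ∧ ∀ d : ℕ, 2 ≤ d → ∀ κ : ℝ,
    |gaussSum d (Real.sqrt d) κ - gaussSum d (Real.sqrt d) 0| ≤
      C * d * Real.exp (-(Real.pi / 4 * d)) := by
  have hπ := Real.pi_gt_three
  set Z := ∑' k : ℤ, Real.exp (-(Real.pi / 4) * (k : ℝ) ^ 2) with hZ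
  have hZ0 : 0 ≤ Z := tsum_nonneg fun k => (Real.exp_pos _).le
  refine ⟨8 + 2 * Z, by positivity, fun d hd κ => ?_⟩
  have hd' : (2 : ℝ) ≤ d := by exact_mod_cast hd
  have hσ : 0 < Real.sqrt d := Real.sqrt_pos.2 (by linarith)
  have hσ2 : Real.sqrt d ^ 2 = d := Real.sq_sqrt (by linarith)
  have h := abs_gaussSum_sub_tsum_le hd hσ
  have ht := abs_tsum_exp_sub_tsum_exp_le (D := d) (by linarith) κ
  rw [hσ2] at h
  set E := Real.exp (-(Real.pi / 4 * d)) with hE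
  have hE0 : 0 < E := Real.exp_pos _
  have htail : 2 * (Real.exp (-(2 * Real.pi / d * (d : ℝ) ^ 2 / 4)) /
      (1 - Real.exp (-(2 * Real.pi / d * (d : ℝ))))) ≤ 4 * E := by
    rw [div_mul_cancel₀ _ (by linarith : (d : ℝ) ≠ 0)]
    have h1 : Real.exp (-(2 * Real.pi)) ≤ 1 / 2 := by
      rw [Real.exp_neg, one_div]
      refine inv_anti₀ (by norm_num) ?_
      linarith [Real.add_one_le_exp (2 * Real.pi)]
    have h2 : Real.exp (-(2 * Real.pi / d * (d : ℝ) ^ 2 / 4)) ≤ E := by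
      refine Real.exp_le_exp.2 ?_
      have e : 2 * Real.pi / d * (d : ℝ) ^ 2 / 4 = Real.pi / 2 * d := by field_simp; ring
      rw [e]
      nlinarith
    have h3 : Real.exp (-(2 * Real.pi / d * (d : ℝ) ^ 2 / 4)) / (1 - Real.exp (-(2 * Real.pi))) ≤
        E / (1 / 2) := div_le_div₀ hE0.le h2 (by norm_num) (by linarith)
    linarith
  have h1 := abs_le.1 ((h κ).trans htail)
  have h2 := abs_le.1 ((h 0).trans htail)
  have h3 := abs_le.1 ht
  have h4 : 8 * E ≤ 8 * d * E := by nlinarith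
  have h5 : (d : ℝ) * (2 * E * Z) = 2 * Z * d * E := by ring
  rw [h5] at h3
  rw [add_mul, add_mul, abs_le]
  constructor <;> linarith [h1.1, h1.2, h2.1, h2.2, h3.1, h3.2]

theorem one_le_gaussSum_zero {d : ℕ} (hd : 0 < d) (σ : ℝ) : 1 ≤ gaussSum d σ 0 := by
  have h0 : (0 : ℤ) ∈ centredIntegers d 0 := by
    rw [mem_centredIntegers]
    have : (0 : ℝ) < d := by exact_mod_cast hd
    push_cast
    constructor <;> linarith
  have h := Finset.single_le_sum
    (f := fun k : ℤ => Real.exp (-(2 * Real.pi / σ ^ 2) * ((k : ℝ) - 0) ^ 2))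
    (fun k _ => (Real.exp_pos _).le) h0
  simpa [gaussSum] using h

theorem normConst_le_one {d : ℕ} (hd : 0 < d) (σ : ℝ) : normConst d σ 0 ≤ 1 := by
  rw [normConst]
  exact div_le_one_of_le₀ (Real.one_le_sqrt.2 (one_le_gaussSum_zero hd σ)) (Real.sqrt_nonneg _)

theorem abs_sqrt_sub_one_le {x : ℝ} (hx : 0 ≤ x) : |Real.sqrt x - 1| ≤ |x - 1| := by
  have h := Real.sqrt_nonneg x
  have e : x - 1 = (Real.sqrt x - 1) * (Real.sqrt x + 1) := by
    nlinarith [Real.sq_sqrt hx]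
  rw [e, abs_mul]
  refine le_mul_of_one_le_right (abs_nonneg _) ?_
  rw [abs_of_nonneg (by linarith)]
  linarith

theorem epsNor_le {d : ℕ} (hd : 0 < d) (T₀ σ t : ℝ) :
    epsNor T₀ d σ t ≤ |gaussSum d σ (d / T₀ * t) - gaussSum d σ 0| := by
  have h1 := one_le_gaussSum_zero hd σ
  have h0 : 0 ≤ gaussSum d σ (d / T₀ * t) := Finset.sum_nonneg fun k _ => (Real.exp_pos _).le
  have h2 : 0 < gaussSum d σ 0 := by linarith
  refine (abs_sqrt_sub_one_le (by positivity)).trans ?_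
  rw [div_sub_one h2.ne', abs_div, abs_of_pos h2]
  exact div_le_self (abs_nonneg _) h1

end QuantumClock

namespace QuantumClock

/-! ### Stretched exponential smallness -/

/-- The scale `d^(1/4) √(log d)`. -/
noncomputable def growth (d : ℕ) : ℝ := (d : ℝ) ^ ((1 : ℝ) / 4) * Real.sqrt (Real.log d)

/-- Sequences bounded by a polynomial times `exp (-c d^(1/4) √(log d))` for some `c > 0`. -/
def IsExpSmall (f : ℕ → ℝ) : Prop :=
  ∃ (c C : ℝ) (p : ℕ), 0 < c ∧
    ∀ᶠ d : ℕ in Filter.atTop, |f d| ≤ C * (d : ℝ) ^ p * Real.exp (-(c * growth d))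

/-- Sequences of at most polynomial growth. -/
def IsPolyBounded (f : ℕ → ℝ) : Prop :=
  ∃ (C : ℝ) (p : ℕ), ∀ᶠ d : ℕ in Filter.atTop, |f d| ≤ C * (d : ℝ) ^ p

theorem growth_nonneg (d : ℕ) : 0 ≤ growth d := by unfold growth; positivity

theorem growth_pow_four (d : ℕ) : growth d ^ 4 = d * Real.log d ^ 2 := by
  have h1 : ((d : ℝ) ^ ((1 : ℝ) / 4)) ^ 4 = d := by
    rw [← Real.rpow_natCast, ← Real.rpow_mul (Nat.cast_nonneg d)]
    norm_num
  have h2 : Real.sqrt (Real.log d) ^ 4 = Real.log d ^ 2 := by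
    rw [show (4 : ℕ) = 2 * 2 from rfl, pow_mul, Real.sq_sqrt (Real.log_natCast_nonneg d)]
  rw [growth, mul_pow, h1, h2]

theorem growth_le (d : ℕ) : growth d ≤ d := by
  rcases Nat.eq_zero_or_pos d with rfl | hd
  · simp [growth]
  have hd' : (1 : ℝ) ≤ d := by exact_mod_cast hd
  refine le_of_pow_le_pow_left₀ (n := 4) (by norm_num) (by positivity) ?_
  rw [growth_pow_four]
  have h0 := Real.log_natCast_nonneg d
  have h1 : Real.log d ≤ d := (Real.log_le_sub_one_of_pos (by linarith)).trans (by linarith)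
  have h2 : Real.log d ^ 2 ≤ (d : ℝ) ^ 2 := pow_le_pow_left₀ h0 h1 2
  calc (d : ℝ) * Real.log d ^ 2 ≤ d * d ^ 2 := mul_le_mul_of_nonneg_left h2 (by positivity)
    _ = d ^ 3 := by ring
    _ ≤ d ^ 4 := pow_le_pow_right₀ hd' (by norm_num)

theorem rpow_le_growth {d : ℕ} (hd : 3 ≤ d) : (d : ℝ) ^ ((1 : ℝ) / 4) ≤ growth d := by
  have hd' : (3 : ℝ) ≤ d := by exact_mod_cast hd
  refine le_mul_of_one_le_right (by positivity) (Real.one_le_sqrt.2 ?_)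
  rw [Real.le_log_iff_exp_le (by linarith)]
  linarith [Real.exp_one_lt_d9]

theorem tendsto_growth : Filter.Tendsto growth Filter.atTop Filter.atTop := by
  refine Filter.tendsto_atTop_mono' _ ?_
    ((tendsto_rpow_atTop (by norm_num : (0 : ℝ) < 1 / 4)).comp tendsto_natCast_atTop_atTop)
  filter_upwards [Filter.eventually_ge_atTop 3] with d hd using rpow_le_growth hd

theorem tendsto_pow_mul_exp_neg_growth {c : ℝ} (hc : 0 < c) (C : ℝ) (p : ℕ) (m : ℝ) :
    Filter.Tendsto (fun d : ℕ => C * (d : ℝ) ^ p * Real.exp (-(c * growth d)) * (d : ℝ) ^ m)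
      Filter.atTop (nhds 0) := by
  have h := ((tendsto_rpow_mul_exp_neg_mul_atTop_nhds_zero (4 * (p + m)) c hc).comp
    ((tendsto_rpow_atTop (by norm_num : (0 : ℝ) < 1 / 4)).comp
      (tendsto_natCast_atTop_atTop (R := ℝ)))).const_mul |C|
  rw [mul_zero] at h
  refine squeeze_zero_norm' ?_ h
  filter_upwards [Filter.eventually_ge_atTop 3] with d hd
  have hd' : (3 : ℝ) ≤ d := by exact_mod_cast hd
  have hd0 : (0 : ℝ) < d := by linarith
  have e : ((d : ℝ) ^ ((1 : ℝ) / 4)) ^ (4 * (p + m)) = (d : ℝ) ^ p * (d : ℝ) ^ m := by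
    rw [← Real.rpow_mul hd0.le, ← Real.rpow_natCast, ← Real.rpow_add hd0]
    congr 1
    ring
  simp only [Function.comp_apply]
  rw [e, Real.norm_eq_abs, abs_mul, abs_mul, abs_mul, Real.abs_exp,
    abs_of_nonneg (by positivity : 0 ≤ (d : ℝ) ^ p), abs_of_nonneg (by positivity : 0 ≤ (d : ℝ) ^ m)]
  calc |C| * (d : ℝ) ^ p * Real.exp (-(c * growth d)) * (d : ℝ) ^ m =
      |C| * ((d : ℝ) ^ p * (d : ℝ) ^ m * Real.exp (-(c * growth d))) := by ring
    _ ≤ _ := by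
      refine mul_le_mul_of_nonneg_left (mul_le_mul_of_nonneg_left ?_ (by positivity))
        (abs_nonneg _)
      refine Real.exp_le_exp.2 ?_
      have := mul_le_mul_of_nonneg_left (rpow_le_growth hd) hc.le
      linarith

theorem IsPolyBounded.mono {f g : ℕ → ℝ} (hg : IsPolyBounded g)
    (h : ∀ᶠ d : ℕ in Filter.atTop, |f d| ≤ |g d|) : IsPolyBounded f := by
  obtain ⟨C, p, hg⟩ := hg
  exact ⟨C, p, by filter_upwards [h, hg] with d h1 h2 using h1.trans h2⟩

theorem isPolyBounded_const (K : ℝ) : IsPolyBounded fun _ => K :=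
  ⟨|K|, 0, by simp⟩

theorem isPolyBounded_natCast : IsPolyBounded fun d => (d : ℝ) :=
  ⟨1, 1, by simp⟩

theorem IsPolyBounded.mul {f g : ℕ → ℝ} (hf : IsPolyBounded f) (hg : IsPolyBounded g) :
    IsPolyBounded fun d => f d * g d := by
  obtain ⟨C, p, hf⟩ := hf
  obtain ⟨C', p', hg⟩ := hg
  refine ⟨C * C', p + p', ?_⟩
  filter_upwards [hf, hg] with d h1 h2
  rw [abs_mul, pow_add]
  calc |f d| * |g d| ≤ (C * (d : ℝ) ^ p) * (C' * (d : ℝ) ^ p') :=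
        mul_le_mul h1 h2 (abs_nonneg _) ((abs_nonneg _).trans h1)
    _ = _ := by ring

theorem IsPolyBounded.add {f g : ℕ → ℝ} (hf : IsPolyBounded f) (hg : IsPolyBounded g) :
    IsPolyBounded fun d => f d + g d := by
  obtain ⟨C, p, hf⟩ := hf
  obtain ⟨C', p', hg⟩ := hg
  refine ⟨|C| + |C'|, max p p', ?_⟩
  filter_upwards [hf, hg, Filter.eventually_ge_atTop 1] with d h1 h2 hd
  have hd' : (1 : ℝ) ≤ d := by exact_mod_cast hd
  have key : ∀ (K : ℝ) {q r : ℕ}, q ≤ r → K * (d : ℝ) ^ q ≤ |K| * (d : ℝ) ^ r := fun K q r hqr =>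
    mul_le_mul (le_abs_self K) (pow_le_pow_right₀ hd' hqr) (by positivity) (abs_nonneg K)
  rw [add_mul]
  exact (abs_add_le _ _).trans (add_le_add (h1.trans (key C (le_max_left _ _)))
    (h2.trans (key C' (le_max_right _ _))))

theorem IsExpSmall.mono {f g : ℕ → ℝ} (hg : IsExpSmall g)
    (h : ∀ᶠ d : ℕ in Filter.atTop, |f d| ≤ |g d|) : IsExpSmall f := by
  obtain ⟨c, C, p, hc, hg⟩ := hg
  exact ⟨c, C, p, hc, by filter_upwards [h, hg] with d h1 h2 using h1.trans h2⟩

theorem IsExpSmall.isPolyBounded {f : ℕ → ℝ} (hf : IsExpSmall f) : IsPolyBounded f := by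
  obtain ⟨c, C, p, hc, hf⟩ := hf
  refine ⟨|C|, p, ?_⟩
  filter_upwards [hf] with d h
  refine h.trans ((mul_le_mul_of_nonneg_right (mul_le_mul_of_nonneg_right (le_abs_self C)
    (by positivity)) (Real.exp_pos _).le).trans (mul_le_of_le_one_right (by positivity) ?_))
  rw [Real.exp_le_one_iff, neg_nonpos]
  exact mul_nonneg hc.le (growth_nonneg d)

theorem IsExpSmall.poly_mul {f g : ℕ → ℝ} (hf : IsPolyBounded f) (hg : IsExpSmall g) :
    IsExpSmall fun d => f d * g d := by
  obtain ⟨C, p, hf⟩ := hf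
  obtain ⟨c, C', p', hc, hg⟩ := hg
  refine ⟨c, C * C', p + p', hc, ?_⟩
  filter_upwards [hf, hg] with d h1 h2
  rw [abs_mul, pow_add]
  calc |f d| * |g d| ≤ (C * (d : ℝ) ^ p) * (C' * (d : ℝ) ^ p' * Real.exp (-(c * growth d))) :=
        mul_le_mul h1 h2 (abs_nonneg _) ((abs_nonneg _).trans h1)
    _ = _ := by ring

theorem IsExpSmall.mul_poly {f g : ℕ → ℝ} (hf : IsExpSmall f) (hg : IsPolyBounded g) :
    IsExpSmall fun d => f d * g d := by
  simpa only [mul_comm] using IsExpSmall.poly_mul hg hf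

theorem IsExpSmall.add {f g : ℕ → ℝ} (hf : IsExpSmall f) (hg : IsExpSmall g) :
    IsExpSmall fun d => f d + g d := by
  obtain ⟨c, C, p, hc, hf⟩ := hf
  obtain ⟨c', C', p', hc', hg⟩ := hg
  refine ⟨min c c', |C| + |C'|, max p p', lt_min hc hc', ?_⟩
  filter_upwards [hf, hg, Filter.eventually_ge_atTop 1] with d h1 h2 hd
  have hd' : (1 : ℝ) ≤ d := by exact_mod_cast hd
  have key : ∀ (K : ℝ) {q r : ℕ} {s s' : ℝ}, q ≤ r → s' ≤ s →
      K * (d : ℝ) ^ q * Real.exp (-(s * growth d)) ≤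
        |K| * (d : ℝ) ^ r * Real.exp (-(s' * growth d)) := fun K q r s s' hqr hs =>
    mul_le_mul (mul_le_mul (le_abs_self K) (pow_le_pow_right₀ hd' hqr) (by positivity)
      (abs_nonneg K)) (Real.exp_le_exp.2 (neg_le_neg (mul_le_mul_of_nonneg_right hs
        (growth_nonneg d)))) (Real.exp_pos _).le (by positivity)
  rw [add_mul, add_mul]
  exact (abs_add_le _ _).trans (add_le_add (h1.trans (key C (le_max_left _ _) (min_le_left _ _)))
    (h2.trans (key C' (le_max_right _ _) (min_le_right _ _))))

theorem IsExpSmall.abs {f : ℕ → ℝ} (hf : IsExpSmall f) : IsExpSmall fun d => |f d| :=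
  hf.mono (Filter.Eventually.of_forall fun _ => (abs_abs _).le)

theorem IsExpSmall.of_abs_le_add {f g h : ℕ → ℝ} (hg : IsExpSmall g) (hh : IsExpSmall h)
    (hf : ∀ᶠ d : ℕ in Filter.atTop, |f d| ≤ |g d| + |h d|) : IsExpSmall f :=
  (hg.abs.add hh.abs).mono (hf.mono fun _ hd => hd.trans (le_abs_self _))

theorem isExpSmall_exp_neg_growth {c : ℝ} (hc : 0 < c) :
    IsExpSmall fun d => Real.exp (-(c * growth d)) :=
  ⟨c, 1, 0, hc, by simp⟩

theorem isExpSmall_exp_neg {c : ℝ} (hc : 0 < c) : IsExpSmall fun d => Real.exp (-(c * d)) := by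
  refine (isExpSmall_exp_neg_growth hc).mono (Filter.Eventually.of_forall fun d => ?_)
  rw [Real.abs_exp, Real.abs_exp]
  exact Real.exp_le_exp.2 (neg_le_neg (mul_le_mul_of_nonneg_left (growth_le d) hc.le))

/-! ### The individual errors for the width `σ = √d` -/

theorem isExpSmall_epsStep : IsExpSmall fun d => epsStep d (Real.sqrt d) := by
  refine (IsExpSmall.poly_mul (isPolyBounded_const 2)
    (isExpSmall_exp_neg (c := Real.pi / 4) (by have := Real.pi_pos; positivity))).mono ?_
  filter_upwards [Filter.eventually_ge_atTop 1] with d hd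
  have hd' : (1 : ℝ) ≤ d := by exact_mod_cast hd
  have hA := normConst_le_one (d := d) (by omega) (Real.sqrt d)
  have hA0 := (normConst_pos (d := d) (by omega) (Real.sqrt d)).le
  unfold epsStep
  rw [Real.sq_sqrt (by linarith), abs_mul, abs_mul, abs_mul, Real.abs_exp, Real.abs_exp,
    abs_of_nonneg hA0]
  have e : Real.pi * (d : ℝ) ^ 2 / (4 * d) = Real.pi / 4 * d := by field_simp
  rw [e]
  refine mul_le_mul_of_nonneg_right ?_ (Real.exp_pos _).le
  exact mul_le_of_le_one_right (abs_nonneg _) hA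

theorem exists_isExpSmall_epsNor : ∃ f : ℕ → ℝ, IsExpSmall f ∧ (∀ d, 0 ≤ f d) ∧
    ∀ d : ℕ, 2 ≤ d → ∀ T₀ t : ℝ, epsNor T₀ d (Real.sqrt d) t ≤ f d := by
  obtain ⟨C, hC, h⟩ := exists_abs_gaussSum_sub_le
  refine ⟨fun d => C * d * Real.exp (-(Real.pi / 4 * d)), ?_, fun d => by positivity,
    fun d hd T₀ t => (epsNor_le (by omega) T₀ _ t).trans (h d hd _)⟩
  exact IsExpSmall.poly_mul ((isPolyBounded_const C).mul isPolyBounded_natCast)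
    (isExpSmall_exp_neg (by have := Real.pi_pos; positivity))

theorem eventually_le_mul_natCast {γ : ℝ} (hγ : 0 < γ) (K : ℝ) :
    ∀ᶠ d : ℕ in Filter.atTop, K ≤ γ * d :=
  (tendsto_natCast_atTop_atTop.const_mul_atTop hγ).eventually_ge_atTop K

theorem eventually_kappaTilde_pos {γ : ℝ} (hγ : 0 < γ) :
    ∀ᶠ d : ℕ in Filter.atTop, 0 < kappaTilde d γ := by
  filter_upwards [eventually_le_mul_natCast hγ 4, Filter.eventually_ge_atTop 1] with d h hd
  have hd' : (1 : ℝ) ≤ d := by exact_mod_cast hd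
  unfold kappaTilde
  rw [if_neg (by linarith)]
  refine pow_pos ?_ 2
  rw [sub_pos, div_lt_div_iff₀ (by linarith) two_pos]
  linarith

theorem isExpSmall_geomTail {γ : ℝ} (hγ : 0 < γ) :
    IsExpSmall fun d => geomTail d (Real.sqrt d) (d * Real.sqrt (kappaTilde d γ)) := by
  have hπ := Real.pi_pos
  set r := 1 - Real.exp (-(Real.pi * γ)) with hr
  have hr0 : 0 < r := sub_pos.2 (Real.exp_lt_one_iff.2 (by rw [neg_lt_zero]; positivity))
  refine (IsExpSmall.mul_poly (isExpSmall_exp_neg (c := Real.pi * γ ^ 2 / 8) (by positivity))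
    (isPolyBounded_const r⁻¹)).mono ?_
  filter_upwards [eventually_le_mul_natCast hγ 4, Filter.eventually_ge_atTop 1,
    eventually_kappaTilde_pos hγ] with d h hd hκ
  have hd' : (1 : ℝ) ≤ d := by exact_mod_cast hd
  obtain ⟨hq, hqγ⟩ := exists_sqrt_kappaTilde (by omega) hκ
  set q := (d : ℝ) * Real.sqrt (kappaTilde d γ)
  have hq4 : d * γ / 4 ≤ q := by linarith
  have hA := normConst_le_one (d := d) (by omega) (Real.sqrt d)
  have hA0 := (normConst_pos (d := d) (by omega) (Real.sqrt d)).le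
  rw [abs_of_nonneg (geomTail_nonneg d hq.le), abs_of_nonneg (by positivity), geomTail,
    Real.sq_sqrt (by linarith), ← div_eq_mul_inv]
  have hA2 : normConst d (Real.sqrt d) 0 ^ 2 ≤ 1 := pow_le_one₀ hA0 hA
  have h1 : Real.pi * γ ^ 2 / 8 * d ≤ 2 * Real.pi / d * q ^ 2 := by
    have h2 : (d * γ / 4) ^ 2 ≤ q ^ 2 := pow_le_pow_left₀ (by positivity) hq4 2
    calc Real.pi * γ ^ 2 / 8 * d = 2 * Real.pi / d * (d * γ / 4) ^ 2 := by field_simp; ring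
      _ ≤ _ := mul_le_mul_of_nonneg_left h2 (by positivity)
  have h3 : Real.pi * γ ≤ 4 * Real.pi / d * q := by
    calc Real.pi * γ = 4 * Real.pi / d * (d * γ / 4) := by field_simp
      _ ≤ _ := mul_le_mul_of_nonneg_left hq4 (by positivity)
  have h4 : Real.exp (-(2 * Real.pi / d * q ^ 2)) / (1 - Real.exp (-(4 * Real.pi / d * q))) ≤
      Real.exp (-(Real.pi * γ ^ 2 / 8 * d)) / r :=
    div_le_div₀ (Real.exp_pos _).le (Real.exp_le_exp.2 (neg_le_neg h1)) hr0
      (sub_le_sub_left (Real.exp_le_exp.2 (neg_le_neg h3)) 1)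
  have h5 : 0 ≤ Real.exp (-(2 * Real.pi / d * q ^ 2)) / (1 - Real.exp (-(4 * Real.pi / d * q))) :=
    div_nonneg (Real.exp_pos _).le (by
      have := Real.exp_le_one_iff.2 (by rw [neg_nonpos]; positivity : -(4 * Real.pi / d * q) ≤ 0)
      linarith)
  exact (mul_le_of_le_one_left h5 hA2).trans h4

theorem outsideMass_cosPotential_le {n : ℕ} (hn : 1 ≤ n) {x₀ xvr : ℝ} (h0 : 0 < x₀)
    (h1 : x₀ < 2 * Real.pi) (hx : 0 < xvr) (hxπ : xvr ≤ Real.pi) :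
    outsideMass (cosPotential n x₀) x₀ xvr ≤
      2 * n * Real.exp (-(Real.sin (xvr / 2) ^ 2 * n)) := by
  have hπ := Real.pi_pos
  have hU := (isPeakedPotential_cosPotential hn h0 h1).isUnitPotential
  have hA := cosPotential_coeff_pos n
  rw [hU.outsideMass_eq]
  set A := (2 : ℝ) ^ (2 * n) / (2 * Real.pi * ((2 * n).choose n : ℝ)) with hAdef
  have hA2 : A * (2 * Real.pi) ≤ 2 * n := by
    refine le_trans (le_of_eq ?_) (four_pow_div_choose_le hn)
    rw [hAdef, pow_mul]
    have := centralBinom_pos_real n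
    norm_num
    field_simp
  set e := Real.exp (-(Real.sin (xvr / 2) ^ 2 * n)) with he
  have hb : ∀ x ∈ Set.Icc (x₀ + xvr - 2 * Real.pi) (x₀ - xvr), cosPotential n x₀ x ≤ A * e := by
    intro x hx'
    unfold cosPotential
    refine mul_le_mul_of_nonneg_left ?_ hA.le
    have h2 : Real.cos ((x - x₀) / 2) ^ 2 ≤ Real.cos (xvr / 2) ^ 2 := by
      refine sq_le_sq' ?_ ?_
      · rw [← Real.cos_pi_sub, ← Real.cos_neg ((x - x₀) / 2)]
        refine Real.cos_le_cos_of_nonneg_of_le_pi ?_ ?_ ?_ <;> linarith [hx'.1, hx'.2]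
      · rw [← Real.cos_neg ((x - x₀) / 2)]
        refine Real.cos_le_cos_of_nonneg_of_le_pi ?_ ?_ ?_ <;> linarith [hx'.1, hx'.2]
    have h3 : Real.cos (xvr / 2) ^ 2 ≤ Real.exp (-Real.sin (xvr / 2) ^ 2) := by
      have h4 := Real.add_one_le_exp (-Real.sin (xvr / 2) ^ 2)
      have h5 := Real.sin_sq_add_cos_sq (xvr / 2)
      linarith
    rw [pow_mul, he, mul_comm _ (n : ℝ), ← mul_neg, Real.exp_nat_mul]
    exact pow_le_pow_left₀ (sq_nonneg _) (h2.trans h3) n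
  calc ∫ x in (x₀ + xvr - 2 * Real.pi)..(x₀ - xvr), cosPotential n x₀ x
      ≤ ∫ _ in (x₀ + xvr - 2 * Real.pi)..(x₀ - xvr), A * e :=
        intervalIntegral.integral_mono_on (by linarith) (hU.intervalIntegrable _ _)
          intervalIntegrable_const hb
    _ = (2 * Real.pi - 2 * xvr) * (A * e) := by
        rw [intervalIntegral.integral_const, smul_eq_mul]; ring
    _ ≤ 2 * Real.pi * (A * e) := mul_le_mul_of_nonneg_right (by linarith) (by positivity)
    _ = A * (2 * Real.pi) * e := by ring
    _ ≤ _ := mul_le_mul_of_nonneg_right hA2 (Real.exp_pos _).le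

end QuantumClock

namespace QuantumClock

/-! ### The asymptotics for the cosine potential -/

theorem alphaZero_le_one {d : ℕ} {n₀ : ℝ} (hd : 2 ≤ d) : alphaZero d n₀ ≤ 1 := by
  have hd' : (2 : ℝ) ≤ d := by exact_mod_cast hd
  unfold alphaZero
  rw [div_mul_eq_mul_div, div_le_one (by linarith)]
  linarith [min_le_left n₀ ((d : ℝ) - 1 - n₀), min_le_right n₀ ((d : ℝ) - 1 - n₀)]

theorem isPolyBounded_of_le_growth {n : ℕ → ℕ} {c₂ : ℝ}
    (hn : ∀ᶠ d : ℕ in Filter.atTop, (n d : ℝ) ≤ c₂ * growth d) :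
    IsPolyBounded fun d => (n d : ℝ) := by
  refine ((isPolyBounded_const c₂).mul isPolyBounded_natCast).mono ?_
  filter_upwards [hn] with d h
  rw [abs_of_nonneg (Nat.cast_nonneg _), abs_mul, Nat.abs_cast]
  refine h.trans ((mul_le_mul_of_nonneg_right (le_abs_self c₂) (growth_nonneg d)).trans ?_)
  exact mul_le_mul_of_nonneg_left (growth_le d) (abs_nonneg _)

theorem cosDerivBound_nonneg (n : ℕ) : 0 ≤ cosDerivBound n := by
  unfold cosDerivBound
  have := Real.pi_pos
  positivity

theorem IsPolyBounded.cosDerivBound {n : ℕ → ℕ} (hn : IsPolyBounded fun d => (n d : ℝ)) :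
    IsPolyBounded fun d => cosDerivBound (n d) := by
  refine ((isPolyBounded_const (Real.exp 2 / (2 * Real.sqrt Real.pi))).mul (hn.mul hn)).mono
    (Filter.Eventually.of_forall fun d => ?_)
  have h0 : (0 : ℝ) ≤ n d := Nat.cast_nonneg _
  have hs : Real.sqrt (n d) ≤ n d := by
    rcases Nat.eq_zero_or_pos (n d) with h | h
    · simp [h]
    · have h' : (1 : ℝ) ≤ n d := by exact_mod_cast h
      rw [Real.sqrt_le_left h0]
      nlinarith
  rw [cosDerivBound_eq, abs_of_nonneg (by positivity), abs_of_nonneg (by positivity)]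
  exact mul_le_mul_of_nonneg_left (mul_le_mul_of_nonneg_left hs h0) (by positivity)

theorem cosDerivBound_sq (n : ℕ) :
    cosDerivBound n ^ 2 = (Real.exp 2 / (2 * Real.sqrt Real.pi)) ^ 2 * (n : ℝ) ^ 3 := by
  rw [cosDerivBound_eq, mul_pow, mul_pow, Real.sq_sqrt (Nat.cast_nonneg n)]
  ring

/-- The growth of the rate parameter for the cosine potential. -/
theorem exists_rateParam_growth_le {n : ℕ → ℕ} {α₀ : ℕ → ℝ} {α c₂ : ℝ} (hα : 0 < α)
    (hα₀ : ∀ d, 2 ≤ d → α ≤ α₀ d) (hα₁ : ∀ d, 2 ≤ d → α₀ d ≤ 1)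
    (hn : ∀ᶠ d : ℕ in Filter.atTop, (n d : ℝ) ≤ c₂ * growth d) :
    ∃ M : ℝ, 0 < M ∧ ∀ᶠ d : ℕ in Filter.atTop, 1 < Real.pi * α₀ d ^ 2 * d ∧
      0 ≤ rateParam (Real.sqrt d) (α₀ d) (cosDerivBound (n d)) ∧
      (rateParam (Real.sqrt d) (α₀ d) (cosDerivBound (n d)) + 1) ^ 2 * growth d ≤ M * d := by
  have hπ := Real.pi_pos
  set K := (Real.exp 2 / (2 * Real.sqrt Real.pi)) ^ 2 with hK
  have hK0 : 0 ≤ K := sq_nonneg _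
  refine ⟨2 * ((2 * Real.pi) ^ 2 * (K * |c₂| ^ 3)) + 2, by positivity, ?_⟩
  have hlog : Filter.Tendsto (fun d : ℕ => Real.log d) Filter.atTop Filter.atTop :=
    Real.tendsto_log_atTop.comp tendsto_natCast_atTop_atTop
  filter_upwards [hn, Filter.eventually_ge_atTop 2, hlog.eventually_ge_atTop 1,
    hlog.eventually_ge_atTop (-2 * Real.log (Real.pi * α ^ 2))] with d hnd hd hl1 hl2
  have hd' : (2 : ℝ) ≤ d := by exact_mod_cast hd
  have ha := hα₀ d hd
  have ha1 := hα₁ d hd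
  have ha0 : 0 < α₀ d := hα.trans_le ha
  set b := cosDerivBound (n d) with hb
  have hb0 : 0 ≤ b := cosDerivBound_nonneg _
  set X := Real.pi * α₀ d ^ 2 * d with hX
  have hX0 : 0 < X := by positivity
  have hL : Real.log d / 2 ≤ Real.log X := by
    have h1 : Real.log (Real.pi * α ^ 2 * d) ≤ Real.log X := by
      refine Real.log_le_log (by positivity) ?_
      exact mul_le_mul_of_nonneg_right (mul_le_mul_of_nonneg_left
        (pow_le_pow_left₀ hα.le ha 2) hπ.le) (by positivity)
    rw [Real.log_mul (by positivity) (by positivity)] at h1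
    linarith
  have hL0 : 0 < Real.log X := by linarith
  have hX1 : 1 < X := (Real.log_pos_iff hX0.le).1 hL0
  have hσ2 : Real.sqrt d ^ 2 = (d : ℝ) := Real.sq_sqrt (by linarith)
  have hυ : rateParam (Real.sqrt d) (α₀ d) b = Real.pi * α₀ d * kap / Real.log X * b := by
    rw [rateParam, hσ2]
  rw [hυ]
  set υ := Real.pi * α₀ d * kap / Real.log X * b with hυdef
  have hk : 0 ≤ kap ∧ kap ≤ 1 := by unfold kap; norm_num
  have hυ0 : 0 ≤ υ := mul_nonneg (div_nonneg (mul_nonneg (by positivity) hk.1) hL0.le) hb0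
  have hυ1 : υ ≤ 2 * Real.pi * b / Real.log d := by
    have h1 : Real.pi * α₀ d * kap ≤ Real.pi := by
      calc Real.pi * α₀ d * kap ≤ Real.pi * 1 * 1 :=
            mul_le_mul (mul_le_mul_of_nonneg_left ha1 hπ.le) hk.2 hk.1 (by positivity)
        _ = Real.pi := by ring
    have h2 : Real.pi * α₀ d * kap / Real.log X ≤ Real.pi / (Real.log d / 2) :=
      div_le_div₀ hπ.le h1 (by linarith) hL
    calc υ ≤ Real.pi / (Real.log d / 2) * b := mul_le_mul_of_nonneg_right h2 hb0
      _ = _ := by field_simp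
  have hg0 := growth_nonneg d
  have hb2 : b ^ 2 ≤ K * |c₂| ^ 3 * growth d ^ 3 := by
    rw [hb, cosDerivBound_sq, ← hK, mul_assoc, ← mul_pow]
    refine mul_le_mul_of_nonneg_left (pow_le_pow_left₀ (Nat.cast_nonneg _) ?_ 3) hK0
    exact hnd.trans (mul_le_mul_of_nonneg_right (le_abs_self c₂) hg0)
  have hυ2 : υ ^ 2 * growth d ≤ (2 * Real.pi) ^ 2 * (K * |c₂| ^ 3) * d := by
    have hl0 : 0 < Real.log d := by linarith
    calc υ ^ 2 * growth d ≤ (2 * Real.pi * b / Real.log d) ^ 2 * growth d :=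
          mul_le_mul_of_nonneg_right (pow_le_pow_left₀ hυ0 hυ1 2) hg0
      _ = (2 * Real.pi) ^ 2 * b ^ 2 / Real.log d ^ 2 * growth d := by ring
      _ ≤ (2 * Real.pi) ^ 2 * (K * |c₂| ^ 3 * growth d ^ 3) / Real.log d ^ 2 * growth d := by
          refine mul_le_mul_of_nonneg_right ?_ hg0
          exact div_le_div_of_nonneg_right (mul_le_mul_of_nonneg_left hb2 (by positivity))
            (by positivity)
      _ = (2 * Real.pi) ^ 2 * (K * |c₂| ^ 3) * growth d ^ 4 / Real.log d ^ 2 := by ring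
      _ = _ := by rw [growth_pow_four]; field_simp
  refine ⟨hX1, hυ0, ?_⟩
  have h1 : (υ + 1) ^ 2 ≤ 2 * υ ^ 2 + 2 := by nlinarith [sq_nonneg (υ - 1)]
  have h2 := mul_le_mul_of_nonneg_right h1 hg0
  linarith [growth_le d]

theorem epsTwo_sqrt_le {d : ℕ} {α₀ b : ℝ} (hd : 2 ≤ d) (hα₁ : α₀ ≤ 1)
    (hX : 1 < Real.pi * α₀ ^ 2 * d) (hυ : 0 ≤ rateParam (Real.sqrt d) α₀ b)
    (hN : 8 ≤ Real.pi * α₀ ^ 2 / (2 * (rateParam (Real.sqrt d) α₀ b + 1) ^ 2) * d) :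
    0 ≤ epsTwo d (Real.sqrt d) α₀ b ∧ epsTwo d (Real.sqrt d) α₀ b ≤
      (2 * Real.pi) ^ ((5 : ℝ) / 4) * (1 + Real.pi ^ 2 / 8) * Real.sqrt (Real.exp 1 / 2) * d *
        Real.exp (-(Real.pi / 4 * (α₀ ^ 2 / (rateParam (Real.sqrt d) α₀ b + 1) ^ 2 * d))) := by
  have hπ := Real.pi_pos
  have hd' : (2 : ℝ) ≤ d := by exact_mod_cast hd
  have hd0 : (d : ℝ) ≠ 0 := by linarith
  have hσ2 : Real.sqrt d ^ 2 = (d : ℝ) := Real.sq_sqrt (by linarith)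
  have hσ1 : 1 ≤ Real.sqrt d := Real.one_le_sqrt.2 (by linarith)
  have hσd : (d / Real.sqrt d) ^ 2 = (d : ℝ) := by rw [div_pow, hσ2]; field_simp
  have hA := normConst_le_one (d := d) (by omega) (Real.sqrt d)
  have hA0 := (normConst_pos (d := d) (by omega) (Real.sqrt d)).le
  set υ := rateParam (Real.sqrt d) α₀ b with hυdef
  have hN' : 8 ≤ calN d (Real.sqrt d) α₀ b := by
    unfold calN
    rw [hσd, hσ2, div_self hd0, ← hυdef]
    exact Nat.le_floor hN
  unfold epsTwo
  rw [if_pos ⟨hN', by rwa [hσ2]⟩, hσd, hσ2, div_self hd0, ← hυdef, mul_div_cancel_right₀ υ hd0,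
    add_comm 1 υ]
  have hfrac : α₀ / (υ + 1) ≤ 1 := by rw [div_le_one (by linarith)]; linarith
  refine ⟨by positivity, ?_⟩
  have h1 : Real.sqrt d ^ ((3 : ℝ) / 2) ≤ d := by
    calc Real.sqrt d ^ ((3 : ℝ) / 2) ≤ Real.sqrt d ^ (2 : ℝ) :=
          Real.rpow_le_rpow_of_exponent_le hσ1 (by norm_num)
      _ = d := by rw [Real.rpow_two, hσ2]
  have h2 : Real.sqrt (Real.exp 1 / 2 * (α₀ / (υ + 1))) ≤ Real.sqrt (Real.exp 1 / 2) :=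
    Real.sqrt_le_sqrt (mul_le_of_le_one_right (by positivity) hfrac)
  have e : -(Real.pi / 4) * (α₀ ^ 2 / (υ + 1) ^ 2) * d =
      -(Real.pi / 4 * (α₀ ^ 2 / (υ + 1) ^ 2 * d)) := by ring
  rw [e]
  refine mul_le_mul_of_nonneg_right ?_ (Real.exp_pos _).le
  calc (2 * Real.pi) ^ ((5 : ℝ) / 4) * Real.sqrt d ^ ((3 : ℝ) / 2) * normConst d (Real.sqrt d) 0 *
        (1 + Real.pi ^ 2 / 8) * Real.sqrt (Real.exp 1 / 2 * (α₀ / (υ + 1)))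
      ≤ (2 * Real.pi) ^ ((5 : ℝ) / 4) * d * 1 * (1 + Real.pi ^ 2 / 8) *
        Real.sqrt (Real.exp 1 / 2) :=
        mul_le_mul (mul_le_mul_of_nonneg_right (mul_le_mul (mul_le_mul_of_nonneg_left h1
          (by positivity)) hA hA0 (by positivity)) (by positivity)) h2 (by positivity)
          (by positivity)
    _ = _ := by ring

theorem isExpSmall_epsTwo {n : ℕ → ℕ} {α₀ : ℕ → ℝ} {α c₂ : ℝ} (hα : 0 < α)
    (hα₀ : ∀ d, 2 ≤ d → α ≤ α₀ d) (hα₁ : ∀ d, 2 ≤ d → α₀ d ≤ 1)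
    (hn : ∀ᶠ d : ℕ in Filter.atTop, (n d : ℝ) ≤ c₂ * growth d) :
    IsExpSmall fun d => epsTwo d (Real.sqrt d) (α₀ d) (cosDerivBound (n d)) := by
  have hπ := Real.pi_pos
  obtain ⟨M, hM, h⟩ := exists_rateParam_growth_le hα hα₀ hα₁ hn
  refine (IsExpSmall.poly_mul ((isPolyBounded_const ((2 * Real.pi) ^ ((5 : ℝ) / 4) *
    (1 + Real.pi ^ 2 / 8) * Real.sqrt (Real.exp 1 / 2))).mul isPolyBounded_natCast)
    (isExpSmall_exp_neg_growth (c := Real.pi / 4 * (α ^ 2 / M)) (by positivity))).mono ?_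
  filter_upwards [h, Filter.eventually_ge_atTop 2,
    tendsto_growth.eventually_ge_atTop (8 / (Real.pi * (α ^ 2 / M) / 2))] with d hd hd2 hg
  obtain ⟨hX, hυ, hυM⟩ := hd
  have hd' : (2 : ℝ) ≤ d := by exact_mod_cast hd2
  have ha := hα₀ d hd2
  have ha0 : 0 < α₀ d := hα.trans_le ha
  set υ := rateParam (Real.sqrt d) (α₀ d) (cosDerivBound (n d)) with hυdef
  have hkey : α ^ 2 / M * growth d ≤ α₀ d ^ 2 / (υ + 1) ^ 2 * d := by
    rw [div_mul_eq_mul_div, div_mul_eq_mul_div, div_le_div_iff₀ hM (by positivity)]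
    calc α ^ 2 * growth d * (υ + 1) ^ 2 = α ^ 2 * ((υ + 1) ^ 2 * growth d) := by ring
      _ ≤ α₀ d ^ 2 * (M * d) := mul_le_mul (pow_le_pow_left₀ hα.le ha 2) hυM
          (mul_nonneg (by positivity) (growth_nonneg d)) (by positivity)
      _ = _ := by ring
  have hN : 8 ≤ Real.pi * α₀ d ^ 2 / (2 * (υ + 1) ^ 2) * d := by
    rw [div_le_iff₀ (by positivity)] at hg
    calc (8 : ℝ) ≤ growth d * (Real.pi * (α ^ 2 / M) / 2) := hg
      _ = Real.pi / 2 * (α ^ 2 / M * growth d) := by ring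
      _ ≤ Real.pi / 2 * (α₀ d ^ 2 / (υ + 1) ^ 2 * d) :=
          mul_le_mul_of_nonneg_left hkey (by positivity)
      _ = _ := by field_simp
  obtain ⟨h0, h1⟩ := epsTwo_sqrt_le hd2 (hα₁ d hd2) hX hυ hN
  rw [abs_of_nonneg h0, abs_of_nonneg (by positivity)]
  refine h1.trans (mul_le_mul_of_nonneg_left (Real.exp_le_exp.2 (neg_le_neg ?_)) (by positivity))
  rw [mul_assoc]
  exact mul_le_mul_of_nonneg_left hkey (by positivity)

theorem isExpSmall_epsT {n : ℕ → ℕ} {α₀ : ℕ → ℝ} {α c₂ : ℝ} (hα : 0 < α)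
    (hα₀ : ∀ d, 2 ≤ d → α ≤ α₀ d) (hα₁ : ∀ d, 2 ≤ d → α₀ d ≤ 1)
    (hn : ∀ᶠ d : ℕ in Filter.atTop, (n d : ℝ) ≤ c₂ * growth d) :
    IsExpSmall fun d => epsT d (Real.sqrt d) (α₀ d) (cosDerivBound (n d)) := by
  have hπ := Real.pi_gt_three
  have hb := (isPolyBounded_of_le_growth hn).cosDerivBound
  refine (isExpSmall_epsTwo hα hα₀ hα₁ hn).of_abs_le_add (IsExpSmall.poly_mul
    (f := fun d => 2 * (2 * Real.pi * 2 + (cosDerivBound (n d) + 2 * Real.pi) * 2 +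
      (2 * Real.pi + Real.pi * d + 1)))
    ((isPolyBounded_const 2).mul (((isPolyBounded_const (2 * Real.pi * 2)).add
      ((hb.add (isPolyBounded_const (2 * Real.pi))).mul (isPolyBounded_const 2))).add
      (((isPolyBounded_const (2 * Real.pi)).add ((isPolyBounded_const Real.pi).mul
        isPolyBounded_natCast)).add (isPolyBounded_const 1))))
    (isExpSmall_exp_neg (c := Real.pi / 4) (by positivity))) ?_
  filter_upwards [Filter.eventually_ge_atTop 2] with d hd
  have hd' : (2 : ℝ) ≤ d := by exact_mod_cast hd
  have hd0 : (d : ℝ) ≠ 0 := by linarith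
  have hσ2 : Real.sqrt d ^ 2 = (d : ℝ) := Real.sq_sqrt (by linarith)
  have hA := normConst_le_one (d := d) (by omega) (Real.sqrt d)
  have hA0 := (normConst_pos (d := d) (by omega) (Real.sqrt d)).le
  have hb0 := cosDerivBound_nonneg (n d)
  set b := cosDerivBound (n d)
  have e1 : Real.pi * (d : ℝ) / d = Real.pi := by field_simp
  have e2 : Real.pi * (d : ℝ) ^ 2 / d = Real.pi * d := by field_simp
  have e3 : 2 * Real.pi * (d : ℝ) / d = 2 * Real.pi := by field_simp
  have e4 : -(Real.pi / 4) * ((d : ℝ) ^ 2 / d) = -(Real.pi / 4 * d) := by field_simp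
  have hexp : ∀ y : ℝ, 1 ≤ y → 1 / 2 ≤ 1 - Real.exp (-y) := by
    intro y hy
    have h1 : Real.exp (-y) ≤ 1 / 2 := by
      rw [Real.exp_neg, one_div]
      exact inv_anti₀ (by norm_num) (by linarith [Real.add_one_le_exp y])
    linarith
  have hq : ∀ x y : ℝ, 0 ≤ x → 1 ≤ y → 0 ≤ x / (1 - Real.exp (-y)) ∧
      x / (1 - Real.exp (-y)) ≤ x * 2 := by
    intro x y hx hy
    have h1 := hexp y hy
    refine ⟨div_nonneg hx (by linarith), ?_⟩
    rw [div_le_iff₀ (by linarith)]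
    nlinarith
  have hinv : 1 / (d : ℝ) ≤ 1 := by rw [div_le_one (by linarith)]; linarith
  have hinv0 : 0 ≤ 1 / (d : ℝ) := by positivity
  have h2π : 2 * Real.pi / d ≤ 2 * Real.pi := div_le_self (by positivity) (by linarith)
  have h2π0 : 0 ≤ 2 * Real.pi / (d : ℝ) := by positivity
  obtain ⟨q1, q1'⟩ := hq (2 * Real.pi) Real.pi (by positivity) (by linarith)
  obtain ⟨q2, q2'⟩ := hq (b + 2 * Real.pi / d) (Real.pi * d) (by positivity) (by nlinarith)
  have hπd : 0 ≤ Real.pi * d := by positivity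
  unfold epsT
  rw [hσ2, e1, e2, e3, e4]
  set Q1 := 2 * Real.pi / (1 - Real.exp (-Real.pi))
  set Q2 := (b + 2 * Real.pi / d) / (1 - Real.exp (-(Real.pi * d)))
  refine (abs_add_le _ _).trans (add_le_add le_rfl ?_)
  rw [abs_of_nonneg (by positivity), abs_of_nonneg (by positivity)]
  refine mul_le_mul_of_nonneg_right ?_ (Real.exp_pos _).le
  refine mul_le_mul (mul_le_of_le_one_right (by norm_num) hA) ?_ (by positivity) (by norm_num)
  linarith

end QuantumClock

namespace QuantumClock

/-- A bound on the clock error that is uniform over one period. -/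
theorem exists_isExpSmall_epsClock {n : ℕ → ℕ} {α₀ : ℕ → ℝ} {T₀ α c₂ : ℝ} (hT₀ : 0 < T₀)
    (hα : 0 < α) (hα₀ : ∀ d, 2 ≤ d → α ≤ α₀ d) (hα₁ : ∀ d, 2 ≤ d → α₀ d ≤ 1)
    (hn : ∀ᶠ d : ℕ in Filter.atTop, (n d : ℝ) ≤ c₂ * growth d) :
    ∃ F : ℕ → ℝ, IsExpSmall F ∧ ∀ d, 2 ≤ d → ∀ t ∈ Set.Icc 0 T₀,
      |epsClock T₀ d (Real.sqrt d) (α₀ d) (cosDerivBound (n d)) t| ≤ F d := by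
  obtain ⟨f, hf, -, hf'⟩ := exists_isExpSmall_epsNor
  refine ⟨fun d => d * |epsT d (Real.sqrt d) (α₀ d) (cosDerivBound (n d))| +
    (d + 1) * |epsStep d (Real.sqrt d)| + f d,
    ((IsExpSmall.poly_mul isPolyBounded_natCast (isExpSmall_epsT hα hα₀ hα₁ hn).abs).add
      (IsExpSmall.poly_mul (isPolyBounded_natCast.add (isPolyBounded_const 1))
        isExpSmall_epsStep.abs)).add hf, fun d hd t ht => ?_⟩
  have hk : |t| * (d / T₀) ≤ d := by
    rw [abs_of_nonneg ht.1, mul_div_assoc', div_le_iff₀ hT₀, mul_comm]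
    exact mul_le_mul_of_nonneg_left ht.2 (Nat.cast_nonneg d)
  have hk0 : 0 ≤ |t| * (d / T₀) := by positivity
  unfold epsClock
  refine (abs_add_le _ _).trans (add_le_add ((abs_add_le _ _).trans (add_le_add ?_ ?_)) ?_)
  · rw [abs_mul, abs_of_nonneg hk0]
    exact mul_le_mul_of_nonneg_right hk (abs_nonneg _)
  · rw [abs_mul, abs_of_nonneg (by linarith)]
    exact mul_le_mul_of_nonneg_right (by linarith) (abs_nonneg _)
  · rw [epsNor, abs_abs]
    exact hf' d hd T₀ t

theorem isExpSmall_outsideMass_cosPotential {n : ℕ → ℕ} {x₀ xvr c₁ c₂ : ℝ} (h0 : 0 < x₀)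
    (h1 : x₀ < 2 * Real.pi) (hx : 0 < xvr) (hxπ : xvr ≤ Real.pi) (hc₁ : 0 < c₁)
    (hn₁ : ∀ᶠ d : ℕ in Filter.atTop, c₁ * growth d ≤ n d)
    (hn₂ : ∀ᶠ d : ℕ in Filter.atTop, (n d : ℝ) ≤ c₂ * growth d) :
    IsExpSmall fun d => outsideMass (cosPotential (n d) x₀) x₀ xvr := by
  have hs : 0 < Real.sin (xvr / 2) :=
    Real.sin_pos_of_pos_of_lt_pi (by linarith) (by linarith)
  refine (IsExpSmall.poly_mul ((isPolyBounded_const 2).mul (isPolyBounded_of_le_growth hn₂))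
    (isExpSmall_exp_neg_growth (c := Real.sin (xvr / 2) ^ 2 * c₁) (by positivity))).mono ?_
  filter_upwards [hn₁, tendsto_growth.eventually_gt_atTop 0] with d hd hg
  have hn : 1 ≤ n d := by
    have : (0 : ℝ) < n d := (mul_pos hc₁ hg).trans_le hd
    exact_mod_cast this
  have hU := (isPeakedPotential_cosPotential hn h0 h1).isUnitPotential
  rw [abs_of_nonneg (hU.outsideMass_nonneg hxπ), abs_of_nonneg (by positivity)]
  refine (outsideMass_cosPotential_le hn h0 h1 hx hxπ).trans
    (mul_le_mul_of_nonneg_left (Real.exp_le_exp.2 (neg_le_neg ?_)) (by positivity))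
  rw [mul_assoc]
  exact mul_le_mul_of_nonneg_left hd (by positivity)

theorem IsExpSmall.epsS {ε : ℕ → ℝ} {γ : ℝ} (hε : IsExpSmall ε) (T₀ : ℝ) (hγ : 0 < γ) :
    IsExpSmall fun d => epsS T₀ d (Real.sqrt d) γ (ε d) := by
  have hc := isPolyBounded_const
  have hp := hε.isPolyBounded
  unfold QuantumClock.epsS
  simp only [epsVBound_eq]
  exact (IsExpSmall.poly_mul (hc (4 * Real.pi))
    ((IsExpSmall.poly_mul (hc (1 + 2 * Real.pi)) (isExpSmall_geomTail hγ)).add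
      ((IsExpSmall.poly_mul (hc 2) hε).mul_poly
        ((hc 1).add ((hc (8 * Real.pi)).mul hp))))).add
    ((IsExpSmall.poly_mul (hc (2 * Real.pi * T₀)) hε).mul_poly
      (((hc (2 * Real.pi * T₀)).mul hp).add (hc 1)))

/-- The total error bound for the cosine potential, uniformly over one period. -/
theorem exists_total_error_le {n : ℕ → ℕ} {n₀ : ℕ → ℝ} {T₀ x₀ xvr γ α c₁ c₂ : ℝ} (hT₀ : 0 < T₀)
    (hw : IsWindow x₀ xvr γ) (hα : 0 < α) (hα₀ : ∀ d, 2 ≤ d → α ≤ alphaZero d (n₀ d))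
    (hc₁ : 0 < c₁) (hn₁ : ∀ᶠ d : ℕ in Filter.atTop, c₁ * growth d ≤ n d)
    (hn₂ : ∀ᶠ d : ℕ in Filter.atTop, (n d : ℝ) ≤ c₂ * growth d) :
    ∃ (c C : ℝ) (p : ℕ), 0 < c ∧ ∀ᶠ d : ℕ in Filter.atTop,
      0 < kappaTilde d γ ∧ ∀ t ∈ Set.Icc 0 T₀,
        2 * epsClock T₀ d (Real.sqrt d) (alphaZero d (n₀ d)) (cosDerivBound (n d)) t +
            epsClock T₀ d (Real.sqrt d) (alphaZero d (n₀ d)) (cosDerivBound (n d)) t ^ 2 +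
            epsS T₀ d (Real.sqrt d) γ (outsideMass (cosPotential (n d) x₀) x₀ xvr) ≤
          C * (d : ℝ) ^ p * Real.exp (-(c * growth d)) := by
  have hπ := Real.pi_pos
  obtain ⟨hx, hxπ, hγ, hγ1, hw1, hw2⟩ := hw
  have hπγ : 0 < Real.pi * γ := by positivity
  obtain ⟨F, hF, hF'⟩ := exists_isExpSmall_epsClock hT₀ hα hα₀ (fun d hd => alphaZero_le_one hd) hn₂
  have hε := isExpSmall_outsideMass_cosPotential (x₀ := x₀) (by linarith) (by linarith) hx hxπ hc₁
    hn₁ hn₂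
  obtain ⟨c, C, p, hc, h⟩ := ((IsExpSmall.poly_mul (isPolyBounded_const 2) hF).add
    (IsExpSmall.poly_mul hF.isPolyBounded hF)).add (hε.epsS T₀ hγ)
  refine ⟨c, C, p, hc, ?_⟩
  filter_upwards [h, eventually_kappaTilde_pos hγ, Filter.eventually_ge_atTop 2] with d hd hκ hd2
  refine ⟨hκ, fun t ht => le_trans ?_ ((le_abs_self _).trans hd)⟩
  have h1 := hF' d hd2 t ht
  have h2 := pow_le_pow_left₀ (abs_nonneg _) h1 2
  rw [sq_abs] at h2
  have h3 := (le_abs_self _).trans h1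
  rw [← sq]
  linarith

end QuantumClock

theorem mainTheorem6 :
    -- the explicit bound on `ε_V` before and after the peak window
    (∀ (T₀ : ℝ) (d : ℕ) (σ n₀ : ℝ) (V₀ : ℝ → ℝ) (x₀ xvr γ : ℝ),
      0 < T₀ → 0 < σ → σ < d → 0 < n₀ → n₀ < (d : ℝ) - 1 →
      QuantumClock.IsPeakedPotential V₀ x₀ → QuantumClock.IsWindow x₀ xvr γ →
      0 < QuantumClock.kappaTilde d γ →
      ∀ t : ℝ,
        ((0 ≤ t * (2 * Real.pi) / T₀ ∧ t * (2 * Real.pi) / T₀ ≤ x₀ - xvr - Real.pi * γ) ∨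
          (x₀ + xvr + Real.pi * γ ≤ t * (2 * Real.pi) / T₀ ∧
            t * (2 * Real.pi) / T₀ ≤ 2 * Real.pi + x₀ - xvr - Real.pi * γ)) →
        QuantumClock.epsV T₀ V₀ d σ n₀ 0 t ≤
          QuantumClock.epsVBound d σ γ (QuantumClock.outsideMass V₀ x₀ xvr)) ∧
    -- the bound on the trace norm between the pulse-driven and the autonomous system state
    (∀ (T₀ : ℝ) (d : ℕ) (σ n₀ b : ℝ) (V₀ : ℝ → ℝ) (x₀ xvr γ : ℝ),
      0 < T₀ → 0 < σ → σ < d → 0 < n₀ → n₀ < (d : ℝ) - 1 →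
      QuantumClock.IsPeakedPotential V₀ x₀ → QuantumClock.IsWindow x₀ xvr γ →
      QuantumClock.IsDerivBound (fun x => Real.pi * V₀ x) b →
      ∀ (dS : ℕ) (Hs Hint ρ : Matrix (Fin dS) (Fin dS) ℂ) (g : ℝ → ℝ),
        QuantumClock.IsSystem Hs Hint ρ →
        QuantumClock.IsPulse g (QuantumClock.startTime T₀ x₀ xvr γ)
          (QuantumClock.stopTime T₀ x₀ xvr γ) →
        ∀ t ∈ Set.Icc 0 (QuantumClock.startTime T₀ x₀ xvr γ) ∪
            Set.Icc (QuantumClock.stopTime T₀ x₀ xvr γ) T₀,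
          (QuantumClock.traceNorm
              (QuantumClock.pulseState g (QuantumClock.startTime T₀ x₀ xvr γ) Hs Hint ρ t -
                QuantumClock.autonomousState T₀ V₀ d σ n₀ Hs Hint ρ t) ≤
            QuantumClock.systemFactor ρ *
              (2 * QuantumClock.epsClock T₀ d σ (QuantumClock.alphaZero d n₀) b t +
                QuantumClock.epsClock T₀ d σ (QuantumClock.alphaZero d n₀) b t ^ 2 +
                (QuantumClock.epsV T₀ V₀ d σ n₀ 0 t +
                  2 * Real.pi * QuantumClock.outsideMass V₀ x₀ xvr *
                    (2 * Real.pi * QuantumClock.outsideMass V₀ x₀ xvr + 1)))) ∧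
          (0 < QuantumClock.kappaTilde d γ →
            QuantumClock.traceNorm
              (QuantumClock.pulseState g (QuantumClock.startTime T₀ x₀ xvr γ) Hs Hint ρ t -
                QuantumClock.autonomousState T₀ V₀ d σ n₀ Hs Hint ρ t) ≤
            QuantumClock.systemFactor ρ *
              (2 * QuantumClock.epsClock T₀ d σ (QuantumClock.alphaZero d n₀) b t +
                QuantumClock.epsClock T₀ d σ (QuantumClock.alphaZero d n₀) b t ^ 2 +
                QuantumClock.epsS T₀ d σ γ (QuantumClock.outsideMass V₀ x₀ xvr)))) ∧
    -- the cosine potential, with width `σ = √d`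
    (∀ (T₀ x₀ xvr γ α c₁ c₂ : ℝ) (n₀ : ℕ → ℝ) (n : ℕ → ℕ),
      0 < T₀ → QuantumClock.IsWindow x₀ xvr γ → 0 < α →
      (∀ d : ℕ, 2 ≤ d → 0 < n₀ d ∧ n₀ d < (d : ℝ) - 1 ∧ α ≤ QuantumClock.alphaZero d (n₀ d)) →
      0 < c₁ →
      (∀ᶠ d : ℕ in Filter.atTop,
        c₁ * ((d : ℝ) ^ ((1 : ℝ) / 4) * Real.sqrt (Real.log d)) ≤ n d ∧
          (n d : ℝ) ≤ c₂ * ((d : ℝ) ^ ((1 : ℝ) / 4) * Real.sqrt (Real.log d))) →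
      (∀ N : ℕ, 1 ≤ N →
        QuantumClock.IsPeakedPotential (QuantumClock.cosPotential N x₀) x₀ ∧
          QuantumClock.IsDerivBound (fun x => Real.pi * QuantumClock.cosPotential N x₀ x)
            (QuantumClock.cosDerivBound N)) ∧
      (∃ (c C : ℝ) (p : ℕ), 0 < c ∧ ∀ᶠ d : ℕ in Filter.atTop,
        0 < QuantumClock.kappaTilde d γ ∧ ∀ t ∈ Set.Icc 0 T₀,
          2 * QuantumClock.epsClock T₀ d (Real.sqrt d) (QuantumClock.alphaZero d (n₀ d))
                (QuantumClock.cosDerivBound (n d)) t +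
              QuantumClock.epsClock T₀ d (Real.sqrt d) (QuantumClock.alphaZero d (n₀ d))
                (QuantumClock.cosDerivBound (n d)) t ^ 2 +
              QuantumClock.epsS T₀ d (Real.sqrt d) γ
                (QuantumClock.outsideMass (QuantumClock.cosPotential (n d) x₀) x₀ xvr) ≤
            C * (d : ℝ) ^ p *
              Real.exp (-(c * ((d : ℝ) ^ ((1 : ℝ) / 4) * Real.sqrt (Real.log d))))) ∧
      (∀ m δ : ℝ, 0 < m → 0 < δ → ∀ᶠ d : ℕ in Filter.atTop,
        ∀ (dS : ℕ) (Hs Hint ρ : Matrix (Fin dS) (Fin dS) ℂ) (g : ℝ → ℝ),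
          QuantumClock.IsSystem Hs Hint ρ →
          QuantumClock.IsPulse g (QuantumClock.startTime T₀ x₀ xvr γ)
            (QuantumClock.stopTime T₀ x₀ xvr γ) →
          ∀ t ∈ Set.Icc 0 (QuantumClock.startTime T₀ x₀ xvr γ) ∪
              Set.Icc (QuantumClock.stopTime T₀ x₀ xvr γ) T₀,
            QuantumClock.traceNorm
                (QuantumClock.pulseState g (QuantumClock.startTime T₀ x₀ xvr γ) Hs Hint ρ t -
                  QuantumClock.autonomousState T₀ (QuantumClock.cosPotential (n d) x₀) d
                    (Real.sqrt d) (n₀ d) Hs Hint ρ t) * (d : ℝ) ^ m ≤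
              QuantumClock.systemFactor ρ * δ)) := by
  refine ⟨?_, ?_, ?_⟩
  · intro T₀ d σ n₀ V₀ x₀ xvr γ _ hσ _ hn₀ hn₀' hV hw hκ t ht
    have hd : 2 ≤ d := by
      have : (1 : ℝ) < d := by linarith
      exact_mod_cast this
    exact QuantumClock.epsV_le_epsVBound hd hσ hV.isUnitPotential hw hκ ht
  · intro T₀ d σ n₀ b V₀ x₀ xvr γ hT₀ hσ hσd hn₀ hn₀' hV hw hb dS Hs Hint ρ g hsys hg t ht
    exact ⟨QuantumClock.traceNorm_le_epsV hT₀ hσ hσd hn₀ hn₀' hV hw hb hsys hg ht,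
      QuantumClock.traceNorm_le_epsS hT₀ hσ hσd hn₀ hn₀' hV hw hb hsys hg ht⟩
  · intro T₀ x₀ xvr γ α c₁ c₂ n₀ n hT₀ hw hα hn₀ hc₁ hn
    have hπ := Real.pi_pos
    have hπγ : 0 < Real.pi * γ := mul_pos hπ hw.2.2.1
    have hx₀ : 0 < x₀ := by linarith [hw.1, hw.2.2.2.2.1]
    have hx₀' : x₀ < 2 * Real.pi := by linarith [hw.1, hw.2.2.2.2.2]
    have hpot : ∀ N : ℕ, 1 ≤ N →
        QuantumClock.IsPeakedPotential (QuantumClock.cosPotential N x₀) x₀ ∧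
          QuantumClock.IsDerivBound (fun x => Real.pi * QuantumClock.cosPotential N x₀ x)
            (QuantumClock.cosDerivBound N) := fun N hN =>
      ⟨QuantumClock.isPeakedPotential_cosPotential hN hx₀ hx₀',
        QuantumClock.isDerivBound_cosPotential hN x₀⟩
    have hn₁ : ∀ᶠ d : ℕ in Filter.atTop, c₁ * QuantumClock.growth d ≤ n d :=
      hn.mono fun _ h => h.1
    obtain ⟨c, C, p, hc, h⟩ := QuantumClock.exists_total_error_le hT₀ hw hα
      (fun d hd => (hn₀ d hd).2.2) hc₁ hn₁ (hn.mono fun _ h => h.2)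
    refine ⟨hpot, ⟨c, C, p, hc, h⟩, fun m δ _ hδ => ?_⟩
    filter_upwards [h, hn₁, Filter.eventually_ge_atTop 2,
      QuantumClock.tendsto_growth.eventually_gt_atTop 0,
      (QuantumClock.tendsto_pow_mul_exp_neg_growth hc C p m).eventually_le_const hδ]
      with d hd hnd hd2 hg hlim dS Hs Hint ρ g hsys hpulse t ht
    have hd' : (2 : ℝ) ≤ d := by exact_mod_cast hd2
    have hN : 1 ≤ n d := by
      have : (0 : ℝ) < n d := (mul_pos hc₁ hg).trans_le hnd
      exact_mod_cast this
    have hσ : 0 < Real.sqrt d := Real.sqrt_pos.2 (by linarith)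
    have hσd : Real.sqrt d < d := by
      rw [Real.sqrt_lt' (by linarith)]
      nlinarith
    have htT : t ∈ Set.Icc 0 T₀ := by
      have h0 := (QuantumClock.off_peak_of_mem hT₀ hw ht).1
      refine ⟨h0, ?_⟩
      rcases ht with ht | ht
      · refine ht.2.trans ?_
        unfold QuantumClock.startTime
        rw [div_le_iff₀ (by positivity)]
        exact mul_le_mul_of_nonneg_left (by linarith [hw.1]) hT₀.le
      · exact ht.2
    have hbound := QuantumClock.traceNorm_le_epsS hT₀ hσ hσd (hn₀ d hd2).1 (hn₀ d hd2).2.1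
      (hpot (n d) hN).1 hw (hpot (n d) hN).2 hsys hpulse ht hd.1
    have hs := QuantumClock.systemFactor_nonneg ρ
    have hm : (0 : ℝ) ≤ (d : ℝ) ^ m := by positivity
    calc _ ≤ QuantumClock.systemFactor ρ *
          (C * (d : ℝ) ^ p * Real.exp (-(c * QuantumClock.growth d))) * (d : ℝ) ^ m :=
          mul_le_mul_of_nonneg_right
            (hbound.trans (mul_le_mul_of_nonneg_left (hd.2 t htT) hs)) hm
      _ = QuantumClock.systemFactor ρ *
          (C * (d : ℝ) ^ p * Real.exp (-(c * QuantumClock.growth d)) * (d : ℝ) ^ m) := by ring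
      _ ≤ _ := mul_le_mul_of_nonneg_left hlim hs
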